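/- Let $k,s,b\ge 1$ be integers, and let $\Delta_{k,s}$ be the set of vectors $\mathbf q\in\mathbb Z_{\ge0}^k$ with $q_1+\dots+q_k=s$. An urn contains balls of $k$ colors; at each step an unordered sample of $s$ balls is drawn, either always without replacement (multivariate hypergeometric sample $\mathbf q$) or always with replacement (multinomial sample $\mathbf q$), the sample is put back, and $m_{\mathbf q,j}\in\mathbb Z$ balls of color $j$ are added for $j=1,\dots,k$. The scheme is a $(k,s,b)$-urn: - it is balanced: $\sum_j m_{\mathbf q,j}=b$ for all $\mathbf q\in\Delta_{k,s}$; - its core $\mathbf A=(m_{s\mathbf e_i,j})_{i,j\in[k]}$ has nonnegative off-diagonal entries and diagonal entries $\ge -s$; - it is tenable: along every possible sequence of draws from the initial composition $\mathbf X_0\in\mathbb Z_{\ge0}^k$, no color count becomes negative and a further sample can always be drawn. Assume that the scheme is affine, i.e. for every total number $\tau$ of balls there is a real $k\times k$ matrix $\mathbf C$ such that, from every composition $\mathbf x\in\mathbb Z_{\ge0}^k$ with $\tau$ balls (row vector) from which a sample can be drawn, the mean composition after one draw is $\mathbf x\mathbf C$. Assume also that $\mathbf A$ is irreducible (the directed graph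 on $[k]$ with an edge $i\to j$ for every nonzero off-diagonal entry $a_{ij}$ is strongly connected). Let $\mathbf X_n$ be the (row) composition vector after $n$ draws and $\boldsymbol\Sigma_n$ its covariance matrix. Let $\lambda_1=b,\lambda_2,\dots,\lambda_k$ be the eigenvalues of $\mathbf A$ with algebraic multiplicity, in decreasing order of real part, and let $\Lambda=\operatorname{Re}(\lambda_2)/\lambda_1$ be the core index (for $k=1$ put $\Lambda=0$). For an eigenvalue $\lambda$ let $\mathbf P_\lambda$ be the projection of $\mathbb C^k$ onto the generalized eigenspace of $\mathbf A$ at $\lambda$ along the sum of the other generalized eigenspaces, let $\mathbf N_\lambda=\mathbf A\mathbf P_\lambda-\lambda\mathbf P_\lambda$, let $\nu_\lambda\ge 0$ be the least integer with $\mathbf N_\lambda^{\nu_\lambda+1}=\mathbf 0$, and let $\nu_2=\max\{\nu_\lambda:\lambda\in\{\lambda_2,\dots,\lambda_k\},\ \operatorname{Re}\lambda=\operatorname{Re}\lambda_2\}$. Let $\mathbf v_1$ be the row vector with $\mathbf v_1\mathbf A=b\,\mathbf v_1$ whose components have sum $1$, and put $$\hat{\mathbf P}=\mathbf I-\mathbf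 P_{\lambda_1},\qquad \boldsymbol{\mathcal Q}=s(s-1)\,\mathbf v_1^T\mathbf v_1+s\,\mathbf{diag}(\mathbf v_1),\qquad \mathbf B=\frac1{s^2}\,\mathbf A^T\boldsymbol{\mathcal Q}\,\mathbf A .$$ Then, both for sampling without replacement and for sampling with replacement, as $n\to\infty$: 1. If $\Lambda<\tfrac12$, then $$\frac1n\,\boldsymbol\Sigma_n\;\longrightarrow\;\boldsymbol\Sigma_{(\mathbf A)}:=b\int_0^\infty e^{t\mathbf A^T}\,\hat{\mathbf P}^T\,\mathbf B\,\hat{\mathbf P}\,e^{t\mathbf A}\,e^{-bt}\,dt,$$ where the integral converges absolutely. 2. If $\Lambda=\tfrac12$, then $$\frac1{n\,(\ln n)^{2\nu_2+1}}\,\boldsymbol\Sigma_n\;\longrightarrow\;\frac1{b^{2\nu_2}(2\nu_2+1)(\nu_2!)^2}\sum_{\operatorname{Re}\lambda=b/2}(\mathbf N_\lambda^*)^{\nu_2}\,\mathbf P_\lambda^*\,\mathbf B\,\mathbf P_\lambda\,\mathbf N_\lambda^{\nu_2},$$ where the sum is over the distinct eigenvalues $\lambda$ of $\mathbf A$ with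 real part $b/2$ and $^*$ denotes the conjugate transpose. -/

import Mathlib

open Matrix MeasureTheory ProbabilityTheory Filter Topology

namespace MultiDrawUrn

/-! ### The urn -/

/-- The two ways of drawing the sample. -/
inductive Sampling
  | withoutReplacement
  | withReplacement

/-- The discrete simplex of all samples: vectors of `k` natural numbers with sum `s`. -/
def samples (k s : ℕ) : Finset (Fin k → ℕ) := Finset.piAntidiag Finset.univ s

/-- The probability of drawing the sample `q` of size `s` from an urn that holds `x i` balls of
each color `i`: multivariate hypergeometric for draws without replacement, multinomial for draws
with replacement. -/
noncomputable def drawProb {k : ℕ} (mode : Sampling) (s : ℕ) (x q : Fin k → ℕ) : ℝ :=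
  if q ∈ samples k s then
    match mode with
    | .withoutReplacement => (∏ i, ((x i).choose (q i) : ℝ)) / ((∑ i, x i).choose s : ℝ)
    | .withReplacement =>
        (Nat.multinomial Finset.univ q : ℝ) * (∏ i, (x i : ℝ) ^ q i) / ((∑ i, x i : ℕ) : ℝ) ^ s
  else 0

/-- The number of balls that must be in the urn for a sample of size `s` to be drawn. -/
def minSize (mode : Sampling) (s : ℕ) : ℕ :=
  match mode with
  | .withoutReplacement => s
  | .withReplacement => 1

/-- The composition after `n` draws, from the initial composition `x₀`, when the successive
samples are `h 0, h 1, …` and `M q j` balls of color `j` are added upon drawing `q`. -/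
def composition {k : ℕ} (M : (Fin k → ℕ) → Fin k → ℤ) (x₀ : Fin k → ℕ) (h : ℕ → Fin k → ℕ)
    (n : ℕ) : Fin k → ℤ :=
  fun j => (x₀ j : ℤ) + ∑ i ∈ Finset.range n, M (h i) j

/-- A composition read as a vector of natural numbers (used only where it is nonnegative). -/
def counts {k : ℕ} (x : Fin k → ℤ) : Fin k → ℕ := fun i => (x i).toNat

/-- No matter which sequence of possible samples is drawn, no color count ever gets negative and
the next sample can always be drawn. -/
def IsTenable {k : ℕ} (mode : Sampling) (s : ℕ) (M : (Fin k → ℕ) → Fin k → ℤ)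
    (x₀ : Fin k → ℕ) : Prop :=
  ∀ (h : ℕ → Fin k → ℕ) (n : ℕ),
    (∀ i < n, 0 < drawProb mode s (counts (composition M x₀ h i)) (h i)) →
      (∀ j, 0 ≤ composition M x₀ h n j) ∧ (minSize mode s : ℤ) ≤ ∑ j, composition M x₀ h n j

/-- The core: row `i` is the row of the replacement matrix for a sample of `s` balls of color
`i`. -/
def core {k : ℕ} (s : ℕ) (M : (Fin k → ℕ) → Fin k → ℤ) : Matrix (Fin k) (Fin k) ℤ :=
  Matrix.of fun i j => M (Pi.single i s) j

/-- A tenable balanced urn on `k` colors with sample size `s`, balance factor `b`, replacement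
matrix `M` (only its rows labelled by samples matter) and initial composition `x₀`. -/
structure IsUrn {k : ℕ} (mode : Sampling) (s b : ℕ) (M : (Fin k → ℕ) → Fin k → ℤ)
    (x₀ : Fin k → ℕ) : Prop where
  one_le_s : 1 ≤ s
  one_le_b : 1 ≤ b
  balanced : ∀ q ∈ samples k s, ∑ j, M q j = b
  core_offDiag : ∀ i j, i ≠ j → 0 ≤ core s M i j
  core_diag : ∀ i, -(s : ℤ) ≤ core s M i i
  tenable : IsTenable mode s M x₀

/-- The scheme is affine: for each total number `τ` of balls there is a real matrix `C` such that
one draw from any composition `x` with `τ` balls leads to the mean composition `x C`. -/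
def IsAffine {k : ℕ} (mode : Sampling) (s : ℕ) (M : (Fin k → ℕ) → Fin k → ℤ) : Prop :=
  ∀ τ : ℕ, ∃ C : Matrix (Fin k) (Fin k) ℝ, ∀ x : Fin k → ℕ, ∑ i, x i = τ →
    ∀ j, (x j : ℝ) + ∑ q ∈ samples k s, drawProb mode s x q * (M q j : ℝ)
      = ((fun i => (x i : ℝ)) ᵥ* C) j

/-- The core is irreducible. Its off-diagonal entries are nonnegative and its diagonal entries are
at least `-s`; adding a multiple of the identity, which does not affect irreducibility, makes it
a nonnegative matrix. -/
def IsIrreducibleCore {k : ℕ} (s : ℕ) (A : Matrix (Fin k) (Fin k) ℤ) : Prop :=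
  (A.map (fun a => (a : ℝ)) + (s : ℝ) • (1 : Matrix (Fin k) (Fin k) ℝ)).IsIrreducible

/-- `Q n` is the sample at draw `n + 1` of the urn grown from `x₀`: given the first `n` samples,
it has the conditional law `drawProb` at the current composition. -/
structure IsDrawSequence {k : ℕ} (mode : Sampling) (s : ℕ) (M : (Fin k → ℕ) → Fin k → ℤ)
    (x₀ : Fin k → ℕ) {Ω : Type*} [MeasurableSpace Ω] (μ : Measure Ω)
    (Q : ℕ → Ω → Fin k → ℕ) : Prop where
  measurable : ∀ n, Measurable (Q n)
  law : ∀ (n : ℕ) (h : ℕ → Fin k → ℕ) (q : Fin k → ℕ),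
    μ.real {ω | (∀ i < n, Q i ω = h i) ∧ Q n ω = q}
      = μ.real {ω | ∀ i < n, Q i ω = h i} * drawProb mode s (counts (composition M x₀ h n)) q

/-- The composition vector `X_n` of the urn with samples `Q`. -/
def compositionVector {k : ℕ} (M : (Fin k → ℕ) → Fin k → ℤ) (x₀ : Fin k → ℕ) {Ω : Type*}
    (Q : ℕ → Ω → Fin k → ℕ) (n : ℕ) (ω : Ω) : Fin k → ℤ :=
  composition M x₀ (fun i => Q i ω) n

/-- The covariance matrix `Σ_n` of `X_n`, with its (real) entries regarded as complex numbers. -/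
noncomputable def covMatrix {k : ℕ} (M : (Fin k → ℕ) → Fin k → ℤ) (x₀ : Fin k → ℕ) {Ω : Type*}
    [MeasurableSpace Ω] (μ : Measure Ω) (Q : ℕ → Ω → Fin k → ℕ) (n : ℕ) :
    Matrix (Fin k) (Fin k) ℂ :=
  Matrix.of fun i j =>
    ((covariance (fun ω => (compositionVector M x₀ Q n ω i : ℝ))
      (fun ω => (compositionVector M x₀ Q n ω j : ℝ)) μ : ℝ) : ℂ)

/-! ### Spectral decomposition of a complex square matrix -/

/-- The generalized eigenspace of `A` at `z`, as a space of column vectors. -/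
noncomputable def genEigenspace {k : ℕ} (A : Matrix (Fin k) (Fin k) ℂ) (z : ℂ) :
    Submodule ℂ (Fin k → ℂ) :=
  Module.End.maxGenEigenspace (Matrix.toLin' A) z

/-- Each generalized eigenspace is complementary to the sum of the other ones. -/
theorem isCompl_genEigenspace {k : ℕ} (A : Matrix (Fin k) (Fin k) ℂ) (z : ℂ) :
    IsCompl (genEigenspace A z) (⨆ w, ⨆ _ : w ≠ z, genEigenspace A w) := by
  constructor
  · exact Module.End.independent_maxGenEigenspace (Matrix.toLin' A) z
  · rw [codisjoint_iff, eq_top_iff, ← Module.End.iSup_maxGenEigenspace_eq_top (Matrix.toLin' A)]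
    refine iSup_le fun w => ?_
    by_cases hw : w = z
    · subst hw
      exact le_sup_left
    · exact le_sup_of_le_right (le_iSup₂_of_le w hw le_rfl)

/-- `P_z`, the projection onto the generalized eigenspace at `z` along the other ones (it is zero
when `z` is not an eigenvalue). -/
noncomputable def specProj {k : ℕ} (A : Matrix (Fin k) (Fin k) ℂ) (z : ℂ) :
    Matrix (Fin k) (Fin k) ℂ :=
  LinearMap.toMatrix' (Submodule.projection _ _ (isCompl_genEigenspace A z))

/-- `N_z`, the nilpotent part: `A P_z = z P_z + N_z`. -/
noncomputable def specNil {k : ℕ} (A : Matrix (Fin k) (Fin k) ℂ) (z : ℂ) :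
    Matrix (Fin k) (Fin k) ℂ :=
  A * specProj A z - z • specProj A z

/-- `ν_z`, the least `ν` with `N_z ^ (ν + 1) = 0`. -/
noncomputable def nilIndex {k : ℕ} (A : Matrix (Fin k) (Fin k) ℂ) (z : ℂ) : ℕ :=
  sInf {ν : ℕ | specNil A z ^ (ν + 1) = 0}

/-! ### Quantities derived from a core whose rows all have sum `b` -/

/-- The core as a complex matrix. -/
def coreC {k : ℕ} (A : Matrix (Fin k) (Fin k) ℤ) : Matrix (Fin k) (Fin k) ℂ :=
  A.map (fun a => (a : ℂ))

/-- The eigenvalues `λ₂, …, λ_k`, with algebraic multiplicity, that are left when one copy of the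
principal eigenvalue `λ₁ = b` is removed. -/
noncomputable def otherEigenvalues {k : ℕ} (b : ℕ) (A : Matrix (Fin k) (Fin k) ℤ) : Multiset ℂ :=
  (coreC A).charpoly.roots.erase (b : ℂ)

/-- `Re λ₂`, the largest real part among `λ₂, …, λ_k` (zero when `k = 1`). -/
noncomputable def secondRe {k : ℕ} (b : ℕ) (A : Matrix (Fin k) (Fin k) ℤ) : ℝ :=
  sSup {r : ℝ | ∃ z ∈ otherEigenvalues b A, z.re = r}

/-- The core index `Λ = Re λ₂ / λ₁`. -/
noncomputable def coreIndex {k : ℕ} (b : ℕ) (A : Matrix (Fin k) (Fin k) ℤ) : ℝ :=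
  secondRe b A / b

/-- `ν₂`, the largest `ν_z` among the eigenvalues `z` with real part `Re λ₂`. -/
noncomputable def nuTwo {k : ℕ} (b : ℕ) (A : Matrix (Fin k) (Fin k) ℤ) : ℕ :=
  ((otherEigenvalues b A).toFinset.filter (fun z => z.re = secondRe b A)).sup
    (nilIndex (coreC A))

open Classical in
/-- The principal left eigenvector `v₁`: the row vector with `v₁ A = b v₁` whose components have
sum one. -/
noncomputable def principalVec {k : ℕ} (b : ℕ) (A : Matrix (Fin k) (Fin k) ℤ) : Fin k → ℝ :=
  if hv : ∃ v : Fin k → ℝ, v ᵥ* A.map (fun a => (a : ℝ)) = (b : ℝ) • v ∧ ∑ i, v i = 1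
  then Classical.choose hv else 0

/-- `𝒬 = s (s - 1) v₁ᵀ v₁ + s diag(v₁)`. -/
noncomputable def matQ {k : ℕ} (s b : ℕ) (A : Matrix (Fin k) (Fin k) ℤ) :
    Matrix (Fin k) (Fin k) ℝ :=
  ((s : ℝ) * ((s : ℝ) - 1)) • Matrix.vecMulVec (principalVec b A) (principalVec b A)
    + (s : ℝ) • Matrix.diagonal (principalVec b A)

/-- `B = Aᵀ 𝒬 A / s²`. -/
noncomputable def matB {k : ℕ} (s b : ℕ) (A : Matrix (Fin k) (Fin k) ℤ) :
    Matrix (Fin k) (Fin k) ℂ :=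
  (1 / (s : ℂ) ^ 2) • ((coreC A)ᵀ * (matQ s b A).map (fun r => (r : ℂ)) * coreC A)

/-- `P̂ = I - P_{λ₁}`. -/
noncomputable def projHat {k : ℕ} (b : ℕ) (A : Matrix (Fin k) (Fin k) ℤ) :
    Matrix (Fin k) (Fin k) ℂ :=
  1 - specProj (coreC A) (b : ℂ)

/-- The integrand `e^{tAᵀ} P̂ᵀ B P̂ e^{tA} e^{-bt}`. -/
noncomputable def sigmaIntegrand {k : ℕ} (s b : ℕ) (A : Matrix (Fin k) (Fin k) ℤ) (t : ℝ) :
    Matrix (Fin k) (Fin k) ℂ :=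
  Complex.exp (-((b : ℂ) * (t : ℂ))) •
    (NormedSpace.exp ((t : ℂ) • (coreC A)ᵀ) * (projHat b A)ᵀ * matB s b A * projHat b A
      * NormedSpace.exp ((t : ℂ) • coreC A))

/-- `Σ_(A)`: `b` times the entrywise integral of the integrand over the positive half-line. -/
noncomputable def sigmaSmall {k : ℕ} (s b : ℕ) (A : Matrix (Fin k) (Fin k) ℤ) :
    Matrix (Fin k) (Fin k) ℂ :=
  Matrix.of fun i j => (b : ℂ) * ∫ t in Set.Ioi (0 : ℝ), sigmaIntegrand s b A t i j

/-- The limit matrix of the critical case; the sum runs over the distinct eigenvalues of real part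
`b / 2`. -/
noncomputable def sigmaCritical {k : ℕ} (s b : ℕ) (A : Matrix (Fin k) (Fin k) ℤ) :
    Matrix (Fin k) (Fin k) ℂ :=
  (1 / ((b : ℂ) ^ (2 * nuTwo b A) * (2 * (nuTwo b A : ℂ) + 1)
      * ((nuTwo b A).factorial : ℂ) ^ 2)) •
    ∑ z ∈ (coreC A).charpoly.roots.toFinset.filter (fun z => z.re = (b : ℝ) / 2),
      (specNil (coreC A) z)ᴴ ^ nuTwo b A * (specProj (coreC A) z)ᴴ * matB s b A
        * specProj (coreC A) z * specNil (coreC A) z ^ nuTwo b A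

end MultiDrawUrn

/-!
The covariance matrices obey an exact linear recursion, and the proof compares its solution with an
explicit function of the number of balls that solves the recursion up to a vanishing forcing term.

Let `T_n = τ + b n` be the (deterministic) number of balls. Each of the two sampling schemes draws
`s X_n j / T_n` balls of color `j` in the mean. Evaluating the affine condition at compositions
shows that the mean replacement is linear in the drawn sample, so that a step adds `(1/s) q A`
for the sample `q` (`replacement_eq`). First and second moments of the sample given the
composition then yield (`meanVec_succ`, `covReal_succ`)

  `Σ_{n+1} = (1 + A / T_n)ᵀ Σ_n (1 + A / T_n) + Aᵀ G_n A`,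

where `G_n` (`sampleNoise`) depends on the first two moments of `X_n` only. Because the total is
deterministic, `Σ_n` kills the vector of ones, that is, `P̂ᵀ Σ_n P̂ = Σ_n`, and all growth takes
place on the range of `P̂`. The products of the factors `1 + A / T_m` are compared with
`e^{tA}`, `t = log (T_n / T_m) / b`, up to a bounded factor (`exists_norm_growth_mul_le`), and
`e^{tA} P̂` is bounded by means of the spectral projections (`exists_norm_flow_mul_le`). When the
core index is at most `1/2`, the eigenvalue `b` is simple, since a second copy would give the index
`1`; hence `P_b` is the rank one matrix `1 v₁`, which is real.

* A priori bound: `G_n` is bounded, so the second moments of `X_n - T_n v₁`, which satisfy the same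
  recursion, are `o(T_n²)` (`tendsto_norm_div_sq`). Hence `X_n / T_n → v₁` in mean square, and
  the forcing term compressed by `P̂` converges to `P̂ᵀ B P̂` (`exists_recursion`): the limit of
  `Aᵀ G_n A` differs from `B` only by `b² v₁ᵀ v₁`, and `v₁ P̂ = 0`.
* Comparison: `U(x) = (x/b) · b ∫_0^{log x / b} e^{-bt} e^{tAᵀ} P̂ᵀ B P̂ e^{tA} dt` solves the
  differential equation belonging to the recursion, so `U(T_n)` satisfies the recursion with a
  forcing term that also tends to `P̂ᵀ B P̂` (`tendsto_ansatz_forcing`). The difference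
  `Σ_n - U(T_n)` has vanishing forcing, and is therefore `o(n)` below the critical index and
  `o(n (log n)^{2ν₂+1})` at it (`tendsto_sub_ansatz_subcritical`, `tendsto_sub_ansatz_critical`).
* Limits of `U`: below the critical index the integral converges absolutely. At the critical index
  expand `e^{tA} P̂ = ∑_λ e^{λt} ∑_j (t^j / j!) N_λ^j P_λ`; in the integral of the product of two
  such expansions the largest power `t^{2ν₂}` survives only for pairs of equal eigenvalues of real
  part `b/2`, as the other pairs decay or oscillate (`tendsto_orbitIntegral_critical`).
-/

namespace MultiDrawUrn

set_option linter.unusedSectionVars false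

/-! ### Growth of the total number of balls -/

/-- The total number of balls after `n` draws, as a real number: `τ` balls at the start and `b`
more at each draw. -/
noncomputable def total (τ b : ℝ) (n : ℕ) : ℝ := τ + b * n

section Total

variable {τ b : ℝ}

lemma total_succ (n : ℕ) : total τ b (n + 1) = total τ b n + b := by
  simp only [total]; push_cast; ring

lemma one_le_total (hτ : 1 ≤ τ) (hb : 0 < b) (n : ℕ) : 1 ≤ total τ b n := by
  have : 0 ≤ b * n := by positivity
  simp only [total]; linarith

lemma total_pos (hτ : 1 ≤ τ) (hb : 0 < b) (n : ℕ) : 0 < total τ b n :=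
  zero_lt_one.trans_le (one_le_total hτ hb n)

lemma total_mono (hb : 0 < b) : Monotone (total τ b) := fun m n h => by
  have : (m : ℝ) ≤ n := by exact_mod_cast h
  simp only [total]; gcongr

lemma min_mul_le_total (hτ : 1 ≤ τ) (n : ℕ) : min 1 b * (n + 1) ≤ total τ b n := by
  have h1 : min 1 b ≤ τ := (min_le_left _ _).trans hτ
  have h2 : min 1 b * n ≤ b * n := by gcongr; exact min_le_right _ _
  simp only [total]; linarith

lemma tendsto_total (hb : 0 < b) : Tendsto (total τ b) atTop atTop :=
  tendsto_atTop_add_const_left _ _ (tendsto_natCast_atTop_atTop.const_mul_atTop hb)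

lemma tendsto_total_div (τ b : ℝ) : Tendsto (fun n : ℕ => total τ b n / n) atTop (𝓝 b) := by
  have h : Tendsto (fun n : ℕ => τ / (n : ℝ) + b) atTop (𝓝 (0 + b)) :=
    (tendsto_const_div_atTop_nhds_zero_nat τ).add_const b
  rw [zero_add] at h
  refine h.congr' ?_
  filter_upwards [eventually_gt_atTop 0] with n hn
  have : (n : ℝ) ≠ 0 := by positivity
  simp only [total]; field_simp

lemma summable_inv_total_sq (hτ : 1 ≤ τ) (hb : 0 < b) :
    Summable fun n => ((total τ b n) ^ 2)⁻¹ := by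
  have hc : 0 < min 1 b := lt_min one_pos hb
  have h : Summable fun n : ℕ => ((min 1 b) ^ 2)⁻¹ * (((n + 1 : ℕ) : ℝ) ^ 2)⁻¹ :=
    ((summable_nat_add_iff 1).2 (Real.summable_nat_pow_inv.2 one_lt_two)).mul_left _
  refine h.of_nonneg_of_le (fun n => by positivity) fun n => ?_
  rw [← mul_inv, ← mul_pow]
  have := min_mul_le_total (b := b) hτ n
  gcongr
  push_cast; exact this

end Total

/-! ### The one-parameter group of a generator and its discretization -/

section Flow

variable {𝔸 : Type*} [NormedRing 𝔸] [NormedAlgebra ℂ 𝔸] [CompleteSpace 𝔸]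

/-- The one-parameter group `t ↦ e^{ta}` of an element `a` of a complex Banach algebra, with real
time `t`. -/
noncomputable def flow (a : 𝔸) (t : ℝ) : 𝔸 := NormedSpace.exp ((t : ℂ) • a)

@[simp] lemma flow_zero (a : 𝔸) : flow a 0 = 1 := by simp [flow]

lemma flow_add (a : 𝔸) (s t : ℝ) : flow a (s + t) = flow a s * flow a t := by
  let := NormedAlgebra.restrictScalars ℚ ℂ 𝔸
  rw [flow, flow, flow, ← NormedSpace.exp_add_of_commute]
  · push_cast; rw [add_smul]
  · exact ((Commute.refl a).smul_left _).smul_right _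

lemma commute_flow {a p : 𝔸} (h : Commute p a) (t : ℝ) :
    Commute p (flow a t) := by
  let := NormedAlgebra.restrictScalars ℚ ℂ 𝔸
  exact (h.smul_right _).exp_right

lemma hasDerivAt_flow (a : 𝔸) (t : ℝ) : HasDerivAt (flow a) (a * flow a t) t := by
  have h := (hasDerivAt_exp_smul_const' (𝕂 := ℂ) a (t : ℂ)).scomp t
    Complex.ofRealCLM.hasDerivAt
  rw [Complex.ofRealCLM_apply, Complex.ofReal_one, one_smul] at h
  exact h

lemma continuous_flow (a : 𝔸) : Continuous (flow a) :=
  continuous_iff_continuousAt.2 fun t => (hasDerivAt_flow a t).continuousAt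

/-- The Euler factor `1 + (h / b) a` differs from `(1 + h) ^ (a / b)` by a factor `1 + O(h²)`. -/
lemma norm_euler_mul_flow_sub_one_le (a : 𝔸) {b : ℝ} (H : ℝ) :
    ∃ C, 0 ≤ C ∧ ∀ h, 0 ≤ h → h ≤ H →
      ‖(1 + ((h / b : ℝ) : ℂ) • a) * flow a (-(Real.log (1 + h) / b)) - 1‖ ≤ C * h ^ 2 := by
  set a' : 𝔸 := ((1 / b : ℝ) : ℂ) • a with ha'
  have hcont : ContinuousOn (fun x : ℝ => flow a (-(Real.log (1 + x) / b))) (Set.Icc 0 H) := by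
    refine (continuous_flow a).comp_continuousOn ?_
    refine ((ContinuousOn.log (by fun_prop) fun x hx => ?_).div_const b).neg
    have := hx.1; positivity
  obtain ⟨K, hK⟩ := isCompact_Icc.exists_bound_of_continuousOn hcont
  refine ⟨‖a' - a' * a'‖ * |K|, by positivity, fun h h0 hH => ?_⟩
  set f : ℝ → 𝔸 := fun x => (1 + ((x / b : ℝ) : ℂ) • a) * flow a (-(Real.log (1 + x) / b))
  have hd : ∀ x ∈ Set.Icc 0 h, HasDerivWithinAt f
      (((x / (1 + x) : ℝ) : ℂ) • ((a' - a' * a') * flow a (-(Real.log (1 + x) / b))))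
      (Set.Icc 0 h) x := by
    intro x hx
    have hx1 : (1 + x) ≠ 0 := by have := hx.1; positivity
    have h1 : HasDerivAt (fun x : ℝ => (1 : 𝔸) + ((x / b : ℝ) : ℂ) • a) a' x := by
      have : HasDerivAt (fun x : ℝ => ((x / b : ℝ) : ℂ)) ((1 / b : ℝ) : ℂ) x :=
        ((hasDerivAt_id x).div_const b).ofReal_comp
      exact (this.smul_const a).const_add 1
    have h2 : HasDerivAt (fun x : ℝ => flow a (-(Real.log (1 + x) / b)))
        ((-(1 / (1 + x) / b) : ℝ) • (a * flow a (-(Real.log (1 + x) / b)))) x := by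
      have hl : HasDerivAt (fun x : ℝ => -(Real.log (1 + x) / b)) (-(1 / (1 + x) / b)) x :=
        ((((hasDerivAt_id x).const_add 1).log hx1).div_const b).neg
      exact HasDerivAt.scomp x (hasDerivAt_flow a _) hl
    have h3 := (h1.mul h2).hasDerivWithinAt (s := Set.Icc 0 h)
    refine h3.congr_deriv ?_
    set E := flow a (-(Real.log (1 + x) / b))
    rw [← Complex.coe_smul, ha']
    simp only [add_mul, sub_mul, mul_smul_comm, smul_mul_assoc, smul_sub, smul_smul, one_mul,
      smul_add, mul_assoc]
    have hx1' : (1 + x : ℂ) ≠ 0 := by exact_mod_cast hx1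
    rw [← sub_eq_zero]
    have e1 : ((x / (1 + x) : ℝ) : ℂ) * ((1 / b : ℝ) : ℂ)
        = ((1 / b : ℝ) : ℂ) + ((-(1 / (1 + x) / b) : ℝ) : ℂ) := by
      norm_cast
      by_cases hb : b = 0
      · simp [hb]
      · field_simp; ring
    have e2 : ((x / (1 + x) : ℝ) : ℂ) * (((1 / b : ℝ) : ℂ) * ((1 / b : ℝ) : ℂ))
        = - (((x / b : ℝ) : ℂ) * ((-(1 / (1 + x) / b) : ℝ) : ℂ)) := by
      norm_cast
      by_cases hb : b = 0
      · simp [hb]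
      · field_simp
    have e2' : ((-(1 / (1 + x) / b) : ℝ) : ℂ) * ((x / b : ℝ) : ℂ)
      = - (((x / (1 + x) : ℝ) : ℂ) * (((1 / b : ℝ) : ℂ) * ((1 / b : ℝ) : ℂ))) := by
      rw [e2]; ring
    simp only [e1, e2, e2', add_smul, neg_smul]
    abel
  have hb : ∀ x ∈ Set.Ico 0 h,
      ‖((x / (1 + x) : ℝ) : ℂ) • ((a' - a' * a') * flow a (-(Real.log (1 + x) / b)))‖
        ≤ h * (‖a' - a' * a'‖ * |K|) := by
    intro x hx
    have hx0 := hx.1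
    rw [norm_smul, Complex.norm_real]
    have h1 : ‖x / (1 + x)‖ ≤ h := by
      rw [Real.norm_of_nonneg (by positivity), div_le_iff₀ (by positivity)]
      nlinarith [hx.2]
    have h2 : ‖flow a (-(Real.log (1 + x) / b))‖ ≤ |K| :=
      (hK x ⟨hx.1, hx.2.le.trans hH⟩).trans (le_abs_self K)
    have h3 : ‖(a' - a' * a') * flow a (-(Real.log (1 + x) / b))‖ ≤ ‖a' - a' * a'‖ * |K| :=
      (norm_mul_le _ _).trans (by gcongr)
    gcongr
  have := norm_image_sub_le_of_norm_deriv_le_segment' hd hb h ⟨h0, le_rfl⟩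
  have hf0 : f 0 = 1 := by simp [f]
  rw [hf0] at this
  calc _ ≤ _ := this
    _ = _ := by ring

/-- The mean evolution `1 + a / T_n` of one draw. -/
noncomputable def step (a : 𝔸) (τ b : ℝ) (n : ℕ) : 𝔸 :=
  1 + ((1 / total τ b n : ℝ) : ℂ) • a

/-- The mean evolution from time `m` to time `n`: the product of `1 + a / T_i` over
`m ≤ i < n`. -/
noncomputable def growth (a : 𝔸) (τ b : ℝ) (m : ℕ) : ℕ → 𝔸
  | 0 => 1
  | n + 1 => if m ≤ n then growth a τ b m n * step a τ b n else 1

@[simp] lemma growth_self (a : 𝔸) (τ b : ℝ) (m : ℕ) : growth a τ b m m = 1 := by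
  cases m <;> simp [growth]

lemma growth_succ (a : 𝔸) (τ b : ℝ) {m n : ℕ} (h : m ≤ n) :
    growth a τ b m (n + 1) = growth a τ b m n * step a τ b n := by
  simp [growth, h]

/-- The mean evolution from time `m` to time `n` is `(T_n / T_m) ^ (a / b)` up to a bounded
factor: the relative errors of the Euler factors are `O(1 / T_i²)`, hence summable. -/
lemma exists_norm_growth_mul_le (a p : 𝔸) {τ b : ℝ} (hτ : 1 ≤ τ) (hb : 0 < b) :
    ∃ C, 0 ≤ C ∧ ∀ m n, m ≤ n → ‖growth a τ b m n * p‖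
      ≤ C * ‖flow a (Real.log (total τ b n / total τ b m) / b) * p‖ := by
  obtain ⟨K, hK0, hK⟩ := norm_euler_mul_flow_sub_one_le a (b := b) b
  set S := ∑' n, ((total τ b n) ^ 2)⁻¹
  have hpos := total_pos (b := b) hτ hb
  have key : ∀ m d, ∃ V, ‖V‖ ≤ ‖(1 : 𝔸)‖ *
        Real.exp (K * b ^ 2 * ∑ i ∈ Finset.range (m + d), ((total τ b i) ^ 2)⁻¹) ∧
      growth a τ b m (m + d) = V * flow a (Real.log (total τ b (m + d) / total τ b m) / b) := by
    intro m d
    induction d with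
    | zero =>
      refine ⟨1, ?_, ?_⟩
      · refine le_mul_of_one_le_right (norm_nonneg _) (Real.one_le_exp ?_)
        positivity
      · simp [div_self (hpos m).ne']
    | succ d ih =>
      obtain ⟨V, hV, hG⟩ := ih
      set n := m + d
      set h := b / total τ b n
      have hh0 : 0 ≤ h := (div_pos hb (hpos n)).le
      have hhb : h ≤ b := div_le_self hb.le (one_le_total hτ hb n)
      obtain ⟨U, hUdef⟩ : ∃ U, U = (1 + ((h / b : ℝ) : ℂ) • a) * flow a (-(Real.log (1 + h) / b)) :=
        ⟨_, rfl⟩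
      have hU : ‖U - 1‖ ≤ K * h ^ 2 := hUdef ▸ hK h hh0 hhb
      have hstep : step a τ b n = U * flow a (Real.log (1 + h) / b) := by
        rw [hUdef, mul_assoc, ← flow_add]
        have : h / b = 1 / total τ b n := by
          simp only [h]; field_simp
        simp [step, this]
      have hlog : Real.log (total τ b (n + 1) / total τ b m) / b
          = Real.log (total τ b n / total τ b m) / b + Real.log (1 + h) / b := by
        rw [← add_div, ← Real.log_mul (div_pos (hpos n) (hpos m)).ne' (by positivity)]
        congr 2
        simp only [h]
        rw [total_succ]
        have := (hpos n).ne'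
        field_simp
      have hcomm : ∀ t, Commute U (flow a t) := fun t =>
        hUdef ▸ Commute.mul_left (Commute.add_left (Commute.one_left _)
          ((commute_flow (Commute.refl a) t).smul_left _))
          (commute_flow ((commute_flow (Commute.refl a) _).symm) t)
      refine ⟨V * U, ?_, ?_⟩
      · rw [← add_assoc, Finset.sum_range_succ, mul_add, Real.exp_add,
          ← mul_assoc ‖(1 : 𝔸)‖]
        have h1 : V * U = V + V * (U - 1) := by rw [mul_sub, mul_one, add_sub_cancel]
        have h2 : K * b ^ 2 * ((total τ b n) ^ 2)⁻¹ = K * h ^ 2 := by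
          simp only [h, div_pow]; ring
        rw [h2]
        calc ‖V * U‖ ≤ ‖V‖ + ‖V‖ * (K * h ^ 2) := by
              rw [h1]
              exact (norm_add_le _ _).trans (add_le_add le_rfl ((norm_mul_le _ _).trans
                (mul_le_mul_of_nonneg_left hU (norm_nonneg _))))
          _ = ‖V‖ * (K * h ^ 2 + 1) := by ring
          _ ≤ _ := by
              gcongr
              exact Real.add_one_le_exp _
      · rw [← add_assoc, growth_succ a τ b (Nat.le_add_right m d), hG, hstep, hlog, flow_add,
          mul_assoc V, ← mul_assoc (flow a _) U, ← (hcomm _).eq]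
        simp only [mul_assoc]
  refine ⟨‖(1 : 𝔸)‖ * Real.exp (K * b ^ 2 * S), by positivity, fun m n hmn => ?_⟩
  obtain ⟨d, rfl⟩ := Nat.exists_eq_add_of_le hmn
  obtain ⟨V, hV, hG⟩ := key m d
  rw [hG, mul_assoc]
  refine (norm_mul_le _ _).trans ?_
  gcongr
  refine hV.trans ?_
  gcongr
  exact (summable_inv_total_sq hτ hb).sum_le_tsum _ fun i _ => by positivity

variable [StarRing 𝔸] [NormedStarGroup 𝔸]

/-- Variation of constants for the recursion `E_{n+1} = (1 + a/T_n)^* E_n (1 + a/T_n) + F_n`. -/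
lemma eq_growth_sum {a : 𝔸} {τ b : ℝ} {E F : ℕ → 𝔸}
    (hE : ∀ n, E (n + 1) = star (step a τ b n) * E n * step a τ b n + F n) (n : ℕ) :
    E n = star (growth a τ b 0 n) * E 0 * growth a τ b 0 n
      + ∑ m ∈ Finset.range n,
          star (growth a τ b (m + 1) n) * F m * growth a τ b (m + 1) n := by
  induction n with
  | zero => simp
  | succ n ih =>
    rw [hE, Finset.sum_range_succ, growth_self, growth_succ a τ b (Nat.zero_le n)]
    have : ∀ m ∈ Finset.range n,
        star (growth a τ b (m + 1) (n + 1)) * F m * growth a τ b (m + 1) (n + 1)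
        = star (step a τ b n) * (star (growth a τ b (m + 1) n) * F m * growth a τ b (m + 1) n)
          * step a τ b n := by
      intro m hm
      rw [growth_succ a τ b (Finset.mem_range.1 hm), star_mul]
      simp only [mul_assoc]
    rw [Finset.sum_congr rfl this, ← Finset.sum_mul, ← Finset.mul_sum]
    conv_lhs => rw [ih]
    simp only [star_mul, mul_add, add_mul, mul_assoc, star_one, one_mul, mul_one, add_assoc]

/-- A bound for the solution of the recursion in terms of the forcing, when the flow on the range
of `p` is controlled by `g`. -/
lemma exists_norm_star_mul_mul_le (a p : 𝔸) {τ b : ℝ} (hτ : 1 ≤ τ) (hb : 0 < b) {g : ℝ → ℝ}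
    (hg : ∀ t, 0 ≤ t → ‖flow a t * p‖ ^ 2 ≤ g t) :
    ∃ C, 0 ≤ C ∧ ∀ (E F : ℕ → 𝔸),
      (∀ n, E (n + 1) = star (step a τ b n) * E n * step a τ b n + F n) → ∀ n,
      ‖star p * E n * p‖ ≤ C * (‖E 0‖ * g (Real.log (total τ b n / total τ b 0) / b)
        + ∑ m ∈ Finset.range n,
          ‖F m‖ * g (Real.log (total τ b n / total τ b (m + 1)) / b)) := by
  obtain ⟨C, hC0, hC⟩ := exists_norm_growth_mul_le a p hτ hb
  have hpos := total_pos (b := b) hτ hb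
  have hsq : ∀ m n, m ≤ n → ∀ x : 𝔸,
      ‖star p * (star (growth a τ b m n) * x * growth a τ b m n) * p‖
        ≤ C ^ 2 * (‖x‖ * g (Real.log (total τ b n / total τ b m) / b)) := by
    intro m n hmn x
    have hlog : 0 ≤ Real.log (total τ b n / total τ b m) / b := by
      refine div_nonneg (Real.log_nonneg ?_) hb.le
      rw [one_le_div (hpos m)]
      exact total_mono hb hmn
    have e : star p * (star (growth a τ b m n) * x * growth a τ b m n) * p
        = star (growth a τ b m n * p) * x * (growth a τ b m n * p) := by
      simp only [star_mul, mul_assoc]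
    have h1 := hC m n hmn
    rw [e]
    calc _ ≤ ‖star (growth a τ b m n * p)‖ * ‖x‖ * ‖growth a τ b m n * p‖ :=
          (norm_mul_le _ _).trans (by gcongr; exact norm_mul_le _ _)
      _ = ‖x‖ * ‖growth a τ b m n * p‖ ^ 2 := by rw [norm_star]; ring
      _ ≤ ‖x‖ * (C ^ 2 * g (Real.log (total τ b n / total τ b m) / b)) := by
          gcongr
          calc _ ≤ (C * ‖flow a (Real.log (total τ b n / total τ b m) / b) * p‖) ^ 2 := by gcongr
            _ = C ^ 2 * ‖flow a (Real.log (total τ b n / total τ b m) / b) * p‖ ^ 2 := by ring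
            _ ≤ _ := by gcongr; exact hg _ hlog
      _ = _ := by ring
  refine ⟨C ^ 2, by positivity, fun E F hE n => ?_⟩
  rw [eq_growth_sum hE n, mul_add, add_mul, Finset.mul_sum, Finset.sum_mul, mul_add,
    Finset.mul_sum]
  refine (norm_add_le _ _).trans (add_le_add (hsq 0 n (Nat.zero_le n) _) ?_)
  refine (norm_sum_le _ _).trans (Finset.sum_le_sum fun m hm => ?_)
  exact hsq (m + 1) n (Finset.mem_range.1 hm) _

end Flow

/-! ### The comparison solution of the recursion -/

section Ansatz

variable {𝔸 : Type*} [NormedRing 𝔸] [NormedAlgebra ℂ 𝔸] [CompleteSpace 𝔸] [StarRing 𝔸]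
  [NormedStarGroup 𝔸] [StarModule ℂ 𝔸]

/-- The rescaled orbit `e^{-bt} e^{ta^*} d e^{ta}` of `d`. -/
noncomputable def orbit (a d : 𝔸) (b t : ℝ) : 𝔸 :=
  ((Real.exp (-(b * t)) : ℝ) : ℂ) • (star (flow a t) * d * flow a t)

/-- `b` times the integral of the rescaled orbit up to time `t`. -/
noncomputable def orbitIntegral (a d : 𝔸) (b t : ℝ) : 𝔸 :=
  (b : ℂ) • ∫ s in (0 : ℝ)..t, orbit a d b s

/-- The comparison solution at real size `x`; along `x = T_n` it solves the recursion for the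
covariance matrices up to a vanishing error. -/
noncomputable def ansatz (a d : 𝔸) (b x : ℝ) : 𝔸 :=
  ((x / b : ℝ) : ℂ) • orbitIntegral a d b (Real.log x / b)

lemma star_flow (a : 𝔸) (t : ℝ) : star (flow a t) = flow (star a) t := by
  rw [flow, flow, NormedSpace.star_exp, star_smul, Complex.star_def, Complex.conj_ofReal]

lemma hasDerivAt_orbit (a d : 𝔸) (b t : ℝ) :
    HasDerivAt (orbit a d b)
      (star a * orbit a d b t + orbit a d b t * a - (b : ℂ) • orbit a d b t) t := by
  have h1 : HasDerivAt (fun t : ℝ => ((Real.exp (-(b * t)) : ℝ) : ℂ))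
      ((Real.exp (-(b * t)) * -(b * 1) : ℝ) : ℂ) t :=
    ((((hasDerivAt_id t).const_mul b).neg).exp).ofReal_comp
  have h2 : HasDerivAt (fun t => star (flow a t)) (star a * star (flow a t)) t := by
    simp only [star_flow]
    exact hasDerivAt_flow _ _
  have h3 := h1.smul ((h2.mul_const d).mul (hasDerivAt_flow a t))
  refine h3.congr_deriv ?_
  have hc : a * flow a t = flow a t * a := (commute_flow (Commute.refl a) t).eq
  simp only [orbit, hc, Pi.mul_apply]
  push_cast
  simp only [smul_add, mul_smul_comm, smul_mul_assoc, mul_assoc, smul_smul]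
  rw [show (Complex.exp (-(b * t)) * -(b * 1 : ℂ)) = -((b : ℂ) * Complex.exp (-(b * t))) by ring,
    neg_smul]
  abel

lemma continuous_orbit (a d : 𝔸) (b : ℝ) : Continuous (orbit a d b) :=
  continuous_iff_continuousAt.2 fun t => (hasDerivAt_orbit a d b t).continuousAt

lemma hasDerivAt_orbitIntegral (a d : 𝔸) (b t : ℝ) :
    HasDerivAt (orbitIntegral a d b) ((b : ℂ) • orbit a d b t) t :=
  (intervalIntegral.integral_hasDerivAt_right
    ((continuous_orbit a d b).intervalIntegrable _ _)
    ((continuous_orbit a d b).stronglyMeasurableAtFilter _ _)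
    (continuous_orbit a d b).continuousAt).const_smul (b : ℂ)

@[simp] lemma orbitIntegral_zero (a d : 𝔸) (b : ℝ) : orbitIntegral a d b 0 = 0 := by
  simp [orbitIntegral]

/-- The integrated form of the differential equation of the rescaled orbit. -/
lemma orbitIntegral_add_orbit (a d : 𝔸) {b : ℝ} (hb : b ≠ 0) (t : ℝ) :
    orbitIntegral a d b t + orbit a d b t
      = d + ((1 / b : ℝ) : ℂ) • (star a * orbitIntegral a d b t + orbitIntegral a d b t * a) := by
  set f : ℝ → 𝔸 := fun t => orbitIntegral a d b t + orbit a d b t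
    - ((1 / b : ℝ) : ℂ) • (star a * orbitIntegral a d b t + orbitIntegral a d b t * a)
  have hf : ∀ t, HasDerivAt f 0 t := by
    intro t
    have hJ := hasDerivAt_orbitIntegral a d b t
    have h := (hJ.add (hasDerivAt_orbit a d b t)).sub
      (((hJ.const_mul (star a)).add (hJ.mul_const a)).const_smul ((1 / b : ℝ) : ℂ))
    refine h.congr_deriv ?_
    have : ((1 / b : ℝ) : ℂ) * (b : ℂ) = 1 := by
      norm_cast; field_simp
    simp only [mul_smul_comm, smul_mul_assoc, smul_add, smul_smul, this, one_smul]
    abel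
  have h0 : f t = f 0 :=
    is_const_of_deriv_eq_zero (fun t => (hf t).differentiableAt) (fun t => (hf t).deriv) t 0
  have : f 0 = d := by simp [f, orbit]
  rw [this] at h0
  simp only [f] at h0
  exact sub_eq_iff_eq_add.1 h0

lemma hasDerivAt_ansatz (a d : 𝔸) {b x : ℝ} (hb : b ≠ 0) (hx : x ≠ 0) :
    HasDerivAt (ansatz a d b) (((1 / b : ℝ) : ℂ) • (d + ((1 / b : ℝ) : ℂ) •
      (star a * orbitIntegral a d b (Real.log x / b)
        + orbitIntegral a d b (Real.log x / b) * a))) x := by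
  have h1 : HasDerivAt (fun x : ℝ => ((x / b : ℝ) : ℂ)) ((1 / b : ℝ) : ℂ) x :=
    ((hasDerivAt_id x).div_const b).ofReal_comp
  have h2 : HasDerivAt (fun x => orbitIntegral a d b (Real.log x / b))
      ((x⁻¹ / b) • ((b : ℂ) • orbit a d b (Real.log x / b))) x :=
    HasDerivAt.scomp x (hasDerivAt_orbitIntegral a d b _) ((Real.hasDerivAt_log hx).div_const b)
  refine (h1.smul h2).congr_deriv ?_
  rw [← orbitIntegral_add_orbit a d hb, ← Complex.coe_smul, smul_smul, smul_smul, smul_add]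
  have : ((x / b : ℝ) : ℂ) * (((x⁻¹ / b : ℝ) : ℂ) * (b : ℂ)) = ((1 / b : ℝ) : ℂ) := by
    norm_cast; field_simp
  rw [← mul_assoc] at this
  rw [this, add_comm]

variable {a d : 𝔸} {b K : ℝ}

lemma exp_half_log_div {b x : ℝ} (hb : 0 < b) (hx : 0 < x) :
    Real.exp (b * (Real.log x / b) / 2) = x ^ (1 / 2 : ℝ) := by
  rw [Real.rpow_def_of_pos hx]; congr 1; field_simp

lemma rpow_half_div {x : ℝ} (hx : 0 < x) :
    x ^ (1 / 2 : ℝ) / x = (x ^ (1 / 2 : ℝ))⁻¹ := by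
  rw [← Real.rpow_neg hx.le, ← Real.rpow_sub_one hx.ne']
  norm_num

/-- The integral of the orbit changes slowly on the logarithmic scale. -/
lemma norm_orbitIntegral_sub_le (hb : 0 < b) (hK : 0 ≤ K)
    (hψ : ∀ t, 0 ≤ t → ‖orbit a d b t‖ ≤ K * Real.exp (b * t / 2)) {x y : ℝ} (hx : 1 ≤ x)
    (hxy : x ≤ y) :
    ‖orbitIntegral a d b (Real.log y / b) - orbitIntegral a d b (Real.log x / b)‖
      ≤ K * y ^ (1 / 2 : ℝ) * (Real.log y - Real.log x) := by
  have hx0 : 0 < x := zero_lt_one.trans_le hx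
  have hy0 : 0 < y := hx0.trans_le hxy
  have hle : Real.log x / b ≤ Real.log y / b := by gcongr
  have h := norm_image_sub_le_of_norm_deriv_le_segment'
    (f := orbitIntegral a d b) (f' := fun t => (b : ℂ) • orbit a d b t)
    (a := Real.log x / b) (b := Real.log y / b) (C := b * (K * y ^ (1 / 2 : ℝ)))
    (fun t _ => (hasDerivAt_orbitIntegral a d b t).hasDerivWithinAt)
    (fun t ht => ?_) _ ⟨hle, le_rfl⟩
  · refine h.trans (le_of_eq ?_)
    field_simp
  · rw [norm_smul, Complex.norm_real, Real.norm_of_nonneg hb.le, ← exp_half_log_div hb hy0]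
    have ht0 : 0 ≤ t := (div_nonneg (Real.log_nonneg hx) hb.le).trans ht.1
    have ht1 := ht.2.le
    refine mul_le_mul_of_nonneg_left ((hψ t ht0).trans ?_) hb.le
    gcongr

/-- The comparison solution satisfies the recursion with a forcing that tends to `d`. -/
lemma tendsto_ansatz_forcing {τ : ℝ} (hτ : 1 ≤ τ) (hb : 0 < b) (hK : 0 ≤ K)
    (hψ : ∀ t, 0 ≤ t → ‖orbit a d b t‖ ≤ K * Real.exp (b * t / 2)) :
    Tendsto (fun n => ansatz a d b (total τ b (n + 1))
      - star (step a τ b n) * ansatz a d b (total τ b n) * step a τ b n) atTop (𝓝 d) := by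
  obtain ⟨T, hT⟩ : ∃ T, T = total τ b := ⟨_, rfl⟩
  rw [← hT]
  have hT1 : ∀ n, 1 ≤ T n := hT ▸ one_le_total hτ hb
  have hT0 : ∀ n, 0 < T n := hT ▸ total_pos hτ hb
  have hTs : ∀ n, T (n + 1) = T n + b := hT ▸ total_succ
  have hTm : Monotone T := hT ▸ total_mono hb
  set J : ℕ → 𝔸 := fun n => orbitIntegral a d b (Real.log (T n) / b) with hJ
  -- the error of one Euler step of the ansatz
  set c : ℝ := 2 * ‖a‖ / b
  have herr1 : ∀ n, ‖ansatz a d b (T (n + 1)) - ansatz a d b (T n)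
      - (d + ((1 / b : ℝ) : ℂ) • (star a * J n + J n * a))‖
      ≤ c * K * (T (n + 1) ^ (1 / 2 : ℝ) * (b / T n)) := by
    intro n
    set v := d + ((1 / b : ℝ) : ℂ) • (star a * J n + J n * a)
    have hv : ∀ x : ℝ, HasDerivAt (fun x : ℝ => ((x / b : ℝ) : ℂ) • v)
        (((1 / b : ℝ) : ℂ) • v) x := fun x =>
      ((((hasDerivAt_id x).div_const b).ofReal_comp).smul_const v)
    have hle : T n ≤ T (n + 1) := hTm n.le_succ
    have h := norm_image_sub_le_of_norm_deriv_le_segment'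
      (f := fun x => ansatz a d b x - ((x / b : ℝ) : ℂ) • v)
      (f' := fun x => ((1 / b : ℝ) : ℂ) • (((1 / b : ℝ) : ℂ) •
        (star a * (orbitIntegral a d b (Real.log x / b) - J n)
          + (orbitIntegral a d b (Real.log x / b) - J n) * a)))
      (a := T n) (b := T (n + 1))
      (C := (1 / b) * ((1 / b) * (2 * ‖a‖ * (K * T (n + 1) ^ (1 / 2 : ℝ) * (b / T n)))))
      (fun x hx => ?_) (fun x hx => ?_) _ ⟨hle, le_rfl⟩
    · refine le_trans (le_of_eq ?_) (h.trans (le_of_eq ?_))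
      · congr 1
        have : ((T (n + 1) / b : ℝ) : ℂ) • v - ((T n / b : ℝ) : ℂ) • v = v := by
          rw [← sub_smul, ← Complex.ofReal_sub, ← sub_div, hTs, add_sub_cancel_left,
            div_self hb.ne', Complex.ofReal_one, one_smul]
        conv_lhs => rw [← this]
        abel
      · rw [hTs, add_sub_cancel_left]
        simp only [c]
        field_simp
    · have hx0 : x ≠ 0 := ((hT0 n).trans_le hx.1).ne'
      refine (((hasDerivAt_ansatz a d hb.ne' hx0).sub (hv x)).congr_deriv ?_).hasDerivWithinAt
      simp only [v, smul_add, mul_sub, sub_mul, smul_sub]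
      abel
    · have hJx : ‖orbitIntegral a d b (Real.log x / b) - J n‖
          ≤ K * T (n + 1) ^ (1 / 2 : ℝ) * (b / T n) := by
        have hx0 : 0 < x := (hT0 n).trans_le hx.1
        refine (norm_orbitIntegral_sub_le hb hK hψ (hT1 n) hx.1).trans ?_
        have hlog : Real.log x - Real.log (T n) ≤ b / T n := by
          rw [← Real.log_div hx0.ne' (hT0 n).ne']
          refine (Real.log_le_sub_one_of_pos (div_pos hx0 (hT0 n))).trans ?_
          rw [div_sub_one (hT0 n).ne']
          have := hx.2.le
          rw [hTs] at this
          have := (hT0 n).le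
          gcongr
          linarith
        have hx1 := hx.1
        have hx2 := hx.2.le
        have : 0 ≤ Real.log x - Real.log (T n) :=
          sub_nonneg.2 (Real.log_le_log (hT0 n) hx1)
        have : 0 ≤ T (n + 1) ^ (1 / 2 : ℝ) := Real.rpow_nonneg (hT0 _).le _
        gcongr
      have hb1 : ‖((1 / b : ℝ) : ℂ)‖ = 1 / b := by
        rw [Complex.norm_real, Real.norm_of_nonneg (by positivity)]
      rw [norm_smul, norm_smul, hb1]
      gcongr
      refine (norm_add_le _ _).trans ?_
      have h1 := norm_mul_le (star a) (orbitIntegral a d b (Real.log x / b) - J n)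
      have h2 := norm_mul_le (orbitIntegral a d b (Real.log x / b) - J n) a
      rw [norm_star] at h1
      have h3 := mul_le_mul_of_nonneg_left hJx (norm_nonneg a)
      linarith
  have hJn : ∀ n, ‖J n‖ ≤ K * T n ^ (1 / 2 : ℝ) * Real.log (T n) := by
    intro n
    have := norm_orbitIntegral_sub_le hb hK hψ le_rfl (hT1 n)
    simpa using this
  -- the two error terms
  set r₁ : ℕ → 𝔸 := fun n => ansatz a d b (T (n + 1)) - ansatz a d b (T n)
      - (d + ((1 / b : ℝ) : ℂ) • (star a * J n + J n * a))
  set r₂ : ℕ → 𝔸 := fun n => ((1 / (b * T n) : ℝ) : ℂ) • (star a * J n * a)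
  have hTt : Tendsto T atTop atTop := hT ▸ tendsto_total hb
  have h1 : Tendsto r₁ atTop (𝓝 0) := by
    refine squeeze_zero_norm herr1 ?_
    have hlim : Tendsto (fun n => (1 + b) ^ (1 / 2 : ℝ) * (b * (T n) ^ (-(1 / 2) : ℝ))) atTop
        (𝓝 ((1 + b) ^ (1 / 2 : ℝ) * (b * 0))) :=
      (((tendsto_rpow_neg_atTop (by norm_num)).comp hTt).const_mul b).const_mul _
    have hz : Tendsto (fun n => T (n + 1) ^ (1 / 2 : ℝ) * (b / T n)) atTop (𝓝 0) := by
      rw [mul_zero, mul_zero] at hlim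
      refine squeeze_zero (fun n => ?_) (fun n => ?_) hlim
      · have := (hT0 n).le
        have := (hT0 (n + 1)).le
        positivity
      · have e : b * (T n) ^ (-(1 / 2) : ℝ) = (T n) ^ (1 / 2 : ℝ) * (b / T n) := by
          rw [Real.rpow_neg (hT0 n).le, ← rpow_half_div (hT0 n)]
          ring
        rw [e, ← mul_assoc, ← Real.mul_rpow (by positivity) (hT0 n).le]
        have hn0 := (hT0 n).le
        have hn1 := (hT0 (n + 1)).le
        gcongr
        rw [hTs]
        nlinarith [hT1 n]
    simpa using hz.const_mul (c * K)
  have h2 : Tendsto r₂ atTop (𝓝 0) := by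
    have hlim : Tendsto (fun n => (‖a‖ ^ 2 * K / b) *
        (Real.log (T n) / (T n) ^ (1 / 2 : ℝ))) atTop (𝓝 ((‖a‖ ^ 2 * K / b) * 0)) :=
      (((isLittleO_log_rpow_atTop (by norm_num : (0 : ℝ) < 1 / 2)).tendsto_div_nhds_zero).comp
        hTt).const_mul _
    rw [mul_zero] at hlim
    refine squeeze_zero_norm (fun n => ?_) hlim
    have hn0 := hT0 n
    have h5 : 0 < (T n) ^ (1 / 2 : ℝ) := Real.rpow_pos_of_pos (hT0 n) _
    have h6 : ‖star a * J n * a‖ ≤ ‖a‖ * ‖J n‖ * ‖a‖ := by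
      refine (norm_mul_le _ _).trans ?_
      gcongr
      exact (norm_mul_le _ _).trans (by rw [norm_star])
    rw [norm_smul, Complex.norm_real, Real.norm_of_nonneg (by positivity)]
    calc _ ≤ 1 / (b * T n) * (‖a‖ * (K * T n ^ (1 / 2 : ℝ) * Real.log (T n)) * ‖a‖) := by
          refine mul_le_mul_of_nonneg_left (h6.trans ?_) (by positivity)
          have := hJn n
          gcongr
      _ = (‖a‖ ^ 2 * K / b) * (Real.log (T n) * ((T n) ^ (1 / 2 : ℝ) / T n)) := by
          field_simp
      _ = _ := by
          rw [rpow_half_div hn0, div_eq_mul_inv (Real.log _)]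
  have key : ∀ n, ansatz a d b (T (n + 1))
      - star (step a τ b n) * ansatz a d b (T n) * step a τ b n = d + r₁ n - r₂ n := by
    intro n
    have hn0 := (hT0 n).ne'
    have hs : star (step a τ b n) = 1 + ((1 / T n : ℝ) : ℂ) • star a := by
      simp only [hT, step, star_add, star_one, star_smul, Complex.star_def, Complex.conj_ofReal]
    have e1 : ((1 / T n : ℝ) : ℂ) * ((T n / b : ℝ) : ℂ) = ((1 / b : ℝ) : ℂ) := by
      norm_cast; field_simp
    have e1' : ((T n / b : ℝ) : ℂ) * ((1 / T n : ℝ) : ℂ) = ((1 / b : ℝ) : ℂ) := by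
      rw [mul_comm, e1]
    have e2 : ((1 / T n : ℝ) : ℂ) * ((1 / b : ℝ) : ℂ)
        = ((1 / (b * T n) : ℝ) : ℂ) := by
      norm_cast; field_simp
    have hexp : star (step a τ b n) * ansatz a d b (T n) * step a τ b n
        = ansatz a d b (T n) + ((1 / b : ℝ) : ℂ) • (star a * J n + J n * a) + r₂ n := by
      rw [hs]
      simp only [step, ansatz, r₂, ← hT, add_mul, mul_add, one_mul, mul_one, smul_mul_assoc,
        mul_smul_comm, smul_smul, smul_add, e1, e1', e2, J]
      abel
    rw [hexp]
    simp only [r₁]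
    abel
  simp only [key]
  simpa using (h1.const_add d).sub h2

end Ansatz

/-! ### Sums of forcing terms -/

section Sums

variable {τ b : ℝ}

lemma tendsto_sum_inv_total (hτ : 1 ≤ τ) (hb : 0 < b) {σ : ℝ} (hσ : σ ≤ 1) :
    Tendsto (fun n => ∑ m ∈ Finset.range n, (total τ b (m + 1) ^ σ)⁻¹) atTop atTop := by
  refine (not_summable_iff_tendsto_nat_atTop_of_nonneg fun m => ?_).1 fun h => ?_
  · have := total_pos (b := b) hτ hb (m + 1)
    positivity
  · refine Real.not_summable_one_div_natCast
      ((summable_nat_add_iff 1).1 ?_)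
    refine (h.mul_left (τ + b)).of_nonneg_of_le (fun m => by positivity) fun m => ?_
    have h1 := one_le_total (b := b) hτ hb (m + 1)
    have h0 := total_pos (b := b) hτ hb (m + 1)
    have h2 : total τ b (m + 1) ^ σ ≤ total τ b (m + 1) := by
      simpa using Real.rpow_le_rpow_of_exponent_le h1 hσ
    have h3 : total τ b (m + 1) ≤ (τ + b) * ((m + 1 : ℕ) : ℝ) := by
      simp only [total]
      push_cast
      have : (0 : ℝ) ≤ m := by positivity
      nlinarith
    rw [one_div, ← div_eq_mul_inv, inv_eq_one_div, div_le_div_iff₀ (by positivity) (by positivity)]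
    linarith

/-- The harmonic sum is at most logarithmic. -/
lemma sum_inv_total_le (hτ : 1 ≤ τ) (hb : 0 < b) (n : ℕ) :
    ∑ m ∈ Finset.range n, (total τ b (m + 1))⁻¹ ≤ b⁻¹ * Real.log (total τ b n) := by
  induction n with
  | zero => simpa using mul_nonneg (inv_nonneg.2 hb.le) (Real.log_nonneg (one_le_total hτ hb 0))
  | succ n ih =>
    rw [Finset.sum_range_succ]
    have h0 := total_pos (b := b) hτ hb n
    have h1 := total_pos (b := b) hτ hb (n + 1)
    have h2 := Real.one_sub_inv_le_log_of_pos (div_pos h1 h0)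
    rw [Real.log_div h1.ne' h0.ne', inv_div, one_sub_div h1.ne', total_succ,
      add_sub_cancel_left] at h2
    rw [total_succ]
    have h3 : (total τ b n + b)⁻¹ = b⁻¹ * (b / (total τ b n + b)) := by
      have : total τ b n + b ≠ 0 := by positivity
      field_simp
    rw [h3]
    calc _ ≤ b⁻¹ * Real.log (total τ b n)
          + b⁻¹ * (Real.log (total τ b n + b) - Real.log (total τ b n)) := by gcongr
      _ = _ := by ring

lemma sum_inv_total_rpow_le (hτ : 1 ≤ τ) (hb : 0 < b) {σ : ℝ} (hσ0 : 0 ≤ σ) (hσ : σ < 1)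
    (n : ℕ) :
    ∑ m ∈ Finset.range n, (total τ b (m + 1) ^ σ)⁻¹
      ≤ ((1 - σ) * b)⁻¹ * total τ b n ^ (1 - σ) := by
  have hs : 0 < 1 - σ := by linarith
  induction n with
  | zero =>
    have := total_pos (b := b) hτ hb 0
    simp; positivity
  | succ n ih =>
    rw [Finset.sum_range_succ]
    have h0 := total_pos (b := b) hτ hb n
    have h1 := total_pos (b := b) hτ hb (n + 1)
    set x := total τ b n
    have hy : total τ b (n + 1) = x + b := total_succ n
    set y := total τ b (n + 1)
    -- Bernoulli's inequality for the concave power `1 - σ`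
    have hB := rpow_one_add_le_one_add_mul_self (s := -(b / y))
      (by rw [neg_le_neg_iff, div_le_one h1]; linarith) hs.le (by linarith : 1 - σ ≤ 1)
    have e1 : 1 + -(b / y) = x / y := by rw [hy]; field_simp; ring
    rw [e1, Real.div_rpow h0.le h1.le, div_le_iff₀ (by positivity)] at hB
    have e2 : y ^ (1 - σ) = y * (y ^ σ)⁻¹ := by
      rw [Real.rpow_sub h1, Real.rpow_one]; rfl
    have e3 : (1 + (1 - σ) * -(b / y)) * y ^ (1 - σ)
        = y ^ (1 - σ) - (1 - σ) * b * (y ^ σ)⁻¹ := by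
      rw [e2]; field_simp; ring
    rw [e3] at hB
    calc _ ≤ ((1 - σ) * b)⁻¹ * x ^ (1 - σ) + (y ^ σ)⁻¹ := by gcongr
      _ = ((1 - σ) * b)⁻¹ * (x ^ (1 - σ) + (1 - σ) * b * (y ^ σ)⁻¹) := by field_simp
      _ ≤ _ := by gcongr; linarith

/-- Weights tending to zero are negligible in a divergent sum. -/
lemma isLittleO_sum_mul_inv (hτ : 1 ≤ τ) (hb : 0 < b) {σ : ℝ} (hσ : σ ≤ 1) {δ : ℕ → ℝ}
    (hδ : Tendsto δ atTop (𝓝 0)) :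
    (fun n => ∑ m ∈ Finset.range n, δ m * (total τ b (m + 1) ^ σ)⁻¹) =o[atTop]
      fun n => ∑ m ∈ Finset.range n, (total τ b (m + 1) ^ σ)⁻¹ := by
  refine Asymptotics.IsLittleO.sum_range ?_ (fun m => ?_) (tendsto_sum_inv_total hτ hb hσ)
  · have := ((Asymptotics.isLittleO_one_iff ℝ).2 hδ).mul_isBigO
      (Asymptotics.isBigO_refl (fun m => (total τ b (m + 1) ^ σ)⁻¹) atTop)
    simpa using this
  · have := total_pos (b := b) hτ hb (m + 1)
    simp only [Pi.zero_apply]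
    positivity

/-- Vanishing forcing is negligible when the flow grows with an exponent below one. -/
lemma tendsto_sum_forcing_subcritical (hτ : 1 ≤ τ) (hb : 0 < b) {σ : ℝ} (hσ0 : 0 ≤ σ)
    (hσ : σ < 1) {δ : ℕ → ℝ} (hδ : Tendsto δ atTop (𝓝 0)) :
    Tendsto (fun n => (∑ m ∈ Finset.range n,
      δ m * (total τ b n / total τ b (m + 1)) ^ σ) / total τ b n) atTop (𝓝 0) := by
  have hpos := total_pos (b := b) hτ hb
  have h1 : (fun n => ∑ m ∈ Finset.range n, (total τ b (m + 1) ^ σ)⁻¹) =O[atTop]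
      fun n => total τ b n ^ (1 - σ) := by
    refine Asymptotics.IsBigO.of_bound ((1 - σ) * b)⁻¹ (Eventually.of_forall fun n => ?_)
    rw [Real.norm_of_nonneg (Finset.sum_nonneg fun m _ => inv_nonneg.2
      (Real.rpow_nonneg (hpos _).le _)), Real.norm_of_nonneg (Real.rpow_nonneg (hpos _).le _)]
    exact sum_inv_total_rpow_le hτ hb hσ0 hσ n
  have h2 := ((isLittleO_sum_mul_inv hτ hb hσ.le hδ).trans_isBigO h1).tendsto_div_nhds_zero
  refine h2.congr fun n => ?_
  rw [Real.rpow_sub (hpos n), Real.rpow_one, div_div_eq_mul_div, Finset.sum_mul]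
  congr 1
  refine Finset.sum_congr rfl fun m _ => ?_
  rw [Real.div_rpow (hpos n).le (hpos _).le]
  ring

/-- Vanishing forcing gains a factor that is `o(log)` when the flow grows with exponent one. -/
lemma tendsto_sum_forcing_critical (hτ : 1 ≤ τ) (hb : 0 < b) {δ : ℕ → ℝ}
    (hδ : Tendsto δ atTop (𝓝 0)) :
    Tendsto (fun n => (∑ m ∈ Finset.range n, δ m * (total τ b n / total τ b (m + 1)))
      / (total τ b n * Real.log (total τ b n))) atTop (𝓝 0) := by
  have hpos := total_pos (b := b) hτ hb
  have h1 : (fun n => ∑ m ∈ Finset.range n, (total τ b (m + 1) ^ (1 : ℝ))⁻¹) =O[atTop]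
      fun n => Real.log (total τ b n) := by
    refine Asymptotics.IsBigO.of_bound b⁻¹ (Eventually.of_forall fun n => ?_)
    rw [Real.norm_of_nonneg (Finset.sum_nonneg fun m _ => inv_nonneg.2
      (Real.rpow_nonneg (hpos _).le _)),
      Real.norm_of_nonneg (Real.log_nonneg (one_le_total hτ hb n))]
    simpa using sum_inv_total_le hτ hb n
  have h2 := ((isLittleO_sum_mul_inv hτ hb le_rfl hδ).trans_isBigO h1).tendsto_div_nhds_zero
  refine h2.congr fun n => ?_
  rw [← mul_div_mul_left _ _ (hpos n).ne', Finset.mul_sum]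
  congr 1
  refine Finset.sum_congr rfl fun m _ => ?_
  rw [Real.rpow_one]
  ring

/-- Bounded forcing produces `o(T_n²)` when the flow grows with exponent `3/2`. -/
lemma tendsto_sum_forcing_apriori (hτ : 1 ≤ τ) (hb : 0 < b) :
    Tendsto (fun n => (∑ m ∈ Finset.range n,
      (total τ b n / total τ b (m + 1)) ^ (3 / 2 : ℝ)) / total τ b n ^ 2) atTop (𝓝 0) := by
  have hpos := total_pos (b := b) hτ hb
  have h := ((isLittleO_log_rpow_atTop (by norm_num : (0 : ℝ) < 1 / 2)).tendsto_div_nhds_zero.comp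
    (tendsto_total (τ := τ) hb)).const_mul b⁻¹
  rw [mul_zero] at h
  refine squeeze_zero (fun n => ?_) (fun n => ?_) h
  · have := (hpos n).le
    refine div_nonneg (Finset.sum_nonneg fun m _ => ?_) (by positivity)
    exact Real.rpow_nonneg (div_nonneg (hpos n).le (hpos _).le) _
  · have hn := hpos n
    simp only [Function.comp_apply]
    calc _ ≤ (∑ m ∈ Finset.range n, total τ b n ^ (3 / 2 : ℝ) * (total τ b (m + 1))⁻¹)
          / total τ b n ^ 2 := by
          gcongr with m _
          rw [Real.div_rpow hn.le (hpos _).le, div_eq_mul_inv]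
          have h1 := one_le_total (b := b) hτ hb (m + 1)
          have := hpos (m + 1)
          gcongr
          simpa using Real.rpow_le_rpow_of_exponent_le h1 (by norm_num : (1 : ℝ) ≤ 3 / 2)
      _ ≤ (total τ b n ^ (3 / 2 : ℝ) * (b⁻¹ * Real.log (total τ b n))) / total τ b n ^ 2 := by
          rw [← Finset.mul_sum]
          gcongr
          exact sum_inv_total_le hτ hb n
      _ = _ := by
          have e : total τ b n ^ 2 = total τ b n ^ (3 / 2 : ℝ) * total τ b n ^ (1 / 2 : ℝ) := by
            rw [← Real.rpow_add hn, ← Real.rpow_natCast]; norm_num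
          have : 0 < total τ b n ^ (3 / 2 : ℝ) := Real.rpow_pos_of_pos hn _
          rw [e]
          field_simp

end Sums

/-! ### Exponential polynomials -/

lemma continuous_pow_mul_cexp (p : ℕ) (z : ℂ) :
    Continuous fun t : ℝ => (t : ℂ) ^ p * Complex.exp (z * t) := by fun_prop

/-- Integration by parts for `t ^ p e^{zt}`. -/
lemma integral_pow_succ_mul_cexp (p : ℕ) (z : ℂ) (L : ℝ) :
    z * ∫ t in (0 : ℝ)..L, (t : ℂ) ^ (p + 1) * Complex.exp (z * t)
      = (L : ℂ) ^ (p + 1) * Complex.exp (z * L)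
        - (p + 1) * ∫ t in (0 : ℝ)..L, (t : ℂ) ^ p * Complex.exp (z * t) := by
  have hd : ∀ t ∈ Set.uIcc 0 L, HasDerivAt
      (fun t : ℝ => (t : ℂ) ^ (p + 1) * Complex.exp (z * t))
      ((p + 1) * ((t : ℂ) ^ p * Complex.exp (z * t))
        + z * ((t : ℂ) ^ (p + 1) * Complex.exp (z * t))) t := by
    intro t _
    have h1 : HasDerivAt (fun t : ℂ => t ^ (p + 1) * Complex.exp (z * t))
        (((p + 1 : ℕ) * (t : ℂ) ^ p) * Complex.exp (z * t)
          + (t : ℂ) ^ (p + 1) * (Complex.exp (z * t) * (z * 1))) (t : ℂ) := by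
      exact (hasDerivAt_pow (p + 1) (t : ℂ)).mul (((hasDerivAt_id (t : ℂ)).const_mul z).cexp)
    convert h1.comp_ofReal using 1
    push_cast; ring
  have hi : ∀ (c : ℂ) (q : ℕ), IntervalIntegrable
      (fun t : ℝ => c * ((t : ℂ) ^ q * Complex.exp (z * t))) volume 0 L := fun c q =>
    ((continuous_pow_mul_cexp q z).const_smul c).intervalIntegrable _ _
  have h := intervalIntegral.integral_eq_sub_of_hasDerivAt hd ((hi _ _).add (hi _ _))
  rw [intervalIntegral.integral_add (hi _ _) (hi _ _), intervalIntegral.integral_const_mul,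
    intervalIntegral.integral_const_mul] at h
  have h0 : ((0 : ℝ) : ℂ) ^ (p + 1) = 0 := by simp
  rw [h0, zero_mul, sub_zero] at h
  rw [← h]; ring

/-- For `z ≠ 0` the integral of `t ^ p e^{zt}` is of the order of its boundary terms. -/
lemma exists_norm_integral_pow_mul_cexp_le {z : ℂ} (hz : z ≠ 0) {e : ℕ → ℕ} (he : Monotone e)
    (hG : ∀ p, ∃ C, ∀ L : ℝ, 1 ≤ L → ‖(L : ℂ) ^ p * Complex.exp (z * L)‖ ≤ C * L ^ e p) (p : ℕ) :
    ∃ C, ∀ L : ℝ, 1 ≤ L →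
      ‖∫ t in (0 : ℝ)..L, (t : ℂ) ^ p * Complex.exp (z * t)‖ ≤ C * L ^ e p := by
  have hz0 : 0 < ‖z‖ := norm_pos_iff.2 hz
  induction p with
  | zero =>
    obtain ⟨C, hC⟩ := hG 0
    refine ⟨(C + 1) / ‖z‖, fun L hL => ?_⟩
    have h1 := hC L hL
    have h2 : (1 : ℝ) ≤ L ^ e 0 := one_le_pow₀ hL
    simp only [pow_zero, one_mul] at h1 ⊢
    rw [integral_exp_mul_complex hz, norm_div, div_mul_eq_mul_div]
    gcongr
    refine (norm_sub_le _ _).trans ?_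
    simp only [Complex.ofReal_zero, mul_zero, Complex.exp_zero, norm_one]
    linarith
  | succ p ih =>
    obtain ⟨C, hC⟩ := hG (p + 1)
    obtain ⟨D, hD⟩ := ih
    refine ⟨(C + (p + 1) * |D|) / ‖z‖, fun L hL => ?_⟩
    have h1 := hC L hL
    have h2 := hD L hL
    have h3 : L ^ e p ≤ L ^ e (p + 1) := pow_le_pow_right₀ hL (he p.le_succ)
    have h4 := congrArg norm (integral_pow_succ_mul_cexp p z L)
    rw [norm_mul] at h4
    rw [div_mul_eq_mul_div, le_div_iff₀ hz0, mul_comm, h4]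
    refine (norm_sub_le _ _).trans ?_
    rw [norm_mul (p + 1 : ℂ)]
    have h5 : ‖(p + 1 : ℂ)‖ = p + 1 := by
      rw [← Nat.cast_succ, Complex.norm_natCast, Nat.cast_succ]
    rw [h5]
    have h6 : D * L ^ e p ≤ |D| * L ^ e (p + 1) :=
      mul_le_mul (le_abs_self D) h3 (by positivity) (abs_nonneg D)
    have h7 : (p + 1 : ℝ) * ‖∫ t in (0 : ℝ)..L, (t : ℂ) ^ p * Complex.exp (z * t)‖
        ≤ (p + 1) * (|D| * L ^ e (p + 1)) := by
      gcongr; exact h2.trans h6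
    linarith

/-- A power times a decaying exponential is bounded. -/
lemma pow_mul_exp_neg_le {ε t : ℝ} (hε : 0 < ε) (ht : 0 ≤ t) (j : ℕ) :
    t ^ j * Real.exp (-(ε * t)) ≤ j.factorial / ε ^ j := by
  have h := Real.pow_div_factorial_le_exp (ε * t) (by positivity) j
  rw [div_le_iff₀ (by positivity), mul_pow] at h
  rw [Real.exp_neg, le_div_iff₀ (by positivity)]
  have := Real.exp_pos (ε * t)
  field_simp
  linarith

/-- The mean of `t ^ p e^{zt}` on the scale `L ^ (q + 1)`: only the constant exponential with the
top power survives. -/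
lemma tendsto_integral_pow_mul_cexp {z : ℂ} {p q : ℕ} (hz : z.re ≤ 0)
    (hpq : p ≤ q ∨ z.re < 0) :
    Tendsto (fun L : ℝ => ((L : ℂ) ^ (q + 1))⁻¹ *
      ∫ t in (0 : ℝ)..L, (t : ℂ) ^ p * Complex.exp (z * t)) atTop
      (𝓝 (if z = 0 ∧ p = q then 1 / (q + 1 : ℂ) else 0)) := by
  have hinv : Tendsto (fun L : ℝ => L⁻¹) atTop (𝓝 0) := tendsto_inv_atTop_zero
  have hmain : ∀ r, r ≤ q → (∃ C, ∀ L : ℝ, 1 ≤ L →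
      ‖∫ t in (0 : ℝ)..L, (t : ℂ) ^ p * Complex.exp (z * t)‖ ≤ C * L ^ r) →
      Tendsto (fun L : ℝ => ((L : ℂ) ^ (q + 1))⁻¹ *
        ∫ t in (0 : ℝ)..L, (t : ℂ) ^ p * Complex.exp (z * t)) atTop (𝓝 0) := by
    rintro r hr ⟨C, hC⟩
    have hlim := hinv.const_mul |C|
    rw [mul_zero] at hlim
    refine squeeze_zero_norm' ?_ hlim
    filter_upwards [eventually_ge_atTop 1] with L hL
    have hL0 : 0 < L := zero_lt_one.trans_le hL
    rw [norm_mul, norm_inv, norm_pow, Complex.norm_real, Real.norm_of_nonneg hL0.le,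
      inv_mul_le_iff₀ (by positivity)]
    refine (hC L hL).trans ?_
    calc C * L ^ r ≤ |C| * L ^ q := by
          gcongr
          exact le_abs_self C
      _ = _ := by rw [pow_succ]; field_simp
  by_cases hz0 : z = 0
  · subst hz0
    have hp : p ≤ q := hpq.resolve_right (by simp)
    have hI : ∀ L : ℝ, ∫ t in (0 : ℝ)..L, (t : ℂ) ^ p * Complex.exp (0 * t)
        = ((L ^ (p + 1) / (p + 1) : ℝ) : ℂ) := by
      intro L
      simp only [zero_mul, Complex.exp_zero, mul_one]
      have : (fun t : ℝ => (t : ℂ) ^ p) = fun t : ℝ => ((t ^ p : ℝ) : ℂ) := by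
        funext t; push_cast; rfl
      rw [this, intervalIntegral.integral_ofReal, integral_pow]
      simp
    rcases hp.lt_or_eq with hlt | rfl
    · rw [if_neg (fun h => hlt.ne h.2)]
      refine hmain (p + 1) hlt ⟨1, fun L hL => ?_⟩
      rw [hI, Complex.norm_real, Real.norm_of_nonneg (by positivity), one_mul]
      exact div_le_self (by positivity) (by linarith [(Nat.cast_nonneg p : (0 : ℝ) ≤ p)])
    · rw [if_pos ⟨rfl, rfl⟩]
      refine tendsto_const_nhds.congr' ?_
      filter_upwards [eventually_gt_atTop 0] with L hL
      rw [hI]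
      have : (L : ℂ) ≠ 0 := by exact_mod_cast hL.ne'
      have hp1 : ((p : ℂ) + 1) ≠ 0 := by exact_mod_cast p.succ_ne_zero
      push_cast
      field_simp
  · rw [if_neg (fun h => hz0 h.1)]
    rcases hpq with hp | hneg
    · refine hmain p hp (exists_norm_integral_pow_mul_cexp_le hz0 (e := fun p => p)
        monotone_id (fun p => ⟨1, fun L hL => ?_⟩) p)
      rw [norm_mul, norm_pow, Complex.norm_real, Real.norm_of_nonneg (by positivity), one_mul,
        Complex.norm_exp]
      refine mul_le_of_le_one_right (by positivity) (Real.exp_le_one_iff.2 ?_)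
      simp only [Complex.mul_re, Complex.ofReal_re, Complex.ofReal_im, mul_zero, sub_zero]
      nlinarith
    · refine hmain 0 (Nat.zero_le q) (exists_norm_integral_pow_mul_cexp_le hz0 (e := fun _ => 0)
        monotone_const (fun p => ⟨p.factorial / (-z.re) ^ p, fun L hL => ?_⟩) p)
      rw [norm_mul, norm_pow, Complex.norm_real, Real.norm_of_nonneg (by positivity),
        Complex.norm_exp, pow_zero, mul_one]
      have := pow_mul_exp_neg_le (neg_pos.2 hneg) (zero_le_one.trans hL) p
      simpa using this

/-! ### The flow on generalized eigenspaces -/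

section SpectralFlow

variable {𝔸 : Type*} [NormedRing 𝔸] [NormedAlgebra ℂ 𝔸] [CompleteSpace 𝔸]

/-- On a vector killed by a power of `a - z` the exponential series terminates. -/
lemma flow_mul_eq_sum {a p : 𝔸} {z : ℂ} {N : ℕ} (h : ∀ j, N < j → (a - z • 1) ^ j * p = 0)
    (t : ℝ) :
    flow a t * p = ∑ j ∈ Finset.range (N + 1),
      (((t : ℂ) ^ j * Complex.exp (z * t)) / (j.factorial : ℂ)) • ((a - z • 1) ^ j * p) := by
  let := NormedAlgebra.restrictScalars ℚ ℂ 𝔸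
  have h1 : (t : ℂ) • a = (z * t) • (1 : 𝔸) + (t : ℂ) • (a - z • 1) := by
    rw [smul_sub, smul_smul, mul_comm z]; abel
  have h2 : NormedSpace.exp ((z * t) • (1 : 𝔸)) = Complex.exp (z * t) • 1 := by
    rw [← Algebra.algebraMap_eq_smul_one, ← NormedSpace.algebraMap_exp_comm,
      ← Complex.exp_eq_exp_ℂ, Algebra.algebraMap_eq_smul_one]
  have h3 : NormedSpace.exp ((t : ℂ) • (a - z • 1)) * p = ∑ j ∈ Finset.range (N + 1),
      ((t : ℂ) ^ j / (j.factorial : ℂ)) • ((a - z • 1) ^ j * p) := by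
    have hs := (NormedSpace.exp_series_hasSum_exp' (𝕂 := ℂ) ((t : ℂ) • (a - z • 1))).mul_right p
    refine HasSum.unique hs ?_
    have hf := hasSum_sum_of_ne_finset_zero (L := SummationFilter.unconditional ℕ)
      (s := Finset.range (N + 1))
      (f := fun j : ℕ => ((j.factorial : ℂ)⁻¹ • ((t : ℂ) • (a - z • 1)) ^ j) * p) (fun j hj => ?_)
    · have e : ∑ j ∈ Finset.range (N + 1), ((t : ℂ) ^ j / (j.factorial : ℂ)) •
          ((a - z • 1) ^ j * p) = ∑ j ∈ Finset.range (N + 1),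
            ((j.factorial : ℂ)⁻¹ • ((t : ℂ) • (a - z • 1)) ^ j) * p :=
        Finset.sum_congr rfl fun j _ => by
          rw [smul_pow, smul_smul, smul_mul_assoc, div_eq_inv_mul]
      rw [e]
      exact hf
    · have : N < j := by simpa [Nat.lt_succ_iff] using hj
      rw [smul_pow, smul_mul_assoc, smul_mul_assoc, h j this, smul_zero, smul_zero]
  rw [flow, h1, NormedSpace.exp_add_of_commute (((Commute.one_left _).smul_left _)), h2, mul_assoc,
    h3, smul_one_mul, Finset.smul_sum]
  refine Finset.sum_congr rfl fun j _ => ?_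
  rw [smul_smul]
  congr 1
  ring

/-- Exponents and polynomial orders of a flow: if `p` is a sum of spectral pieces with exponents of
real part at most `κ`, and the nilpotent order at real part `κ` is at most `ν`, then
`e^{ta} p = O(e^{κt} (1 + t)^ν)`. -/
lemma exists_norm_flow_mul_le {a p : 𝔸} {P : ℂ → 𝔸} {R : Finset ℂ} {N ν : ℕ} {κ : ℝ}
    (hp : p = ∑ z ∈ R, P z) (hN : ∀ z ∈ R, ∀ j, N < j → (a - z • 1) ^ j * P z = 0)
    (hκ : ∀ z ∈ R, z.re ≤ κ)
    (hν : ∀ z ∈ R, z.re = κ → ∀ j, ν < j → (a - z • 1) ^ j * P z = 0) :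
    ∃ C, 0 ≤ C ∧ ∀ t, 0 ≤ t → ‖flow a t * p‖ ≤ C * (Real.exp (κ * t) * (1 + t) ^ ν) := by
  have key : ∀ z ∈ R, ∀ j, ∃ C, 0 ≤ C ∧ ∀ t : ℝ, 0 ≤ t →
      ‖(((t : ℂ) ^ j * Complex.exp (z * t)) / (j.factorial : ℂ)) • ((a - z • 1) ^ j * P z)‖
        ≤ C * (Real.exp (κ * t) * (1 + t) ^ ν) := by
    intro z hz j
    have hnorm : ∀ t : ℝ, 0 ≤ t →
        ‖(((t : ℂ) ^ j * Complex.exp (z * t)) / (j.factorial : ℂ)) • ((a - z • 1) ^ j * P z)‖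
          ≤ t ^ j * Real.exp (z.re * t) * ‖(a - z • 1) ^ j * P z‖ := by
      intro t ht
      rw [norm_smul, norm_div, norm_mul, norm_pow, Complex.norm_real, Real.norm_of_nonneg ht,
        Complex.norm_exp, Complex.norm_natCast]
      have e : (z * t).re = z.re * t := by simp
      rw [e]
      gcongr
      exact div_le_self (by positivity) (by exact_mod_cast j.factorial_pos)
    by_cases hjν : j ≤ ν
    · refine ⟨‖(a - z • 1) ^ j * P z‖, norm_nonneg _, fun t ht => (hnorm t ht).trans ?_⟩
      have h1 : t ^ j ≤ (1 + t) ^ ν :=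
        (pow_le_pow_left₀ ht (by linarith) j).trans (pow_le_pow_right₀ (by linarith) hjν)
      have h2 : Real.exp (z.re * t) ≤ Real.exp (κ * t) := by
        have := hκ z hz
        gcongr
      calc _ ≤ (1 + t) ^ ν * Real.exp (κ * t) * ‖(a - z • 1) ^ j * P z‖ := by gcongr
        _ = _ := by ring
    · rcases (hκ z hz).lt_or_eq with hlt | heq
      · have hε : 0 < κ - z.re := sub_pos.2 hlt
        refine ⟨j.factorial / (κ - z.re) ^ j * ‖(a - z • 1) ^ j * P z‖, by positivity,
          fun t ht => (hnorm t ht).trans ?_⟩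
        have h1 := pow_mul_exp_neg_le hε ht j
        have h2 : Real.exp (z.re * t) = Real.exp (-((κ - z.re) * t)) * Real.exp (κ * t) := by
          rw [← Real.exp_add]; congr 1; ring
        have h3 : (1 : ℝ) ≤ (1 + t) ^ ν := one_le_pow₀ (by linarith)
        rw [h2, ← mul_assoc]
        calc _ ≤ j.factorial / (κ - z.re) ^ j * Real.exp (κ * t) * ‖(a - z • 1) ^ j * P z‖ * 1 := by
              rw [mul_one]; gcongr
          _ ≤ j.factorial / (κ - z.re) ^ j * Real.exp (κ * t) * ‖(a - z • 1) ^ j * P z‖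
              * (1 + t) ^ ν := by gcongr
          _ = _ := by ring
      · refine ⟨0, le_rfl, fun t ht => ?_⟩
        rw [hν z hz heq j (not_le.1 hjν)]
        simp
  choose! C hC0 hC using key
  refine ⟨∑ z ∈ R, ∑ j ∈ Finset.range (N + 1), C z j,
    Finset.sum_nonneg fun z hz => Finset.sum_nonneg fun j _ => hC0 z hz j, fun t ht => ?_⟩
  rw [hp, Finset.mul_sum, Finset.sum_mul]
  refine (norm_sum_le _ _).trans (Finset.sum_le_sum fun z hz => ?_)
  rw [flow_mul_eq_sum (hN z hz), Finset.sum_mul]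
  exact (norm_sum_le _ _).trans (Finset.sum_le_sum fun j _ => hC z hz j t ht)

variable [StarRing 𝔸] [NormedStarGroup 𝔸] [StarModule ℂ 𝔸]

lemma orbit_conj_eq {a p : 𝔸} (h : Commute p a) (d : 𝔸) (b t : ℝ) :
    orbit a (star p * d * p) b t
      = ((Real.exp (-(b * t)) : ℝ) : ℂ) • (star (flow a t * p) * d * (flow a t * p)) := by
  rw [orbit, ← (commute_flow h t).eq, star_mul]
  simp only [mul_assoc]

/-- The growth of the flow on the range of `p` controls the rescaled orbit of a compression. -/
lemma norm_orbit_conj_le {a p : 𝔸} (h : Commute p a) (d : 𝔸) {b t g : ℝ}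
    (hg : ‖flow a t * p‖ ^ 2 ≤ g) :
    ‖orbit a (star p * d * p) b t‖ ≤ Real.exp (-(b * t)) * (‖d‖ * g) := by
  rw [orbit_conj_eq h, norm_smul, Complex.norm_real, Real.norm_of_nonneg (Real.exp_pos _).le]
  gcongr
  calc _ ≤ ‖star (flow a t * p)‖ * ‖d‖ * ‖flow a t * p‖ :=
        (norm_mul_le _ _).trans (by gcongr; exact norm_mul_le _ _)
    _ = ‖d‖ * ‖flow a t * p‖ ^ 2 := by rw [norm_star]; ring
    _ ≤ _ := by gcongr

/-- At the critical exponent the integrated orbit grows like `t ^ (2ν + 1)`; only pairs of equal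
exponents on the critical line and the top nilpotent order contribute to the leading term. -/
lemma tendsto_orbitIntegral_critical {a p : 𝔸} (d : 𝔸) {P : ℂ → 𝔸} {R : Finset ℂ} {N ν : ℕ}
    {b : ℝ} (hcomm : Commute p a)
    (hp : p = ∑ z ∈ R, P z) (hN : ∀ z ∈ R, ∀ j, N < j → (a - z • 1) ^ j * P z = 0)
    (hκ : ∀ z ∈ R, z.re ≤ b / 2)
    (hν : ∀ z ∈ R, z.re = b / 2 → ∀ j, ν < j → (a - z • 1) ^ j * P z = 0) (hνN : ν ≤ N) :
    Tendsto (fun t : ℝ => ((t : ℂ) ^ (2 * ν + 1))⁻¹ • orbitIntegral a (star p * d * p) b t) atTop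
      (𝓝 (((b : ℂ) / ((2 * ν + 1) * (ν.factorial : ℂ) ^ 2)) •
        ∑ z ∈ R.filter (fun z => z.re = b / 2),
          star ((a - z • 1) ^ ν * P z) * d * ((a - z • 1) ^ ν * P z))) := by
  classical
  set m : ℂ → ℕ → 𝔸 := fun z j => (a - z • 1) ^ j * P z with hm
  set I : ℂ → ℂ → ℕ → ℕ → ℝ → ℂ := fun z w j l t =>
    ∫ s in (0 : ℝ)..t, (s : ℂ) ^ (j + l) * Complex.exp ((star z + w - b) * s) with hI
  set x : ℂ → ℂ → ℕ → ℕ → 𝔸 := fun z w j l =>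
    ((b : ℂ) / ((j.factorial : ℂ) * (l.factorial : ℂ))) • (star (m z j) * d * m w l) with hx
  have hexp : ∀ t, orbitIntegral a (star p * d * p) b t
      = ∑ z ∈ R, ∑ w ∈ R, ∑ j ∈ Finset.range (N + 1), ∑ l ∈ Finset.range (N + 1),
          I z w j l t • x z w j l := by
    intro t
    have horb : ∀ s, orbit a (star p * d * p) b s
        = ∑ z ∈ R, ∑ w ∈ R, ∑ j ∈ Finset.range (N + 1), ∑ l ∈ Finset.range (N + 1),
          ((s : ℂ) ^ (j + l) * Complex.exp ((star z + w - b) * s)) •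
            ((1 / ((j.factorial : ℂ) * (l.factorial : ℂ))) • (star (m z j) * d * m w l)) := by
      intro s
      have hfl : flow a s * p = ∑ z ∈ R, ∑ j ∈ Finset.range (N + 1),
          (((s : ℂ) ^ j * Complex.exp (z * s)) / (j.factorial : ℂ)) • m z j := by
        rw [hp, Finset.mul_sum]
        exact Finset.sum_congr rfl fun z hz => flow_mul_eq_sum (hN z hz) s
      rw [orbit_conj_eq hcomm, hfl, star_sum, Finset.sum_mul, Finset.sum_mul, Finset.smul_sum]
      refine Finset.sum_congr rfl fun z _ => ?_
      rw [Finset.mul_sum, Finset.smul_sum]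
      refine Finset.sum_congr rfl fun w _ => ?_
      rw [star_sum, Finset.sum_mul, Finset.sum_mul, Finset.smul_sum]
      refine Finset.sum_congr rfl fun j _ => ?_
      rw [Finset.mul_sum, Finset.smul_sum]
      refine Finset.sum_congr rfl fun l _ => ?_
      rw [star_smul, smul_mul_assoc, smul_mul_assoc, mul_smul_comm, smul_smul, smul_smul,
        smul_smul]
      congr 1
      have e1 : star (((s : ℂ) ^ j * Complex.exp (z * s)) / (j.factorial : ℂ))
          = ((s : ℂ) ^ j * Complex.exp (star z * s)) / (j.factorial : ℂ) := by
        simp only [Complex.star_def, map_div₀, map_mul, map_pow, Complex.conj_ofReal,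
          ← Complex.exp_conj, map_natCast]
      have e2 : Complex.exp ((star z + w - b) * s)
          = Complex.exp (-(b * s)) * Complex.exp (star z * s) * Complex.exp (w * s) := by
        rw [← Complex.exp_add, ← Complex.exp_add]; congr 1; ring
      rw [e1, e2]
      push_cast
      rw [pow_add]
      ring
    have hcont : ∀ z w j l, Continuous (fun s : ℝ =>
        ((s : ℂ) ^ (j + l) * Complex.exp ((star z + w - b) * s)) •
          ((1 / ((j.factorial : ℂ) * (l.factorial : ℂ))) • (star (m z j) * d * m w l))) :=
      fun z w j l => (continuous_pow_mul_cexp (j + l) (star z + w - b)).smul continuous_const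
    have hint : ∀ z w j l, IntervalIntegrable (fun s : ℝ =>
        ((s : ℂ) ^ (j + l) * Complex.exp ((star z + w - b) * s)) •
          ((1 / ((j.factorial : ℂ) * (l.factorial : ℂ))) • (star (m z j) * d * m w l)))
        volume 0 t := fun z w j l =>
      (hcont z w j l).intervalIntegrable _ _
    have hint1 : ∀ z w j, IntervalIntegrable (fun s : ℝ => ∑ l ∈ Finset.range (N + 1),
        ((s : ℂ) ^ (j + l) * Complex.exp ((star z + w - b) * s)) •
          ((1 / ((j.factorial : ℂ) * (l.factorial : ℂ))) • (star (m z j) * d * m w l)))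
        volume 0 t := fun z w j =>
      (continuous_finsetSum _ fun l _ => hcont z w j l).intervalIntegrable _ _
    have hint2 : ∀ z w, IntervalIntegrable (fun s : ℝ => ∑ j ∈ Finset.range (N + 1),
        ∑ l ∈ Finset.range (N + 1),
        ((s : ℂ) ^ (j + l) * Complex.exp ((star z + w - b) * s)) •
          ((1 / ((j.factorial : ℂ) * (l.factorial : ℂ))) • (star (m z j) * d * m w l)))
        volume 0 t := fun z w =>
      (continuous_finsetSum _ fun j _ =>
        continuous_finsetSum _ fun l _ => hcont z w j l).intervalIntegrable _ _
    have hint3 : ∀ z, IntervalIntegrable (fun s : ℝ => ∑ w ∈ R, ∑ j ∈ Finset.range (N + 1),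
        ∑ l ∈ Finset.range (N + 1),
        ((s : ℂ) ^ (j + l) * Complex.exp ((star z + w - b) * s)) •
          ((1 / ((j.factorial : ℂ) * (l.factorial : ℂ))) • (star (m z j) * d * m w l)))
        volume 0 t := fun z =>
      (continuous_finsetSum _ fun w _ => continuous_finsetSum _ fun j _ =>
        continuous_finsetSum _ fun l _ => hcont z w j l).intervalIntegrable _ _
    rw [orbitIntegral, intervalIntegral.integral_congr (fun s _ => horb s),
      intervalIntegral.integral_finsetSum (fun z _ => hint3 z), Finset.smul_sum]
    refine Finset.sum_congr rfl fun z _ => ?_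
    rw [intervalIntegral.integral_finsetSum (fun w _ => hint2 z w), Finset.smul_sum]
    refine Finset.sum_congr rfl fun w _ => ?_
    rw [intervalIntegral.integral_finsetSum (fun j _ => hint1 z w j), Finset.smul_sum]
    refine Finset.sum_congr rfl fun j _ => ?_
    rw [intervalIntegral.integral_finsetSum (fun l _ => hint z w j l), Finset.smul_sum]
    refine Finset.sum_congr rfl fun l _ => ?_
    rw [intervalIntegral.integral_smul_const, smul_smul, smul_smul, hx]
    simp only [smul_smul, hI]
    congr 1
    ring
  have hterm : ∀ z ∈ R, ∀ w ∈ R, ∀ j l, Tendsto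
      (fun t : ℝ => ((t : ℂ) ^ (2 * ν + 1))⁻¹ • I z w j l t • x z w j l) atTop
      (𝓝 (if z = w then if z.re = b / 2 then if j = ν then if l = ν then
        (1 / (2 * ν + 1 : ℂ)) • x z z ν ν else 0 else 0 else 0 else 0)) := by
    intro z hz w hw j l
    by_cases hx0 : x z w j l = 0
    · have : (if z = w then if z.re = b / 2 then if j = ν then if l = ν then
        (1 / (2 * ν + 1 : ℂ)) • x z z ν ν else 0 else 0 else 0 else 0) = 0 := by
        split_ifs with h1 h2 h3 h4
        · subst h1 h3 h4; rw [hx0, smul_zero]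
        all_goals rfl
      rw [this]
      simp only [hx0, smul_zero]
      exact tendsto_const_nhds
    · have hmj : z.re = b / 2 → j ≤ ν := fun h => by
        by_contra hj
        exact hx0 (by simp only [hx, hm]; rw [hν z hz h j (not_le.1 hj)]; simp)
      have hml : w.re = b / 2 → l ≤ ν := fun h => by
        by_contra hl
        exact hx0 (by simp only [hx, hm]; rw [hν w hw h l (not_le.1 hl)]; simp)
      have hzre := hκ z hz
      have hwre := hκ w hw
      have hre : (star z + w - b : ℂ).re = z.re + w.re - b := by simp
      have hle : (star z + w - b : ℂ).re ≤ 0 := by rw [hre]; linarith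
      have hpq : j + l ≤ 2 * ν ∨ (star z + w - b : ℂ).re < 0 := by
        rw [or_iff_not_imp_right, hre]
        intro hn
        have h1 := hmj (by linarith)
        have h2 := hml (by linarith)
        omega
      have h := (tendsto_integral_pow_mul_cexp hle hpq).smul_const (x z w j l)
      simp only [mul_smul] at h
      refine h.mono_right (congrArg 𝓝 ?_).le
      have hiff : (star z + w - b : ℂ) = 0 ∧ j + l = 2 * ν
          ↔ z = w ∧ z.re = b / 2 ∧ j = ν ∧ l = ν := by
        constructor
        · rintro ⟨h0, hjl⟩
          have h1 : (star z + w - b : ℂ).re = 0 := by rw [h0]; simp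
          have h2 : (star z + w - b : ℂ).im = 0 := by rw [h0]; simp
          rw [hre] at h1
          simp only [Complex.sub_im, Complex.add_im, Complex.star_def, Complex.conj_im,
            Complex.ofReal_im] at h2
          have hz2 : z.re = b / 2 := by linarith
          have hw2 : w.re = b / 2 := by linarith
          have := hmj hz2
          have := hml hw2
          exact ⟨Complex.ext (by linarith) (by linarith), hz2, by omega, by omega⟩
        · rintro ⟨rfl, h2, rfl, rfl⟩
          refine ⟨Complex.ext (by rw [hre]; simp; linarith) (by simp), by omega⟩
      by_cases hcase : z = w ∧ z.re = b / 2 ∧ j = ν ∧ l = ν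
      · rw [if_pos (hiff.2 hcase)]
        obtain ⟨rfl, h2, rfl, rfl⟩ := hcase
        simp [h2]
      · rw [if_neg (fun h => hcase (hiff.1 h)), zero_smul]
        split_ifs with h1 h2 h3 h4
        · exact absurd ⟨h1, h2, h3, h4⟩ hcase
        all_goals rfl
  have hsum := tendsto_finsetSum R fun z hz => tendsto_finsetSum R fun w hw =>
    tendsto_finsetSum (Finset.range (N + 1)) fun j _ =>
      tendsto_finsetSum (Finset.range (N + 1)) fun l _ => hterm z hz w hw j l
  refine Tendsto.mono_right (hsum.congr fun t => ?_) (congrArg 𝓝 ?_).le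
  · rw [hexp]
    simp only [Finset.smul_sum]
  · have hmem : ν ∈ Finset.range (N + 1) := Finset.mem_range.2 (Nat.lt_succ_of_le hνN)
    rw [Finset.sum_filter, Finset.smul_sum]
    refine Finset.sum_congr rfl fun z hz => ?_
    rw [Finset.sum_eq_single_of_mem z hz (fun w _ hw => by simp [hw.symm]),
      Finset.sum_eq_single_of_mem ν hmem (fun j _ hj => by simp [hj]),
      Finset.sum_eq_single_of_mem ν hmem (fun l _ hl => by simp [hl])]
    by_cases h : z.re = b / 2
    · simp only [h, if_true, hx, hm, smul_smul]
      congr 1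
      field_simp
    · simp [h]

end SpectralFlow

/-! ### Spectral projections of a complex matrix -/

section Spectral

variable {k : ℕ} (A : Matrix (Fin k) (Fin k) ℂ)

lemma specProj_mulVec_of_mem {z : ℂ} {u : Fin k → ℂ} (hu : u ∈ genEigenspace A z) :
    specProj A z *ᵥ u = u := by
  rw [specProj, LinearMap.toMatrix'_mulVec]
  exact Submodule.projection_apply_of_mem_left _ hu

lemma specProj_mulVec_of_mem_ne {z w : ℂ} (hw : w ≠ z) {u : Fin k → ℂ}
    (hu : u ∈ genEigenspace A w) : specProj A z *ᵥ u = 0 := by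
  rw [specProj, LinearMap.toMatrix'_mulVec, Submodule.projection_apply_eq_zero_iff]
  exact Submodule.mem_iSup_of_mem w (Submodule.mem_iSup_of_mem hw hu)

lemma specProj_mulVec_mem (z : ℂ) (u : Fin k → ℂ) : specProj A z *ᵥ u ∈ genEigenspace A z := by
  rw [specProj, LinearMap.toMatrix'_mulVec]
  exact Submodule.projection_apply_mem _ _

/-- Matrices that agree on all generalized eigenspaces are equal. -/
lemma ext_of_genEigenspace {M₁ M₂ : Matrix (Fin k) (Fin k) ℂ}
    (h : ∀ w, ∀ u ∈ genEigenspace A w, M₁ *ᵥ u = M₂ *ᵥ u) : M₁ = M₂ := by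
  refine Matrix.mulVec_injective (funext fun u => ?_)
  have hu : u ∈ ⨆ w, genEigenspace A w := by
    have := Module.End.iSup_maxGenEigenspace_eq_top (Matrix.toLin' A)
    simp only [genEigenspace]
    rw [this]
    trivial
  refine Submodule.iSup_induction _ (motive := fun u => M₁ *ᵥ u = M₂ *ᵥ u) hu h (by simp) ?_
  intro x y hx hy
  rw [Matrix.mulVec_add, Matrix.mulVec_add, hx, hy]

lemma mulVec_mem_genEigenspace {z : ℂ} {u : Fin k → ℂ} (hu : u ∈ genEigenspace A z) :
    A *ᵥ u ∈ genEigenspace A z := by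
  have := Module.End.mapsTo_maxGenEigenspace_of_comm (Commute.refl (Matrix.toLin' A)) z hu
  simpa [genEigenspace] using this

lemma commute_specProj (z : ℂ) : Commute (specProj A z) A := by
  refine ext_of_genEigenspace A fun w u hu => ?_
  rw [← Matrix.mulVec_mulVec, ← Matrix.mulVec_mulVec]
  by_cases hw : w = z
  · subst hw
    rw [specProj_mulVec_of_mem A hu, specProj_mulVec_of_mem A (mulVec_mem_genEigenspace A hu)]
  · rw [specProj_mulVec_of_mem_ne A hw hu, Matrix.mulVec_zero,
      specProj_mulVec_of_mem_ne A hw (mulVec_mem_genEigenspace A hu)]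

lemma specProj_mul_self (z : ℂ) : specProj A z * specProj A z = specProj A z := by
  refine Matrix.mulVec_injective (funext fun u => ?_)
  rw [← Matrix.mulVec_mulVec, specProj_mulVec_of_mem A (specProj_mulVec_mem A z u)]

lemma finrank_genEigenspace (z : ℂ) :
    Module.finrank ℂ (genEigenspace A z) = A.charpoly.rootMultiplicity z := by
  rw [genEigenspace, LinearMap.finrank_maxGenEigenspace_eq, Matrix.charpoly_toLin']

lemma genEigenspace_eq_bot {z : ℂ} (hz : z ∉ A.charpoly.roots) : genEigenspace A z = ⊥ := by
  rw [← Submodule.finrank_eq_zero (R := ℂ), finrank_genEigenspace, ← Polynomial.count_roots]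
  exact Multiset.count_eq_zero_of_notMem hz

lemma sum_specProj : ∑ z ∈ A.charpoly.roots.toFinset, specProj A z = 1 := by
  refine ext_of_genEigenspace A fun w u hu => ?_
  rw [Matrix.sum_mulVec, Matrix.one_mulVec]
  by_cases hw : w ∈ A.charpoly.roots
  · rw [Finset.sum_eq_single_of_mem w (Multiset.mem_toFinset.2 hw)
      fun z _ hz => specProj_mulVec_of_mem_ne A hz.symm hu, specProj_mulVec_of_mem A hu]
  · rw [genEigenspace_eq_bot A hw, Submodule.mem_bot] at hu
    simp [hu]

lemma sub_pow_finrank_mul_specProj (z : ℂ) : (A - z • 1) ^ k * specProj A z = 0 := by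
  refine Matrix.mulVec_injective (funext fun u => ?_)
  have h := specProj_mulVec_mem A z u
  rw [genEigenspace, Module.End.maxGenEigenspace_eq_genEigenspace_finrank,
    Module.End.mem_genEigenspace_nat, LinearMap.mem_ker, Module.finrank_fin_fun] at h
  have e : Matrix.toLin' A - z • 1 = Matrix.toLin' (A - z • 1) := by
    rw [map_sub, map_smul, Matrix.toLin'_one]; rfl
  rw [e, ← Matrix.toLin'_pow, Matrix.toLin'_apply] at h
  rw [← Matrix.mulVec_mulVec, h, Matrix.zero_mulVec]

lemma specNil_eq (z : ℂ) : specNil A z = (A - z • 1) * specProj A z := by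
  rw [specNil, sub_mul, smul_one_mul]

lemma commute_sub_specProj (z : ℂ) : Commute (A - z • 1) (specProj A z) :=
  ((commute_specProj A z).sub_right ((Commute.one_right _).smul_right z)).symm

lemma specProj_mul_specNil_pow (z : ℂ) (j : ℕ) :
    specProj A z * specNil A z ^ j = (A - z • 1) ^ j * specProj A z := by
  rw [specNil_eq, (commute_sub_specProj A z).mul_pow, ← mul_assoc,
    ((commute_sub_specProj A z).symm.pow_right j).eq, mul_assoc, ← pow_succ']
  congr 1
  exact IsIdempotentElem.pow_succ_eq j (specProj_mul_self A z)

lemma specNil_pow_succ (z : ℂ) (j : ℕ) :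
    specNil A z ^ (j + 1) = (A - z • 1) ^ (j + 1) * specProj A z := by
  rw [specNil_eq, (commute_sub_specProj A z).mul_pow,
    IsIdempotentElem.pow_succ_eq j (specProj_mul_self A z)]

lemma specNil_pow_nilIndex_succ (z : ℂ) : specNil A z ^ (nilIndex A z + 1) = 0 := by
  refine Nat.sInf_mem (s := {ν : ℕ | specNil A z ^ (ν + 1) = 0}) ⟨k, ?_⟩
  rw [Set.mem_ofPred_eq, specNil_pow_succ, pow_succ', mul_assoc, sub_pow_finrank_mul_specProj,
    mul_zero]

lemma sub_pow_mul_specProj_eq_zero {z : ℂ} {j : ℕ} (hj : nilIndex A z < j) :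
    (A - z • 1) ^ j * specProj A z = 0 := by
  obtain ⟨d, rfl⟩ := Nat.exists_eq_add_of_lt hj
  rw [← specNil_pow_succ, show nilIndex A z + d + 1 = nilIndex A z + 1 + d by ring, pow_add,
    specNil_pow_nilIndex_succ, zero_mul]

lemma nilIndex_le (z : ℂ) : nilIndex A z ≤ k := by
  refine Nat.sInf_le ?_
  rw [Set.mem_ofPred_eq, specNil_pow_succ, pow_succ', mul_assoc, sub_pow_finrank_mul_specProj,
    mul_zero]

/-- A left eigenvector at `w` kills the generalized eigenspaces at other points. -/
lemma dotProduct_eq_zero_of_mem_genEigenspace {z w : ℂ} (hzw : w ≠ z) {v u : Fin k → ℂ}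
    (hv : v ᵥ* A = w • v) (hu : u ∈ genEigenspace A z) : v ⬝ᵥ u = 0 := by
  have h := specProj_mulVec_of_mem A hu
  have h2 : v ᵥ* (A - z • 1) = (w - z) • v := by
    rw [Matrix.vecMul_sub, hv, Matrix.vecMul_smul, Matrix.vecMul_one, sub_smul]
  have h3 : ∀ n : ℕ, v ᵥ* (A - z • 1) ^ n = (w - z) ^ n • v := by
    intro n
    induction n with
    | zero => simp
    | succ n ih => rw [pow_succ, ← Matrix.vecMul_vecMul, ih, Matrix.smul_vecMul, h2, smul_smul,
        pow_succ]
  have h4 : ((w - z) ^ k • v) ⬝ᵥ u = 0 := by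
    rw [← h3, ← h, ← Matrix.dotProduct_mulVec, Matrix.mulVec_mulVec,
      sub_pow_finrank_mul_specProj, Matrix.zero_mulVec, dotProduct_zero]
  rw [smul_dotProduct, smul_eq_mul] at h4
  exact (mul_eq_zero.1 h4).resolve_left (pow_ne_zero _ (sub_ne_zero.2 hzw))

end Spectral

/-! ### The principal eigenvalue of a core of index at most one half -/

section Core

variable {k b : ℕ} {A : Matrix (Fin k) (Fin k) ℤ}

lemma re_le_secondRe {z : ℂ} (hz : z ∈ otherEigenvalues b A) : z.re ≤ secondRe b A := by
  refine le_csSup (Set.Finite.bddAbove ?_) ⟨z, hz, rfl⟩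
  have : {r : ℝ | ∃ z ∈ otherEigenvalues b A, z.re = r}
      = Complex.re '' ((otherEigenvalues b A).toFinset : Set ℂ) := by
    ext r; simp
  rw [this]
  exact (Finset.finite_toSet _).image _

variable (hb : 1 ≤ b) (hrow : ∀ i, ∑ j, A i j = b) (hΛ : coreIndex b A ≤ 1 / 2)

include hb hΛ in
lemma secondRe_le : secondRe b A ≤ b / 2 := by
  have hb0 : (0 : ℝ) < b := by exact_mod_cast hb
  rw [coreIndex, div_le_iff₀ hb0] at hΛ
  linarith

include hb hΛ in
/-- A core of index at most one half has `b` as a simple root of its characteristic polynomial. -/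
lemma notMem_otherEigenvalues : (b : ℂ) ∉ otherEigenvalues b A := fun h => by
  have h1 := re_le_secondRe h
  have h2 := secondRe_le hb hΛ
  have hb0 : (0 : ℝ) < b := by exact_mod_cast hb
  rw [Complex.natCast_re] at h1
  linarith

include hrow in
lemma coreC_mulVec_one : coreC A *ᵥ 1 = (b : ℂ) • (1 : Fin k → ℂ) := by
  ext i
  have := congrArg (Int.cast : ℤ → ℂ) (hrow i)
  push_cast at this
  simpa [Matrix.mulVec, dotProduct, coreC] using this

include hrow in
/-- The constants are eigenvectors because all rows have sum `b`. -/
lemma one_mem_genEigenspace : (1 : Fin k → ℂ) ∈ genEigenspace (coreC A) b := by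
  rw [genEigenspace, Module.End.mem_maxGenEigenspace]
  refine ⟨1, ?_⟩
  simp [coreC_mulVec_one hrow]

include hb hΛ hrow in
/-- The principal eigenvalue is simple, so its generalized eigenspace consists of the constant
vectors. -/
lemma mem_genEigenspace_principal (hk : 0 < k) {u : Fin k → ℂ}
    (hu : u ∈ genEigenspace (coreC A) b) : ∃ c : ℂ, u = c • 1 := by
  have : Nonempty (Fin k) := ⟨⟨0, hk⟩⟩
  have hne : (⟨1, one_mem_genEigenspace hrow⟩ : genEigenspace (coreC A) b) ≠ 0 := fun h => by
    have := congrArg Subtype.val h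
    exact one_ne_zero this
  have hle : Module.finrank ℂ (genEigenspace (coreC A) b) ≤ 1 := by
    rw [finrank_genEigenspace, ← Polynomial.count_roots]
    have h0 := Multiset.count_eq_zero_of_notMem (notMem_otherEigenvalues hb hΛ)
    rw [otherEigenvalues, Multiset.count_erase_self] at h0
    omega
  have hpos : 0 < Module.finrank ℂ (genEigenspace (coreC A) b) :=
    Module.finrank_pos_iff_exists_ne_zero.2 ⟨_, hne⟩
  obtain ⟨c, hc⟩ := (finrank_eq_one_iff_of_nonzero' _ hne).1 (le_antisymm hle hpos) ⟨u, hu⟩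
  exact ⟨c, (congrArg Subtype.val hc).symm⟩

lemma ofReal_vecMul_coreC {v : Fin k → ℝ} {c : ℝ}
    (hv : v ᵥ* A.map (fun a => (a : ℝ)) = c • v) :
    (fun i => (v i : ℂ)) ᵥ* coreC A = (c : ℂ) • fun i => (v i : ℂ) := by
  ext j
  have := congrArg (fun r : ℝ => (r : ℂ)) (congrFun hv j)
  simpa [Matrix.vecMul, dotProduct, coreC] using this

include hb hΛ hrow in
/-- The row sums make `b` an eigenvalue; normalizing a left eigenvector to sum one is possible
because the eigenvalue is simple. -/
lemma exists_principalVec (hk : 0 < k) :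
    ∃ v : Fin k → ℝ, v ᵥ* A.map (fun a => (a : ℝ)) = (b : ℝ) • v ∧ ∑ i, v i = 1 := by
  have : Nonempty (Fin k) := ⟨⟨0, hk⟩⟩
  have hdet : (A.map (fun a => (a : ℝ)) - (b : ℝ) • 1).det = 0 := by
    refine Matrix.exists_mulVec_eq_zero_iff.1 ⟨1, one_ne_zero, ?_⟩
    ext i
    have := congrArg (Int.cast : ℤ → ℝ) (hrow i)
    push_cast at this
    rw [Matrix.sub_mulVec, Matrix.smul_mulVec, Matrix.one_mulVec]
    simp [Matrix.mulVec, dotProduct, this]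
  obtain ⟨v, hv0, hv⟩ := Matrix.exists_vecMul_eq_zero_iff.2 hdet
  rw [Matrix.vecMul_sub, Matrix.vecMul_smul, Matrix.vecMul_one, sub_eq_zero] at hv
  have hsum : ∑ i, v i ≠ 0 := by
    intro hs
    refine hv0 ?_
    have hvC := ofReal_vecMul_coreC hv
    -- a left eigenvector orthogonal to the constants is orthogonal to all of the space
    have h0 : vecMulVec (1 : Fin k → ℂ) (fun i => (v i : ℂ)) = 0 := by
      refine ext_of_genEigenspace (coreC A) fun w u hu => ?_
      rw [Matrix.vecMulVec_mulVec, Matrix.zero_mulVec]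
      have : (fun i => (v i : ℂ)) ⬝ᵥ u = 0 := by
        by_cases hw : w = b
        · subst hw
          obtain ⟨c, rfl⟩ := mem_genEigenspace_principal hb hrow hΛ hk hu
          rw [dotProduct_smul, dotProduct_one, ← Complex.ofReal_sum, hs]
          simp
        · exact dotProduct_eq_zero_of_mem_genEigenspace _ (by exact_mod_cast Ne.symm hw) hvC hu
      simp [this]
    ext i
    have := congrFun (congrFun h0 i) i
    simpa [vecMulVec_apply] using this
  refine ⟨(∑ i, v i)⁻¹ • v, ?_, ?_⟩
  · rw [Matrix.smul_vecMul, hv, smul_comm]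
  · simp only [Pi.smul_apply, smul_eq_mul, ← Finset.mul_sum]
    exact inv_mul_cancel₀ hsum

include hb hΛ hrow in
lemma principalVec_spec (hk : 0 < k) :
    principalVec b A ᵥ* A.map (fun a => (a : ℝ)) = (b : ℝ) • principalVec b A
      ∧ ∑ i, principalVec b A i = 1 := by
  have h := exists_principalVec hb hrow hΛ hk
  rw [principalVec, dif_pos h]
  exact Classical.choose_spec h

include hb hΛ hrow in
/-- The projection at the principal eigenvalue has rank one; its range is spanned by the constants
and its rows all equal `v₁`. -/
lemma specProj_principal (hk : 0 < k) :
    specProj (coreC A) b = vecMulVec 1 (fun i => (principalVec b A i : ℂ)) := by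
  obtain ⟨hv, hs⟩ := principalVec_spec hb hrow hΛ hk
  have hvC := ofReal_vecMul_coreC hv
  refine ext_of_genEigenspace (coreC A) fun w u hu => ?_
  rw [Matrix.vecMulVec_mulVec]
  by_cases hw : w = b
  · subst hw
    rw [specProj_mulVec_of_mem _ hu]
    obtain ⟨c, rfl⟩ := mem_genEigenspace_principal hb hrow hΛ hk hu
    rw [dotProduct_smul, dotProduct_one, ← Complex.ofReal_sum, hs]
    simp
  · rw [specProj_mulVec_of_mem_ne _ hw hu,
      dotProduct_eq_zero_of_mem_genEigenspace _ (by exact_mod_cast Ne.symm hw) hvC hu]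
    simp

lemma conjTranspose_coreC : (coreC A)ᴴ = (coreC A)ᵀ := by
  ext i j; simp [coreC]

include hb hΛ hrow in
lemma conjTranspose_projHat (hk : 0 < k) : (projHat b A)ᴴ = (projHat b A)ᵀ := by
  ext i j
  simp [projHat, specProj_principal hb hrow hΛ hk, Matrix.one_apply, apply_ite]

lemma commute_projHat : Commute (projHat b A) (coreC A) :=
  (Commute.one_left _).sub_left (commute_specProj _ _)

/-- The eigenvalues different from the principal one, without multiplicity. -/
noncomputable def minorEigenvalues (b : ℕ) (A : Matrix (Fin k) (Fin k) ℤ) : Finset ℂ :=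
  (coreC A).charpoly.roots.toFinset.erase (b : ℂ)

lemma mem_minorEigenvalues {z : ℂ} :
    z ∈ minorEigenvalues b A ↔ z ≠ b ∧ z ∈ (coreC A).charpoly.roots := by
  simp [minorEigenvalues]

lemma mem_otherEigenvalues_of_mem {z : ℂ} (hz : z ∈ minorEigenvalues b A) :
    z ∈ otherEigenvalues b A := by
  rw [mem_minorEigenvalues] at hz
  exact (Multiset.mem_erase_of_ne hz.1).2 hz.2

include hrow in
lemma natCast_mem_roots (hk : 0 < k) : (b : ℂ) ∈ (coreC A).charpoly.roots := by
  by_contra h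
  have h1 := one_mem_genEigenspace (b := b) hrow
  have : Nonempty (Fin k) := ⟨⟨0, hk⟩⟩
  rw [genEigenspace_eq_bot _ h, Submodule.mem_bot] at h1
  exact one_ne_zero h1

include hrow in
lemma projHat_eq_sum (hk : 0 < k) :
    projHat b A = ∑ z ∈ minorEigenvalues b A, specProj (coreC A) z := by
  rw [projHat, ← sum_specProj (coreC A), minorEigenvalues, sub_eq_iff_eq_add]
  exact (Finset.sum_erase_add _ _ (Multiset.mem_toFinset.2 (natCast_mem_roots hrow hk))).symm

lemma nilIndex_le_nuTwo {z : ℂ} (hz : z ∈ minorEigenvalues b A) (hre : z.re = secondRe b A) :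
    nilIndex (coreC A) z ≤ nuTwo b A :=
  Finset.le_sup (f := nilIndex (coreC A))
    (Finset.mem_filter.2 ⟨Multiset.mem_toFinset.2 (mem_otherEigenvalues_of_mem hz), hre⟩)

lemma nuTwo_le : nuTwo b A ≤ k := Finset.sup_le fun z _ => nilIndex_le _ z

end Core

/-! ### Moments of one sample -/

section Moments

variable {k : ℕ}

lemma mem_samples {s : ℕ} {q : Fin k → ℕ} : q ∈ samples k s ↔ ∑ i, q i = s := by
  simp [samples]

lemma sum_add_single (q : Fin k → ℕ) (i : Fin k) (n : ℕ) :
    ∑ l, (q + Pi.single i n : Fin k → ℕ) l = (∑ l, q l) + n := by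
  simp [Finset.sum_add_distrib]

/-- Size biasing: weighting the samples of size `s + 1` by the count of one color amounts to adding
one ball of that color to the samples of size `s`. -/
lemma sum_samples_succ_mul (s : ℕ) (i : Fin k) (F : (Fin k → ℕ) → ℝ) :
    ∑ q ∈ samples k (s + 1), (q i : ℝ) * F q
      = ∑ q ∈ samples k s, ((q i : ℝ) + 1) * F (q + Pi.single i 1) := by
  rw [← Finset.sum_filter_add_sum_filter_not (samples k (s + 1)) (fun q => q i ≠ 0)]
  rw [Finset.sum_eq_zero (s := (samples k (s + 1)).filter fun q => ¬ q i ≠ 0) (fun q hq => by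
    have := (Finset.mem_filter.1 hq).2
    simp only [ne_eq, not_not] at this
    simp [this]), add_zero]
  have hsub : ∀ q : Fin k → ℕ, q i ≠ 0 → q - Pi.single i 1 + Pi.single i 1 = q := fun q hq => by
    funext l
    by_cases hl : l = i
    · subst hl; simp; omega
    · simp [hl]
  refine Finset.sum_nbij' (fun q => q - Pi.single i 1) (fun q => q + Pi.single i 1) ?_ ?_ ?_ ?_ ?_
  · intro q hq
    obtain ⟨h1, h2⟩ := Finset.mem_filter.1 hq
    rw [mem_samples] at h1 ⊢
    have := sum_add_single (q - Pi.single i 1 : Fin k → ℕ) i 1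
    rw [hsub q h2, h1] at this
    omega
  · intro q hq
    rw [mem_samples] at hq
    rw [Finset.mem_filter, mem_samples, sum_add_single, hq]
    simp
  · intro q hq
    exact hsub q (Finset.mem_filter.1 hq).2
  · intro q _
    funext l
    simp
  · intro q hq
    have h2 := (Finset.mem_filter.1 hq).2
    have : ((q - Pi.single i 1 : Fin k → ℕ) i : ℝ) + 1 = q i := by
      simp only [Pi.sub_apply, Pi.single_eq_same]
      exact_mod_cast Nat.succ_pred_eq_of_ne_zero h2
    rw [this, hsub q h2]

/-- The Chu–Vandermonde identity for several variables. -/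
lemma sum_piAntidiag_prod_choose {ι : Type*} [DecidableEq ι] (t : Finset ι) (x : ι → ℕ) (n : ℕ) :
    ∑ q ∈ t.piAntidiag n, ∏ i ∈ t, (x i).choose (q i) = (∑ i ∈ t, x i).choose n := by
  induction t using Finset.cons_induction generalizing n with
  | empty =>
    rw [Finset.piAntidiag_empty]
    split_ifs with h
    · simp [h]
    · simp [Nat.choose_eq_zero_of_lt (Nat.pos_of_ne_zero h)]
  | cons a t ha ih =>
    rw [Finset.piAntidiag_cons ha, Finset.sum_disjiUnion, Finset.sum_cons, Nat.add_choose_eq]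
    refine Finset.sum_congr rfl fun p _ => ?_
    rw [Finset.sum_map, ← ih, Finset.mul_sum]
    refine Finset.sum_congr rfl fun q hq => ?_
    have hqa : q a = 0 := by
      by_contra h
      exact ha ((Finset.mem_piAntidiag.1 hq).2 a h)
    rw [Finset.prod_cons]
    congr 1
    · simp [addRightEmbedding, hqa]
    · refine Finset.prod_congr rfl fun i hi => ?_
      have : i ≠ a := fun h => ha (h ▸ hi)
      simp [addRightEmbedding, this]

lemma multinomial_add_single {s : ℕ} {q : Fin k → ℕ} (hq : q ∈ samples k s) (i : Fin k) :
    (q i + 1) * Nat.multinomial Finset.univ (q + Pi.single i 1)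
      = (s + 1) * Nat.multinomial Finset.univ q := by
  rw [mem_samples] at hq
  have h1 := Nat.multinomial_spec Finset.univ q
  have h2 := Nat.multinomial_spec Finset.univ (q + Pi.single i 1)
  rw [sum_add_single, hq, Nat.factorial_succ] at h2
  rw [hq] at h1
  have h3 : ∏ l, ((q + Pi.single i 1 : Fin k → ℕ) l).factorial
      = (q i + 1) * ∏ l, (q l).factorial := by
    rw [← Finset.mul_prod_erase _ _ (Finset.mem_univ i),
      ← Finset.mul_prod_erase _ (fun l => (q l).factorial) (Finset.mem_univ i), ← mul_assoc]
    congr 1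
    · simp [Nat.factorial_succ]
    · refine Finset.prod_congr rfl fun l hl => ?_
      simp [Finset.ne_of_mem_erase hl]
  rw [h3, ← h1] at h2
  have hpos : 0 < ∏ l, (q l).factorial := Finset.prod_pos fun l _ => Nat.factorial_pos _
  refine Nat.eq_of_mul_eq_mul_left hpos ?_
  linarith

/-- First moments of the multinomial weights. -/
lemma sum_mul_multinomial (s : ℕ) (x : Fin k → ℝ) (i : Fin k) :
    ∑ q ∈ samples k s, (q i : ℝ) * (Nat.multinomial Finset.univ q * ∏ l, x l ^ q l)
      = s * x i * (∑ l, x l) ^ (s - 1) := by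
  cases s with
  | zero => simp [samples]
  | succ s =>
    rw [sum_samples_succ_mul, Nat.add_sub_cancel, Finset.sum_pow_eq_sum_piAntidiag, Finset.mul_sum]
    refine Finset.sum_congr rfl fun q hq => ?_
    have h1 := congrArg (Nat.cast : ℕ → ℝ) (multinomial_add_single hq i)
    have h2 : ∏ l, x l ^ (q + Pi.single i 1 : Fin k → ℕ) l = x i * ∏ l, x l ^ q l := by
      simp only [Pi.add_apply, pow_add, Finset.prod_mul_distrib, Pi.single_apply, pow_ite, pow_one,
        pow_zero, Finset.prod_ite_eq', Finset.mem_univ, if_true]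
      ring
    push_cast at h1 ⊢
    rw [h2, ← mul_assoc, h1]
    ring

/-- Second moments of the multinomial weights. -/
lemma sum_mul_mul_multinomial (s : ℕ) (x : Fin k → ℝ) (i j : Fin k) :
    ∑ q ∈ samples k (s + 1), (q i : ℝ) * ((q j : ℝ) *
        (Nat.multinomial Finset.univ q * ∏ l, x l ^ q l))
      = (s + 1) * x i * (s * x j * (∑ l, x l) ^ (s - 1)
        + if j = i then (∑ l, x l) ^ s else 0) := by
  rw [sum_samples_succ_mul, ← sum_mul_multinomial]
  have h : (if j = i then (∑ l, x l) ^ s else 0) = ∑ q ∈ samples k s,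
      (if j = i then (Nat.multinomial Finset.univ q * ∏ l, x l ^ q l) else 0) := by
    split_ifs
    · exact Finset.sum_pow_eq_sum_piAntidiag _ _ _
    · simp
  rw [h, ← Finset.sum_add_distrib, Finset.mul_sum]
  refine Finset.sum_congr rfl fun q hq => ?_
  have h1 := congrArg (Nat.cast : ℕ → ℝ) (multinomial_add_single hq i)
  have h2 : ∏ l, x l ^ (q + Pi.single i 1 : Fin k → ℕ) l = x i * ∏ l, x l ^ q l := by
    simp only [Pi.add_apply, pow_add, Finset.prod_mul_distrib, Pi.single_apply, pow_ite, pow_one,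
      pow_zero, Finset.prod_ite_eq', Finset.mem_univ, if_true]
    ring
  push_cast at h1
  have h3 : (((q + Pi.single i 1 : Fin k → ℕ) j : ℕ) : ℝ) = q j + if j = i then 1 else 0 := by
    simp [Pi.single_apply]
  rw [h2, h3]
  calc _ = (q j + if j = i then 1 else 0) *
        (((q i : ℝ) + 1) * (Nat.multinomial Finset.univ (q + Pi.single i 1) : ℝ)
          * (x i * ∏ l, x l ^ q l)) := by ring
    _ = _ := by rw [h1]; split_ifs <;> ring

lemma succ_mul_prod_choose (x q : Fin k → ℕ) (i : Fin k) :
    (q i + 1) * ∏ l, (x l).choose ((q + Pi.single i 1 : Fin k → ℕ) l)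
      = x i * ∏ l, ((x - Pi.single i 1 : Fin k → ℕ) l).choose (q l) := by
  rw [← Finset.mul_prod_erase _ _ (Finset.mem_univ i)]
  conv_rhs => rw [← Finset.mul_prod_erase _ _ (Finset.mem_univ i)]
  rw [← mul_assoc, ← mul_assoc]
  congr 1
  · simp only [Pi.add_apply, Pi.sub_apply, Pi.single_eq_same]
    cases hx : x i with
    | zero => simp
    | succ n =>
      rw [Nat.add_sub_cancel, mul_comm]
      exact (Nat.add_one_mul_choose_eq n (q i)).symm
  · refine Finset.prod_congr rfl fun l hl => ?_
    simp [Finset.ne_of_mem_erase hl]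

lemma sum_sub_single {x : Fin k → ℕ} {i : Fin k} (hx : x i ≠ 0) :
    ∑ l, (x - Pi.single i 1 : Fin k → ℕ) l = ∑ l, x l - 1 := by
  have h : x - Pi.single i 1 + Pi.single i 1 = x := by
    funext l
    by_cases hl : l = i
    · subst hl; simp; omega
    · simp [hl]
  have := sum_add_single (x - Pi.single i 1 : Fin k → ℕ) i 1
  rw [h] at this
  omega

/-- First moments of the hypergeometric weights. -/
lemma sum_mul_prod_choose (s : ℕ) (x : Fin k → ℕ) (i : Fin k) :
    ∑ q ∈ samples k (s + 1), (q i : ℝ) * ((∏ l, (x l).choose (q l) : ℕ) : ℝ)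
      = x i * ((∑ l, x l - 1).choose s : ℕ) := by
  rw [sum_samples_succ_mul]
  have h : ∀ q : Fin k → ℕ, ((q i : ℝ) + 1)
      * ((∏ l, (x l).choose ((q + Pi.single i 1 : Fin k → ℕ) l) : ℕ) : ℝ)
      = x i * ((∏ l, ((x - Pi.single i 1 : Fin k → ℕ) l).choose (q l) : ℕ) : ℝ) := fun q => by
    exact_mod_cast succ_mul_prod_choose x q i
  rw [Finset.sum_congr rfl fun q _ => h q, ← Finset.mul_sum, ← Nat.cast_sum, samples,
    sum_piAntidiag_prod_choose]
  by_cases hx : x i = 0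
  · simp [hx]
  · rw [sum_sub_single hx]

/-- Second moments of the hypergeometric weights. -/
lemma sum_mul_mul_prod_choose (s : ℕ) (x : Fin k → ℕ) (i j : Fin k) :
    ∑ q ∈ samples k (s + 1), (q i : ℝ) * ((q j : ℝ) * ((∏ l, (x l).choose (q l) : ℕ) : ℝ))
      = x i * (((x j : ℝ) - if j = i then 1 else 0) *
          (if s = 0 then 0 else ((∑ l, x l - 2).choose (s - 1) : ℕ))
        + if j = i then ((∑ l, x l - 1).choose s : ℕ) else 0) := by
  rw [sum_samples_succ_mul]
  have h : ∀ q : Fin k → ℕ, ((q i : ℝ) + 1) * ((((q + Pi.single i 1 : Fin k → ℕ) j : ℕ) : ℝ) *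
      ((∏ l, (x l).choose ((q + Pi.single i 1 : Fin k → ℕ) l) : ℕ) : ℝ))
      = x i * ((q j : ℝ) * ((∏ l, ((x - Pi.single i 1 : Fin k → ℕ) l).choose (q l) : ℕ) : ℝ)
        + if j = i then ((∏ l, ((x - Pi.single i 1 : Fin k → ℕ) l).choose (q l) : ℕ) : ℝ)
          else 0) := by
    intro q
    have h1 : ((q i : ℝ) + 1) * ((∏ l, (x l).choose ((q + Pi.single i 1 : Fin k → ℕ) l) : ℕ) : ℝ)
      = x i * ((∏ l, ((x - Pi.single i 1 : Fin k → ℕ) l).choose (q l) : ℕ) : ℝ) := by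
      exact_mod_cast succ_mul_prod_choose x q i
    have h3 : (((q + Pi.single i 1 : Fin k → ℕ) j : ℕ) : ℝ) = q j + if j = i then 1 else 0 := by
      simp [Pi.single_apply]
    rw [h3]
    calc _ = (q j + if j = i then 1 else 0) *
          (((q i : ℝ) + 1)
            * ((∏ l, (x l).choose ((q + Pi.single i 1 : Fin k → ℕ) l) : ℕ) : ℝ)) := by ring
      _ = _ := by rw [h1]; split_ifs <;> ring
  rw [Finset.sum_congr rfl fun q _ => h q, ← Finset.mul_sum, Finset.sum_add_distrib]
  by_cases hx : x i = 0
  · simp [hx]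
  · congr 2
    · cases s with
      | zero => simp [samples]
      | succ s =>
        rw [sum_mul_prod_choose, sum_sub_single hx, if_neg s.succ_ne_zero, Nat.sub_sub]
        congr 1
        simp only [Pi.sub_apply, Pi.single_apply]
        split_ifs with hji
        · subst hji
          rw [Nat.cast_sub (Nat.one_le_iff_ne_zero.2 hx), Nat.cast_one]
        · simp
    · split_ifs
      · rw [← Nat.cast_sum, samples, sum_piAntidiag_prod_choose, sum_sub_single hx]
      · simp

/-- The correction in the second factorial moment: `1` for draws without replacement, `0` for draws
with replacement. -/
def depletion : Sampling → ℝ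
  | .withoutReplacement => 1
  | .withReplacement => 0

lemma drawProb_eq_zero {mode : Sampling} {s : ℕ} {x q : Fin k → ℕ} (hq : q ∉ samples k s) :
    drawProb mode s x q = 0 := if_neg hq

lemma drawProb_nonneg (mode : Sampling) (s : ℕ) (x q : Fin k → ℕ) :
    0 ≤ drawProb mode s x q := by
  unfold drawProb
  split_ifs
  · cases mode <;> simp only <;> positivity
  · exact le_rfl

/-- The mean number of balls of color `i` in a sample. -/
lemma sum_drawProb_mul (mode : Sampling) {s : ℕ} (hs : 1 ≤ s) {x : Fin k → ℕ}
    (hx : minSize mode s ≤ ∑ l, x l) (i : Fin k) :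
    ∑ q ∈ samples k s, drawProb mode s x q * (q i : ℝ)
      = s * x i / ((∑ l, x l : ℕ) : ℝ) := by
  obtain ⟨s, rfl⟩ := Nat.exists_eq_add_of_le' hs
  cases mode with
  | withoutReplacement =>
    simp only [minSize] at hx
    have h := sum_mul_prod_choose s x i
    have e : ∀ q ∈ samples k (s + 1), drawProb .withoutReplacement (s + 1) x q * (q i : ℝ)
        = ((q i : ℝ) * ((∏ l, (x l).choose (q l) : ℕ) : ℝ)) / ((∑ l, x l).choose (s + 1) : ℝ) :=
      fun q hq => by
        simp only [drawProb, if_pos hq]; push_cast; ring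
    rw [Finset.sum_congr rfl e, ← Finset.sum_div, h]
    obtain ⟨n, hn⟩ := Nat.exists_eq_add_of_le' (le_trans (Nat.le_add_left 1 s) hx)
    have hc : 0 < (∑ l, x l).choose (s + 1) := Nat.choose_pos hx
    rw [hn] at hc ⊢
    have h2 := congrArg (Nat.cast : ℕ → ℝ) (Nat.add_one_mul_choose_eq n s)
    push_cast at h2 ⊢
    have hc' : ((n + 1).choose (s + 1) : ℝ) ≠ 0 := by exact_mod_cast hc.ne'
    rw [div_eq_div_iff hc' (by positivity)]
    linear_combination (x i : ℝ) * h2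
  | withReplacement =>
    simp only [minSize] at hx
    have h := sum_mul_multinomial (s + 1) (fun l => (x l : ℝ)) i
    have e : ∀ q ∈ samples k (s + 1), drawProb .withReplacement (s + 1) x q * (q i : ℝ)
        = ((q i : ℝ) * (Nat.multinomial Finset.univ q * ∏ l, (x l : ℝ) ^ q l))
          / ((∑ l, x l : ℕ) : ℝ) ^ (s + 1) :=
      fun q hq => by
        simp only [drawProb, if_pos hq]; ring
    rw [Finset.sum_congr rfl e, ← Finset.sum_div, h]
    have h0 : ((∑ l, x l : ℕ) : ℝ) ≠ 0 := by positivity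
    rw [Nat.add_sub_cancel, ← Nat.cast_sum]
    field_simp
    ring

/-- The second moments of a sample under both schemes; `depletion` is the number of balls that a
draw removes before the next one is made. -/
lemma sum_drawProb_mul_mul (mode : Sampling) {s : ℕ} (hs : 1 ≤ s) {x : Fin k → ℕ}
    (hx : minSize mode s ≤ ∑ l, x l) (i j : Fin k) :
    ∑ q ∈ samples k s, drawProb mode s x q * ((q i : ℝ) * q j)
      = s * (s - 1) / ((∑ l, x l : ℕ) * ((∑ l, x l : ℕ) - depletion mode))
          * (x i * (x j - if j = i then depletion mode else 0))
        + if j = i then s * x i / ((∑ l, x l : ℕ) : ℝ) else 0 := by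
  obtain ⟨s, rfl⟩ := Nat.exists_eq_add_of_le' hs
  cases mode with
  | withoutReplacement =>
    simp only [minSize] at hx
    simp only [depletion]
    have h := sum_mul_mul_prod_choose s x i j
    have e : ∀ q ∈ samples k (s + 1),
        drawProb .withoutReplacement (s + 1) x q * ((q i : ℝ) * q j)
        = ((q i : ℝ) * ((q j : ℝ) * ((∏ l, (x l).choose (q l) : ℕ) : ℝ)))
          / ((∑ l, x l).choose (s + 1) : ℝ) :=
      fun q hq => by
        simp only [drawProb, if_pos hq]; push_cast; ring
    rw [Finset.sum_congr rfl e, ← Finset.sum_div, h]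
    obtain ⟨n, hn⟩ := Nat.exists_eq_add_of_le' (le_trans (Nat.le_add_left 1 s) hx)
    have hc : 0 < (∑ l, x l).choose (s + 1) := Nat.choose_pos hx
    rw [hn] at hc hx ⊢
    have h2 := congrArg (Nat.cast : ℕ → ℝ) (Nat.add_one_mul_choose_eq n s)
    push_cast at h2
    have hc' : ((n + 1).choose (s + 1) : ℝ) ≠ 0 := by exact_mod_cast hc.ne'
    have hdiag : ((x i : ℝ) * ((if j = i then (n + 1 - 1).choose s else 0 : ℕ) : ℝ))
        / ((n + 1).choose (s + 1) : ℝ)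
        = if j = i then ((s + 1 : ℕ) : ℝ) * x i / ((n + 1 : ℕ) : ℝ) else 0 := by
      split_ifs
      · rw [Nat.add_sub_cancel, div_eq_div_iff hc' (by positivity)]
        push_cast
        linear_combination (x i : ℝ) * h2
      · simp
    rw [← hdiag, mul_add, add_div]
    congr 1
    cases s with
    | zero => simp
    | succ s =>
      obtain ⟨m, rfl⟩ := Nat.exists_eq_add_of_le' (show 1 ≤ n by omega)
      have h3 := congrArg (Nat.cast : ℕ → ℝ) (Nat.add_one_mul_choose_eq m s)
      push_cast at h3
      rw [if_neg s.succ_ne_zero, show m + 1 + 1 - 2 = m by omega, Nat.add_sub_cancel]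
      have h4 : (((m + 1 + 1 : ℕ) : ℝ) * (((m + 1 + 1 : ℕ) : ℝ) - 1)) ≠ 0 := by
        push_cast
        rw [add_sub_cancel_right]; positivity
      rw [div_mul_eq_mul_div, div_eq_div_iff hc' h4]
      push_cast at h2 ⊢
      set c2 := ((m + 1 + 1).choose (s + 1 + 1) : ℝ)
      set c1 := ((m + 1).choose (s + 1) : ℝ)
      set d := if j = i then (1 : ℝ) else 0
      linear_combination (x i : ℝ) * ((x j : ℝ) - d) * (m + 1 + 1) * h3
        + (x i : ℝ) * ((x j : ℝ) - d) * (s + 1) * h2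
  | withReplacement =>
    simp only [minSize] at hx
    simp only [depletion, ite_self, sub_zero]
    have h := sum_mul_mul_multinomial s (fun l => (x l : ℝ)) i j
    have e : ∀ q ∈ samples k (s + 1),
        drawProb .withReplacement (s + 1) x q * ((q i : ℝ) * q j)
        = ((q i : ℝ) * ((q j : ℝ) * (Nat.multinomial Finset.univ q * ∏ l, (x l : ℝ) ^ q l)))
          / ((∑ l, x l : ℕ) : ℝ) ^ (s + 1) :=
      fun q hq => by
        simp only [drawProb, if_pos hq]; ring
    rw [Finset.sum_congr rfl e, ← Finset.sum_div, h]
    have h0 : ((∑ l, x l : ℕ) : ℝ) ≠ 0 := by positivity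
    rw [← Nat.cast_sum, mul_add, add_div]
    congr 1
    · cases s with
      | zero => simp
      | succ s =>
        rw [Nat.add_sub_cancel]
        push_cast
        push_cast at h0
        field_simp
        ring
    · split_ifs
      · push_cast
        push_cast at h0
        field_simp
        ring
      · simp

end Moments

/-! ### Affine schemes have linear replacement rules -/

section Affine

variable {k s : ℕ} {M : (Fin k → ℕ) → Fin k → ℤ}

/-- An urn that holds just `s` balls is drawn empty by a sample without replacement. -/
lemma drawProb_self_withoutReplacement {q₀ q : Fin k → ℕ} (h₀ : q₀ ∈ samples k s)
    (hq : q ∈ samples k s) :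
    drawProb .withoutReplacement s q₀ q = if q = q₀ then 1 else 0 := by
  rw [drawProb, if_pos hq]
  rw [mem_samples.1 h₀, Nat.choose_self, Nat.cast_one, div_one]
  split_ifs with h
  · simp [h]
  · have hlt : ∃ i, q₀ i < q i := by
      by_contra hcon
      push Not at hcon
      refine h (funext fun i => ?_)
      exact (Finset.sum_eq_sum_iff_of_le fun i _ => hcon i).1
        ((mem_samples.1 hq).trans (mem_samples.1 h₀).symm) i (Finset.mem_univ i)
    obtain ⟨i, hi⟩ := hlt
    exact Finset.prod_eq_zero (Finset.mem_univ i) (by rw [Nat.choose_eq_zero_of_lt hi]; simp)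

lemma single_mem_samples (i : Fin k) : Pi.single i s ∈ samples k s := by
  simp [mem_samples]

/-- If a weighted sum of monomials of degree `s` vanishes at all points of `ℕ^k`, the weights
vanish. -/
lemma eq_zero_of_forall_sum_prod_pow_eq_zero {c : (Fin k → ℕ) → ℝ}
    (h : ∀ x : Fin k → ℕ, ∑ q ∈ samples k s, c q * ∏ l, (x l : ℝ) ^ q l = 0) {q : Fin k → ℕ}
    (hq : q ∈ samples k s) : c q = 0 := by
  set P : MvPolynomial (Fin k) ℝ := ∑ q ∈ samples k s,
    MvPolynomial.monomial (Finsupp.equivFunOnFinite.symm q) (c q)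
  have hP : P = 0 := by
    refine MvPolynomial.funext_set (fun _ => Set.range (Nat.cast : ℕ → ℝ))
      (fun _ => Set.infinite_range_of_injective Nat.cast_injective) fun x hx => ?_
    choose y hy using fun i => hx i (Set.mem_univ i)
    have hxy : x = fun i => (y i : ℝ) := funext fun i => (hy i).symm
    rw [map_zero, ← h y, map_sum, hxy]
    refine Finset.sum_congr rfl fun q _ => ?_
    rw [MvPolynomial.eval_monomial, Finsupp.prod_fintype _ _ (by simp)]
    rfl
  have h1 := congrArg (MvPolynomial.coeff (Finsupp.equivFunOnFinite.symm q)) hP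
  rw [MvPolynomial.coeff_sum, MvPolynomial.coeff_zero,
    Finset.sum_eq_single_of_mem q hq (fun q' _ hne => ?_), MvPolynomial.coeff_monomial,
    if_pos rfl] at h1
  · exact h1
  · rw [MvPolynomial.coeff_monomial, if_neg]
    exact fun h => hne (Finsupp.equivFunOnFinite.symm.injective h)

/-- In an affine scheme the replacement rule is linear: the row of a sample `q` is `q A / s`. -/
lemma replacement_eq {mode : Sampling} (hs : 1 ≤ s) (haff : IsAffine mode s M) {q : Fin k → ℕ}
    (hq : q ∈ samples k s) (j : Fin k) :
    (M q j : ℝ) = (∑ i, (q i : ℝ) * (core s M i j : ℝ)) / s := by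
  have hs0 : (s : ℝ) ≠ 0 := by positivity
  cases mode with
  | withoutReplacement =>
    obtain ⟨C, hC⟩ := haff s
    have hval : ∀ q₀ ∈ samples k s, (q₀ j : ℝ) + M q₀ j = ∑ i, (q₀ i : ℝ) * C i j := by
      intro q₀ h₀
      have h := hC q₀ (mem_samples.1 h₀) j
      rw [Finset.sum_congr rfl fun q hq => by rw [drawProb_self_withoutReplacement h₀ hq]] at h
      simp only [ite_mul, one_mul, zero_mul, Finset.sum_ite_eq', h₀, if_true] at h
      exact h
    have hcol : ∀ i, C i j = (if i = j then 1 else 0) + (core s M i j : ℝ) / s := by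
      intro i
      have h := hval _ (single_mem_samples i)
      have e : ∑ l, ((Pi.single i s : Fin k → ℕ) l : ℝ) * C l j = s * C i j := by
        rw [Finset.sum_eq_single_of_mem i (Finset.mem_univ i) (fun l _ hl => by
          simp [hl])]
        simp
      rw [e] at h
      have e2 : ((Pi.single i s : Fin k → ℕ) j : ℝ) = s * if i = j then 1 else 0 := by
        simp [Pi.single_apply, eq_comm]
      rw [e2] at h
      have e3 : (M (Pi.single i s) j : ℝ) = core s M i j := rfl
      rw [e3] at h
      field_simp
      linarith
    have h := hval q hq
    simp only [hcol, mul_add, Finset.sum_add_distrib, mul_ite, mul_one, mul_zero,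
      Finset.sum_ite_eq', Finset.mem_univ, if_true] at h
    rw [Finset.sum_div]
    simp only [mul_div_assoc]
    linarith
  | withReplacement =>
    -- the mean replacement is a homogeneous polynomial identity in the composition
    have key : ∀ x : Fin k → ℕ, ∑ q ∈ samples k s, ((Nat.multinomial Finset.univ q : ℝ) *
        ((M q j : ℝ) - (∑ i, (q i : ℝ) * (core s M i j : ℝ)) / s)) * ∏ l, (x l : ℝ) ^ q l = 0 := by
      intro x
      by_cases hx0 : ∑ l, x l = 0
      · refine Finset.sum_eq_zero fun q hq => ?_
        have hq1 : ∑ l, q l ≠ 0 := by rw [mem_samples.1 hq]; omega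
        obtain ⟨l, -, hl⟩ := Finset.exists_ne_zero_of_sum_ne_zero hq1
        have hxl : x l = 0 := Finset.sum_eq_zero_iff.1 hx0 l (Finset.mem_univ l)
        rw [Finset.prod_eq_zero (Finset.mem_univ l) (by simp [hxl, hl]), mul_zero]
      · obtain ⟨τ, hτ⟩ : ∃ τ, ∑ l, x l = τ := ⟨_, rfl⟩
        rw [hτ] at hx0
        have hτ0 : (τ : ℝ) ≠ 0 := by exact_mod_cast hx0
        obtain ⟨C, hC⟩ := haff τ
        have hone : ∀ i, ∑ q ∈ samples k s, drawProb .withReplacement s (Pi.single i τ) q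
            * (M q j : ℝ) = core s M i j := by
          intro i
          rw [Finset.sum_eq_single_of_mem _ (single_mem_samples i)]
          · rw [drawProb, if_pos (single_mem_samples i)]
            have e1 : ∏ l, (((Pi.single i τ : Fin k → ℕ) l : ℕ) : ℝ)
                ^ ((Pi.single i s : Fin k → ℕ) l) = (τ : ℝ) ^ s := by
              rw [Finset.prod_eq_single i (fun l _ hl => by simp [hl]) (by simp)]
              simp
            have e2 : ∑ l, (Pi.single i τ : Fin k → ℕ) l = τ := by simp
            have e3 : Nat.multinomial Finset.univ (Pi.single i s : Fin k → ℕ) = 1 := by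
              have h := Nat.multinomial_spec Finset.univ (Pi.single i s : Fin k → ℕ)
              have h2 : ∏ l, ((Pi.single i s : Fin k → ℕ) l).factorial = s.factorial := by
                rw [Finset.prod_eq_single i (fun l _ hl => by simp [hl]) (by simp)]
                simp
              rw [h2, mem_samples.1 (single_mem_samples i)] at h
              exact Nat.eq_of_mul_eq_mul_left s.factorial_pos (by rw [h, mul_one])
            rw [e1, e2, e3, Nat.cast_one, one_mul, div_self (pow_ne_zero _ hτ0), one_mul]
            rfl
          · intro q hq hne
            have : ∃ l, l ≠ i ∧ q l ≠ 0 := by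
              by_contra hcon
              push Not at hcon
              refine hne (funext fun l => ?_)
              by_cases hl : l = i
              · subst hl
                have := mem_samples.1 hq
                rw [Finset.sum_eq_single l (fun m _ hm => hcon m hm) (by simp)] at this
                simp [this]
              · simp [hcon l hl, hl]
            obtain ⟨l, hl, hql⟩ := this
            rw [drawProb, if_pos hq]
            rw [Finset.prod_eq_zero (Finset.mem_univ l) (by simp [hl, hql])]
            simp
        have hcol : ∀ i, C i j = (if i = j then 1 else 0) + (core s M i j : ℝ) / τ := by
          intro i
          have h := hC (Pi.single i τ) (by simp) j
          rw [hone i] at h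
          have e : ((fun l => ((Pi.single i τ : Fin k → ℕ) l : ℝ)) ᵥ* C) j = τ * C i j := by
            simp only [Matrix.vecMul, dotProduct]
            rw [Finset.sum_eq_single_of_mem i (Finset.mem_univ i) (fun l _ hl => by
              simp [hl])]
            simp
          have e2 : ((Pi.single i τ : Fin k → ℕ) j : ℝ) = τ * if i = j then 1 else 0 := by
            simp [Pi.single_apply, eq_comm]
          rw [e, e2] at h
          field_simp
          linarith
        have hmean := hC x hτ j
        have e : ((fun l => (x l : ℝ)) ᵥ* C) j
            = x j + (∑ i, (x i : ℝ) * (core s M i j : ℝ)) / τ := by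
          simp only [Matrix.vecMul, dotProduct, hcol, mul_add, Finset.sum_add_distrib, mul_ite,
            mul_one, mul_zero, Finset.sum_ite_eq', Finset.mem_univ, if_true, Finset.sum_div,
            mul_div_assoc]
        rw [e, add_right_inj] at hmean
        have hlin : ∑ q ∈ samples k s, drawProb .withReplacement s x q *
            ((∑ i, (q i : ℝ) * (core s M i j : ℝ)) / s)
              = (∑ i, (x i : ℝ) * (core s M i j : ℝ)) / τ := by
          have hmin : minSize .withReplacement s ≤ ∑ l, x l := by
            simp only [minSize, hτ]; omega
          have h1 : ∀ i, ∑ q ∈ samples k s, drawProb .withReplacement s x q * (q i : ℝ)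
              = s * x i / τ := fun i => by
            rw [sum_drawProb_mul .withReplacement hs hmin i, hτ]
          simp only [Finset.sum_div, Finset.mul_sum]
          rw [Finset.sum_comm]
          refine Finset.sum_congr rfl fun i _ => ?_
          have : ∀ q, drawProb .withReplacement s x q * ((q i : ℝ) * (core s M i j : ℝ) / s)
              = drawProb .withReplacement s x q * (q i : ℝ) * ((core s M i j : ℝ) / s) :=
            fun q => by ring
          rw [Finset.sum_congr rfl fun q _ => this q, ← Finset.sum_mul, h1]
          field_simp
        have hdiff : ∑ q ∈ samples k s, drawProb .withReplacement s x q *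
            ((M q j : ℝ) - (∑ i, (q i : ℝ) * (core s M i j : ℝ)) / s) = 0 := by
          simp only [mul_sub, Finset.sum_sub_distrib]
          rw [hmean, hlin, sub_self]
        have hscale : ∀ q ∈ samples k s, ((Nat.multinomial Finset.univ q : ℝ) *
            ((M q j : ℝ) - (∑ i, (q i : ℝ) * (core s M i j : ℝ)) / s)) * ∏ l, (x l : ℝ) ^ q l
            = (τ : ℝ) ^ s * (drawProb .withReplacement s x q *
            ((M q j : ℝ) - (∑ i, (q i : ℝ) * (core s M i j : ℝ)) / s)) := by
          intro q hq
          rw [drawProb, if_pos hq]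
          rw [hτ]
          field_simp
        rw [Finset.sum_congr rfl hscale, ← Finset.mul_sum, hdiff, mul_zero]
    have h := eq_zero_of_forall_sum_prod_pow_eq_zero key hq
    have hm : (Nat.multinomial Finset.univ q : ℝ) ≠ 0 := by
      exact_mod_cast (Nat.multinomial_pos _ _).ne'
    exact sub_eq_zero.1 ((mul_eq_zero.1 h).resolve_left hm)

end Affine

/-! ### The law of the urn process -/

section UrnProcess

variable {k s b : ℕ} {mode : Sampling} {M : (Fin k → ℕ) → Fin k → ℤ} {x₀ : Fin k → ℕ}
  {Ω : Type*} [MeasurableSpace Ω] {μ : Measure Ω} [IsProbabilityMeasure μ]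
  {Q : ℕ → Ω → Fin k → ℕ}

/-- A finite history, continued by the zero sample. -/
def extendHistory {n : ℕ} (H : Fin n → Fin k → ℕ) (i : ℕ) : Fin k → ℕ :=
  if h : i < n then H ⟨i, h⟩ else 0

lemma composition_congr {h h' : ℕ → Fin k → ℕ} {n : ℕ} (hh : ∀ i < n, h i = h' i) :
    composition M x₀ h n = composition M x₀ h' n := by
  funext j
  simp only [composition]
  congr 1
  exact Finset.sum_congr rfl fun i hi => by rw [hh i (Finset.mem_range.1 hi)]

lemma compositionVector_eq_extendHistory (n : ℕ) (ω : Ω) :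
    compositionVector M x₀ Q n ω
      = composition M x₀ (extendHistory fun i : Fin n => Q i ω) n :=
  composition_congr fun i hi => by simp [extendHistory, hi]

lemma compositionVector_succ (n : ℕ) (ω : Ω) (j : Fin k) :
    compositionVector M x₀ Q (n + 1) ω j = compositionVector M x₀ Q n ω j + M (Q n ω) j := by
  simp only [compositionVector, composition, Finset.sum_range_succ]
  ring

lemma measurable_history (hQ : IsDrawSequence mode s M x₀ μ Q) (n : ℕ) :
    Measurable fun ω => fun i : Fin n => Q i ω :=
  measurable_pi_lambda _ fun i => hQ.measurable i

lemma measurable_compositionVector (hQ : IsDrawSequence mode s M x₀ μ Q) (n : ℕ) :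
    Measurable (compositionVector M x₀ Q n) := by
  have : compositionVector M x₀ Q n
      = (fun H : Fin n → Fin k → ℕ => composition M x₀ (extendHistory H) n)
        ∘ fun ω => fun i : Fin n => Q i ω :=
    funext fun ω => compositionVector_eq_extendHistory n ω
  rw [this]
  exact (measurable_of_countable _).comp (measurable_history hQ n)

/-- The law of the next sample given the composition, in integrated form. -/
lemma setIntegral_draw (hQ : IsDrawSequence mode s M x₀ μ Q) (n : ℕ) (q : Fin k → ℕ)
    (f : (Fin k → ℤ) → ℝ) :
    ∫ ω in {ω | Q n ω = q}, f (compositionVector M x₀ Q n ω) ∂μ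
      = ∫ ω, drawProb mode s (counts (compositionVector M x₀ Q n ω)) q
          * f (compositionVector M x₀ Q n ω) ∂μ := by
  set H : Ω → Fin n → Fin k → ℕ := fun ω => fun i : Fin n => Q i ω with hH
  have hHm : Measurable H := measurable_history hQ n
  set c : (Fin n → Fin k → ℕ) → Fin k → ℤ := fun h => composition M x₀ (extendHistory h) n
  have hc : ∀ ω, compositionVector M x₀ Q n ω = c (H ω) := fun ω =>
    compositionVector_eq_extendHistory n ω
  have hqm : MeasurableSet {ω | Q n ω = q} := hQ.measurable n (measurableSet_singleton q)
  have hmeas : (μ.restrict {ω | Q n ω = q}).map H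
      = (μ.map H).withDensity fun h => ENNReal.ofReal (drawProb mode s (counts (c h)) q) := by
    refine Measure.ext_of_singleton fun h => ?_
    have hcyl : ∀ ω, H ω = h ↔ ∀ i < n, Q i ω = extendHistory h i := by
      intro ω
      constructor
      · rintro rfl i hi
        simp [extendHistory, hi, hH]
      · intro hh
        funext i
        have := hh i i.2
        simpa [extendHistory] using this
    rw [withDensity_apply _ (measurableSet_singleton h), Measure.restrict_singleton,
      lintegral_smul_measure, lintegral_dirac,
      Measure.map_apply hHm (measurableSet_singleton h),
      Measure.map_apply hHm (measurableSet_singleton h),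
      Measure.restrict_apply (hHm (measurableSet_singleton h))]
    have h1 : H ⁻¹' {h} = {ω | ∀ i < n, Q i ω = extendHistory h i} := by
      ext ω; exact hcyl ω
    have h2 : H ⁻¹' {h} ∩ {ω | Q n ω = q}
        = {ω | (∀ i < n, Q i ω = extendHistory h i) ∧ Q n ω = q} := by
      rw [h1]; rfl
    have hl := hQ.law n (extendHistory h) q
    rw [h2, h1, smul_eq_mul, ← ofReal_measureReal, hl,
      ENNReal.ofReal_mul measureReal_nonneg, ofReal_measureReal]
  have hg : AEStronglyMeasurable (fun h => f (c h)) ((μ.restrict {ω | Q n ω = q}).map H) :=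
    (measurable_of_countable _).aestronglyMeasurable
  simp only [hc]
  rw [← integral_map hHm.aemeasurable hg, hmeas,
    integral_withDensity_eq_integral_toReal_smul (measurable_of_countable _)
      (Eventually.of_forall fun _ => ENNReal.ofReal_lt_top),
    integral_map hHm.aemeasurable (measurable_of_countable _).aestronglyMeasurable]
  simp only [ENNReal.toReal_ofReal (drawProb_nonneg _ _ _ _), smul_eq_mul]

/-- Almost surely only samples of positive probability are drawn. -/
lemma ae_drawProb_pos (hQ : IsDrawSequence mode s M x₀ μ Q) :
    ∀ᵐ ω ∂μ, ∀ n, 0 < drawProb mode s (counts (compositionVector M x₀ Q n ω)) (Q n ω) := by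
  refine ae_all_iff.2 fun n => ?_
  have key : ∀ q, ∀ᵐ ω ∂μ, Q n ω = q →
      0 < drawProb mode s (counts (compositionVector M x₀ Q n ω)) q := by
    intro q
    set f : (Fin k → ℤ) → ℝ := fun x => if drawProb mode s (counts x) q = 0 then 1 else 0 with hf
    have h := setIntegral_draw hQ n q f
    have h0 : ∀ ω, drawProb mode s (counts (compositionVector M x₀ Q n ω)) q
        * f (compositionVector M x₀ Q n ω) = 0 := by
      intro ω
      simp only [hf]
      split_ifs with h <;> simp [h]
    simp only [h0, integral_zero] at h
    have hnn : ∀ x, 0 ≤ f x := fun x => by simp only [hf]; split_ifs <;> norm_num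
    have hfm : Measurable fun ω => f (compositionVector M x₀ Q n ω) :=
      (measurable_of_countable f).comp (measurable_compositionVector hQ n)
    have hint : Integrable (fun ω => f (compositionVector M x₀ Q n ω))
        (μ.restrict {ω | Q n ω = q}) := by
      refine Integrable.of_bound hfm.aestronglyMeasurable 1 (Eventually.of_forall fun ω => ?_)
      simp only [hf]
      split_ifs <;> simp
    have h1 := (integral_eq_zero_iff_of_nonneg (fun ω => hnn _) hint).1 h
    have hqm : MeasurableSet {ω | Q n ω = q} := hQ.measurable n (measurableSet_singleton q)
    have h2 := (ae_restrict_iff' hqm).1 h1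
    filter_upwards [h2] with ω hω hq
    have := hω hq
    refine lt_of_le_of_ne (drawProb_nonneg _ _ _ _) fun h3 => ?_
    simp [hf, h3.symm] at this
  filter_upwards [ae_all_iff.2 key] with ω hω
  exact hω _ rfl

/-- Almost surely the samples have size `s`, the composition stays nonnegative, the total is
deterministic, and a sample can always be drawn. -/
lemma ae_urn (hurn : IsUrn mode s b M x₀) (hQ : IsDrawSequence mode s M x₀ μ Q) :
    ∀ᵐ ω ∂μ, ∀ n, Q n ω ∈ samples k s ∧ (∀ j, 0 ≤ compositionVector M x₀ Q n ω j) ∧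
      (minSize mode s : ℤ) ≤ ∑ j, compositionVector M x₀ Q n ω j ∧
      ∑ j, compositionVector M x₀ Q n ω j = ((∑ j, x₀ j : ℕ) : ℤ) + b * n := by
  filter_upwards [ae_drawProb_pos hQ] with ω hω
  have hmem : ∀ n, Q n ω ∈ samples k s := fun n => by
    by_contra hn
    have := hω n
    rw [drawProb_eq_zero hn] at this
    exact lt_irrefl _ this
  intro n
  obtain ⟨h1, h2⟩ := hurn.tenable (fun i => Q i ω) n fun i _ => hω i
  refine ⟨hmem n, h1, h2, ?_⟩
  clear h1 h2
  induction n with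
  | zero => simp [compositionVector, composition]
  | succ n ih =>
    simp only [compositionVector_succ, Finset.sum_add_distrib, ih, hurn.balanced _ (hmem n)]
    push_cast; ring

/-- The initial number of balls. -/
noncomputable def initialTotal (x₀ : Fin k → ℕ) : ℝ := ((∑ j, x₀ j : ℕ) : ℝ)

lemma one_le_initialTotal (hurn : IsUrn mode s b M x₀) : 1 ≤ initialTotal x₀ := by
  obtain ⟨-, h⟩ := hurn.tenable (fun _ => 0) 0 fun i hi => absurd hi (Nat.not_lt_zero i)
  have h1 : 1 ≤ minSize mode s := by
    cases mode
    · exact hurn.one_le_s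
    · exact le_rfl
  have h2 : ((1 : ℕ) : ℤ) ≤ ((∑ j, x₀ j : ℕ) : ℤ) := by
    have e : ∑ j, composition M x₀ (fun _ => 0) 0 j = ((∑ j, x₀ j : ℕ) : ℤ) := by
      simp [composition]
    rw [e] at h
    exact le_trans (by exact_mod_cast h1) h
  simp only [initialTotal]
  exact_mod_cast h2

/-- The composition as a real vector. -/
noncomputable def realComposition (M : (Fin k → ℕ) → Fin k → ℤ) (x₀ : Fin k → ℕ)
    (Q : ℕ → Ω → Fin k → ℕ) (n : ℕ) (ω : Ω) (j : Fin k) : ℝ :=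
  (compositionVector M x₀ Q n ω j : ℝ)

lemma ae_realComposition (hurn : IsUrn mode s b M x₀) (hQ : IsDrawSequence mode s M x₀ μ Q) :
    ∀ᵐ ω ∂μ, ∀ n, (∀ j, 0 ≤ realComposition M x₀ Q n ω j
        ∧ realComposition M x₀ Q n ω j ≤ total (initialTotal x₀) b n) ∧
      ∑ j, realComposition M x₀ Q n ω j = total (initialTotal x₀) b n := by
  filter_upwards [ae_urn hurn hQ] with ω hω n
  obtain ⟨-, h1, -, h3⟩ := hω n
  have hsum : ∑ j, realComposition M x₀ Q n ω j = total (initialTotal x₀) b n := by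
    have := congrArg (Int.cast : ℤ → ℝ) h3
    simp only [realComposition, total, initialTotal]
    push_cast at this ⊢
    exact this
  have h0 : ∀ j, 0 ≤ realComposition M x₀ Q n ω j := fun j => by
    simp only [realComposition]; exact_mod_cast h1 j
  refine ⟨fun j => ⟨h0 j, ?_⟩, hsum⟩
  rw [← hsum]
  exact Finset.single_le_sum (fun i _ => h0 i) (Finset.mem_univ j)

/-- Composition and sample take finitely many values almost surely, so every function of them is
integrable. -/
lemma integrable_comp (hurn : IsUrn mode s b M x₀) (hQ : IsDrawSequence mode s M x₀ μ Q) (n : ℕ)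
    (F : (Fin k → ℤ) → (Fin k → ℕ) → ℝ) :
    Integrable (fun ω => F (compositionVector M x₀ Q n ω) (Q n ω)) μ := by
  have hm : Measurable fun ω => F (compositionVector M x₀ Q n ω) (Q n ω) :=
    (measurable_of_countable (Function.uncurry F)).comp
      ((measurable_compositionVector hQ n).prodMk (hQ.measurable n))
  set N : ℤ := ((∑ j, x₀ j : ℕ) : ℤ) + b * n
  set S : Finset (Fin k → ℤ) := Fintype.piFinset fun _ => Finset.Icc 0 N
  refine Integrable.of_bound hm.aestronglyMeasurable
    (∑ x ∈ S, ∑ q ∈ samples k s, |F x q|) ?_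
  filter_upwards [ae_urn hurn hQ] with ω hω
  obtain ⟨h1, h2, -, h4⟩ := hω n
  have hx : compositionVector M x₀ Q n ω ∈ S := by
    refine Fintype.mem_piFinset.2 fun j => Finset.mem_Icc.2 ⟨h2 j, ?_⟩
    simp only [N]
    rw [← h4]
    exact Finset.single_le_sum (fun i _ => h2 i) (Finset.mem_univ j)
  calc ‖F (compositionVector M x₀ Q n ω) (Q n ω)‖
      ≤ ∑ q ∈ samples k s, |F (compositionVector M x₀ Q n ω) q| :=
        Finset.single_le_sum (f := fun q => |F (compositionVector M x₀ Q n ω) q|)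
          (fun q _ => abs_nonneg _) h1
    _ ≤ _ := Finset.single_le_sum (f := fun x => ∑ q ∈ samples k s, |F x q|)
          (fun x _ => Finset.sum_nonneg fun q _ => abs_nonneg _) hx

/-- Functions of the sample may be replaced by their conditional means. -/
lemma integral_draw_mul (hurn : IsUrn mode s b M x₀) (hQ : IsDrawSequence mode s M x₀ μ Q) (n : ℕ)
    (g : (Fin k → ℕ) → ℝ) (f : (Fin k → ℤ) → ℝ) :
    ∫ ω, g (Q n ω) * f (compositionVector M x₀ Q n ω) ∂μ
      = ∫ ω, (∑ q ∈ samples k s,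
          drawProb mode s (counts (compositionVector M x₀ Q n ω)) q * g q)
            * f (compositionVector M x₀ Q n ω) ∂μ := by
  classical
  have hqm : ∀ q, MeasurableSet {ω | Q n ω = q} := fun q =>
    hQ.measurable n (measurableSet_singleton q)
  have h1 : ∀ᵐ ω ∂μ, g (Q n ω) * f (compositionVector M x₀ Q n ω)
      = ∑ q ∈ samples k s, Set.indicator {ω | Q n ω = q}
          (fun ω => g q * f (compositionVector M x₀ Q n ω)) ω := by
    filter_upwards [ae_urn hurn hQ] with ω hω
    rw [Finset.sum_eq_single_of_mem (Q n ω) (hω n).1]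
    · simp
    · intro q _ hq
      simp [hq.symm]
  have hint : ∀ q, Integrable (fun ω => g q * f (compositionVector M x₀ Q n ω)) μ := fun q =>
    integrable_comp hurn hQ n fun x _ => g q * f x
  rw [integral_congr_ae h1, integral_finsetSum _ fun q _ => (hint q).indicator (hqm q)]
  simp only [Finset.sum_mul]
  rw [integral_finsetSum _ fun q _ => integrable_comp hurn hQ n fun x _ =>
    drawProb mode s (counts x) q * g q * f x]
  refine Finset.sum_congr rfl fun q _ => ?_
  rw [integral_indicator (hqm q), integral_const_mul, setIntegral_draw hQ, ← integral_const_mul]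
  congr 1
  funext ω
  ring

/-! ### Recursions for the moments -/

/-- The mean composition. -/
noncomputable def meanVec (M : (Fin k → ℕ) → Fin k → ℤ) (x₀ : Fin k → ℕ) (μ : Measure Ω)
    (Q : ℕ → Ω → Fin k → ℕ) (n : ℕ) : Fin k → ℝ :=
  fun j => ∫ ω, realComposition M x₀ Q n ω j ∂μ

/-- The matrix of second moments of the composition. -/
noncomputable def secondMoment (M : (Fin k → ℕ) → Fin k → ℤ) (x₀ : Fin k → ℕ) (μ : Measure Ω)
    (Q : ℕ → Ω → Fin k → ℕ) (n : ℕ) : Matrix (Fin k) (Fin k) ℝ :=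
  Matrix.of fun i j => ∫ ω, realComposition M x₀ Q n ω i * realComposition M x₀ Q n ω j ∂μ

/-- The matrix of second moments of the sample. -/
noncomputable def sampleMoment (mode : Sampling) (s b : ℕ) (M : (Fin k → ℕ) → Fin k → ℤ)
    (x₀ : Fin k → ℕ) (μ : Measure Ω) (Q : ℕ → Ω → Fin k → ℕ) (n : ℕ) :
    Matrix (Fin k) (Fin k) ℝ :=
  ((s : ℝ) * (s - 1) / (total (initialTotal x₀) b n
      * (total (initialTotal x₀) b n - depletion mode))) •
    (secondMoment M x₀ μ Q n - depletion mode • diagonal (meanVec M x₀ μ Q n))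
  + ((s : ℝ) / total (initialTotal x₀) b n) • diagonal (meanVec M x₀ μ Q n)

/-- Almost surely the truncation in `counts` is without effect and a sample can be drawn. -/
lemma ae_counts (hurn : IsUrn mode s b M x₀) (hQ : IsDrawSequence mode s M x₀ μ Q) :
    ∀ᵐ ω ∂μ, ∀ n, (∀ j, ((counts (compositionVector M x₀ Q n ω) j : ℕ) : ℝ)
        = realComposition M x₀ Q n ω j) ∧
      ((∑ j, counts (compositionVector M x₀ Q n ω) j : ℕ) : ℝ) = total (initialTotal x₀) b n ∧
      minSize mode s ≤ ∑ j, counts (compositionVector M x₀ Q n ω) j := by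
  filter_upwards [ae_urn hurn hQ, ae_realComposition hurn hQ] with ω h1 h2 n
  obtain ⟨-, hnn, hmin, -⟩ := h1 n
  have hcz : ∀ j, ((counts (compositionVector M x₀ Q n ω) j : ℕ) : ℤ)
      = compositionVector M x₀ Q n ω j := fun j => Int.toNat_of_nonneg (hnn j)
  have hc : ∀ j, ((counts (compositionVector M x₀ Q n ω) j : ℕ) : ℝ)
      = realComposition M x₀ Q n ω j := fun j => by
    simp only [realComposition]
    rw [← hcz j]
    push_cast; rfl
  refine ⟨hc, ?_, ?_⟩
  · push_cast
    rw [Finset.sum_congr rfl fun j _ => hc j, (h2 n).2]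
  · have : (minSize mode s : ℤ) ≤ ((∑ j, counts (compositionVector M x₀ Q n ω) j : ℕ) : ℤ) := by
      push_cast
      rw [Finset.sum_congr rfl fun j _ => hcz j]
      exact hmin
    exact_mod_cast this

lemma integral_sample_mul (hurn : IsUrn mode s b M x₀) (hQ : IsDrawSequence mode s M x₀ μ Q)
    (n : ℕ) (l : Fin k) (f : (Fin k → ℤ) → ℝ) :
    ∫ ω, (Q n ω l : ℝ) * f (compositionVector M x₀ Q n ω) ∂μ
      = (s / total (initialTotal x₀) b n) *
        ∫ ω, realComposition M x₀ Q n ω l * f (compositionVector M x₀ Q n ω) ∂μ := by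
  rw [integral_draw_mul hurn hQ n (fun q => (q l : ℝ)) f, ← integral_const_mul]
  refine integral_congr_ae ?_
  filter_upwards [ae_counts hurn hQ] with ω hω
  obtain ⟨h1, h2, h3⟩ := hω n
  rw [sum_drawProb_mul mode hurn.one_le_s h3 l, h2, h1]
  ring

lemma integral_sample_mul_sample (hurn : IsUrn mode s b M x₀)
    (hQ : IsDrawSequence mode s M x₀ μ Q) (n : ℕ) (l r : Fin k) :
    ∫ ω, (Q n ω l : ℝ) * (Q n ω r : ℝ) ∂μ = sampleMoment mode s b M x₀ μ Q n l r := by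
  have h := integral_draw_mul hurn hQ n (fun q => (q l : ℝ) * q r) (fun _ => 1)
  simp only [mul_one] at h
  rw [h]
  set T := total (initialTotal x₀) b n
  have h1 : ∀ᵐ ω ∂μ, (∑ q ∈ samples k s,
      drawProb mode s (counts (compositionVector M x₀ Q n ω)) q * ((q l : ℝ) * q r))
      = (s : ℝ) * (s - 1) / (T * (T - depletion mode)) *
          (realComposition M x₀ Q n ω l * realComposition M x₀ Q n ω r)
        + (if r = l then s / T - (s : ℝ) * (s - 1) / (T * (T - depletion mode)) * depletion mode
            else 0) * realComposition M x₀ Q n ω l := by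
    filter_upwards [ae_counts hurn hQ] with ω hω
    obtain ⟨h1, h2, h3⟩ := hω n
    rw [sum_drawProb_mul_mul mode hurn.one_le_s h3 l r, h2, h1, h1]
    split_ifs <;> ring
  rw [integral_congr_ae h1, integral_add, integral_const_mul, integral_const_mul]
  · simp only [sampleMoment, secondMoment, meanVec, Matrix.add_apply, Matrix.smul_apply,
      Matrix.sub_apply, Matrix.of_apply, Matrix.diagonal_apply, smul_eq_mul]
    by_cases hlr : l = r
    · subst hlr
      simp only [if_true]
      ring
    · simp only [hlr, Ne.symm hlr, if_false]
      ring
  · exact integrable_comp hurn hQ n fun x _ => (s : ℝ) * (s - 1) / (T * (T - depletion mode)) *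
      ((x l : ℝ) * (x r : ℝ))
  · exact integrable_comp hurn hQ n fun x _ =>
      (if r = l then s / T - (s : ℝ) * (s - 1) / (T * (T - depletion mode)) * depletion mode
            else 0) * (x l : ℝ)

/-- The core as a real matrix. -/
def coreR (A : Matrix (Fin k) (Fin k) ℤ) : Matrix (Fin k) (Fin k) ℝ := A.map fun a => (a : ℝ)

/-- One draw changes the composition linearly in the sample. -/
lemma ae_realComposition_succ (hurn : IsUrn mode s b M x₀) (haff : IsAffine mode s M)
    (hQ : IsDrawSequence mode s M x₀ μ Q) (n : ℕ) :
    ∀ᵐ ω ∂μ, ∀ j, realComposition M x₀ Q (n + 1) ω j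
      = realComposition M x₀ Q n ω j
        + (1 / (s : ℝ)) * ∑ l, coreR (core s M) l j * (Q n ω l : ℝ) := by
  filter_upwards [ae_urn hurn hQ] with ω hω j
  simp only [realComposition, compositionVector_succ]
  push_cast
  rw [replacement_eq hurn.one_le_s haff (hω n).1, one_div, div_eq_inv_mul]
  congr 2
  exact Finset.sum_congr rfl fun l _ => mul_comm _ _

lemma meanVec_succ (hurn : IsUrn mode s b M x₀) (haff : IsAffine mode s M)
    (hQ : IsDrawSequence mode s M x₀ μ Q) (n : ℕ) :
    meanVec M x₀ μ Q (n + 1) = meanVec M x₀ μ Q n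
      + (1 / total (initialTotal x₀) b n) • (meanVec M x₀ μ Q n ᵥ* coreR (core s M)) := by
  funext j
  have hs0 : (s : ℝ) ≠ 0 := by have := hurn.one_le_s; positivity
  have h1 : ∀ l, ∫ ω, (Q n ω l : ℝ) ∂μ
      = (s / total (initialTotal x₀) b n) * meanVec M x₀ μ Q n l := fun l => by
    have := integral_sample_mul hurn hQ n l fun _ => 1
    simpa only [mul_one, meanVec] using this
  have hi : ∀ l, Integrable (fun ω => coreR (core s M) l j * (Q n ω l : ℝ)) μ := fun l =>
    integrable_comp hurn hQ n fun _ q => coreR (core s M) l j * (q l : ℝ)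
  have hX : Integrable (fun ω => realComposition M x₀ Q n ω j) μ :=
    integrable_comp hurn hQ n fun x _ => (x j : ℝ)
  have hae := ae_realComposition_succ hurn haff hQ n
  have e : meanVec M x₀ μ Q (n + 1) j = ∫ ω, (realComposition M x₀ Q n ω j
        + (1 / (s : ℝ)) * ∑ l, coreR (core s M) l j * (Q n ω l : ℝ)) ∂μ :=
    integral_congr_ae (by filter_upwards [hae] with ω hω using hω j)
  rw [e, integral_add hX ((integrable_finsetSum _ fun l _ => hi l).const_mul _),
    integral_const_mul, integral_finsetSum _ fun l _ => hi l]
  simp only [integral_const_mul, h1]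
  simp only [Pi.add_apply, Pi.smul_apply, Matrix.vecMul, dotProduct, smul_eq_mul, Finset.mul_sum,
    meanVec]
  congr 1
  refine Finset.sum_congr rfl fun l _ => ?_
  field_simp

/-- The recursion for the second moments of the composition; the moments of the sample enter through
the linearity of the replacement rule. -/
lemma secondMoment_succ (hurn : IsUrn mode s b M x₀) (haff : IsAffine mode s M)
    (hQ : IsDrawSequence mode s M x₀ μ Q) (n : ℕ) :
    secondMoment M x₀ μ Q (n + 1) = secondMoment M x₀ μ Q n
      + (1 / total (initialTotal x₀) b n) •
        (secondMoment M x₀ μ Q n * coreR (core s M)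
          + (coreR (core s M))ᵀ * secondMoment M x₀ μ Q n)
      + (1 / (s : ℝ) ^ 2) •
        ((coreR (core s M))ᵀ * sampleMoment mode s b M x₀ μ Q n * coreR (core s M)) := by
  ext i j
  set A := coreR (core s M)
  set T := total (initialTotal x₀) b n
  have hs0 : (s : ℝ) ≠ 0 := by have := hurn.one_le_s; positivity
  have hQX : ∀ l r, ∫ ω, (Q n ω l : ℝ) * realComposition M x₀ Q n ω r ∂μ
      = (s / T) * secondMoment M x₀ μ Q n l r := fun l r =>
    integral_sample_mul hurn hQ n l fun x => (x r : ℝ)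
  have hQQ := integral_sample_mul_sample hurn hQ n
  have hae : ∀ᵐ ω ∂μ, realComposition M x₀ Q (n + 1) ω i * realComposition M x₀ Q (n + 1) ω j
      = realComposition M x₀ Q n ω i * realComposition M x₀ Q n ω j
        + ((∑ l, (1 / s * A l j) * ((Q n ω l : ℝ) * realComposition M x₀ Q n ω i))
          + (∑ l, (1 / s * A l i) * ((Q n ω l : ℝ) * realComposition M x₀ Q n ω j)))
        + ∑ l, ∑ r, (1 / (s : ℝ) ^ 2 * (A l i * A r j)) * ((Q n ω l : ℝ) * (Q n ω r : ℝ)) := by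
    filter_upwards [ae_realComposition_succ hurn haff hQ n] with ω hω
    rw [hω i, hω j]
    have e1 : ∀ (c : Fin k) (y : ℝ), ∑ l, (1 / s * A l c) * ((Q n ω l : ℝ) * y)
        = (1 / s * ∑ l, A l c * (Q n ω l : ℝ)) * y := fun c y => by
      rw [Finset.mul_sum, Finset.sum_mul]
      exact Finset.sum_congr rfl fun l _ => by ring
    have e2 : ∑ l, ∑ r, (1 / (s : ℝ) ^ 2 * (A l i * A r j)) * ((Q n ω l : ℝ) * (Q n ω r : ℝ))
        = (1 / s * ∑ l, A l i * (Q n ω l : ℝ)) * (1 / s * ∑ r, A r j * (Q n ω r : ℝ)) := by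
      rw [Finset.mul_sum, Finset.mul_sum, Finset.sum_mul_sum]
      refine Finset.sum_congr rfl fun l _ => Finset.sum_congr rfl fun r _ => ?_
      field_simp
    rw [e1, e1, e2]
    ring
  have hi0 : Integrable (fun ω => realComposition M x₀ Q n ω i * realComposition M x₀ Q n ω j) μ :=
    integrable_comp hurn hQ n fun x _ => (x i : ℝ) * x j
  have hi1 : ∀ (c : ℝ) (l r : Fin k), Integrable (fun ω => c *
      ((Q n ω l : ℝ) * realComposition M x₀ Q n ω r)) μ := fun c l r =>
    integrable_comp hurn hQ n fun x q => c * ((q l : ℝ) * x r)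
  have hi2 : ∀ (c : ℝ) (l r : Fin k), Integrable (fun ω => c *
      ((Q n ω l : ℝ) * (Q n ω r : ℝ))) μ := fun c l r =>
    integrable_comp hurn hQ n fun x q => c * ((q l : ℝ) * q r)
  have hsymm : ∀ l, secondMoment M x₀ μ Q n l i = secondMoment M x₀ μ Q n i l := fun l => by
    simp only [secondMoment, Matrix.of_apply]
    congr 1; funext ω; ring
  have e : secondMoment M x₀ μ Q (n + 1) i j = _ := integral_congr_ae hae
  have I1 : Integrable (fun ω => ∑ l, (1 / s * A l j) *
      ((Q n ω l : ℝ) * realComposition M x₀ Q n ω i)) μ :=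
    integrable_finsetSum _ fun l _ => hi1 _ l i
  have I2 : Integrable (fun ω => ∑ l, (1 / s * A l i) *
      ((Q n ω l : ℝ) * realComposition M x₀ Q n ω j)) μ :=
    integrable_finsetSum _ fun l _ => hi1 _ l j
  have I3 : Integrable (fun ω => ∑ l, ∑ r, (1 / (s : ℝ) ^ 2 * (A l i * A r j)) *
      ((Q n ω l : ℝ) * (Q n ω r : ℝ))) μ :=
    integrable_finsetSum _ fun l _ => integrable_finsetSum _ fun r _ => hi2 _ l r
  have I12 : Integrable (fun ω => (∑ l, (1 / s * A l j) *
      ((Q n ω l : ℝ) * realComposition M x₀ Q n ω i)) + ∑ l, (1 / s * A l i) *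
      ((Q n ω l : ℝ) * realComposition M x₀ Q n ω j)) μ := I1.add I2
  have I0 : Integrable (fun ω => realComposition M x₀ Q n ω i * realComposition M x₀ Q n ω j +
      ((∑ l, (1 / s * A l j) * ((Q n ω l : ℝ) * realComposition M x₀ Q n ω i)) +
        ∑ l, (1 / s * A l i) * ((Q n ω l : ℝ) * realComposition M x₀ Q n ω j))) μ := hi0.add I12
  rw [e, integral_add I0 I3, integral_add hi0 I12, integral_add I1 I2,
    integral_finsetSum _ fun l _ => hi1 _ l i, integral_finsetSum _ fun l _ => hi1 _ l j,
    integral_finsetSum _ fun l _ => integrable_finsetSum _ fun r _ => hi2 _ l r]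
  rw [Finset.sum_congr rfl fun l _ => integral_finsetSum _ fun r _ => hi2 _ l r]
  simp only [integral_const_mul, hQX, hQQ, hsymm]
  simp only [Matrix.add_apply, Matrix.smul_apply, Matrix.mul_apply, Matrix.transpose_apply,
    smul_eq_mul, mul_add, Finset.mul_sum, Finset.sum_mul]
  congr 1
  · congr 1
    congr 1
    · refine Finset.sum_congr rfl fun l _ => ?_
      field_simp
    · refine Finset.sum_congr rfl fun l _ => ?_
      field_simp
  · rw [Finset.sum_comm]
    refine Finset.sum_congr rfl fun l _ => Finset.sum_congr rfl fun r _ => ?_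
    ring

/-- The covariance matrix with real entries. -/
noncomputable def covReal (M : (Fin k → ℕ) → Fin k → ℤ) (x₀ : Fin k → ℕ) (μ : Measure Ω)
    (Q : ℕ → Ω → Fin k → ℕ) (n : ℕ) : Matrix (Fin k) (Fin k) ℝ :=
  secondMoment M x₀ μ Q n - vecMulVec (meanVec M x₀ μ Q n) (meanVec M x₀ μ Q n)

lemma covMatrix_eq (hurn : IsUrn mode s b M x₀) (hQ : IsDrawSequence mode s M x₀ μ Q) (n : ℕ) :
    covMatrix M x₀ μ Q n = (covReal M x₀ μ Q n).map fun r => (r : ℂ) := by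
  ext i j
  have hLp : ∀ i, MemLp (fun ω => (compositionVector M x₀ Q n ω i : ℝ)) 2 μ := by
    intro i
    have hm : Measurable fun ω => (compositionVector M x₀ Q n ω i : ℝ) :=
      (measurable_of_countable fun x : Fin k → ℤ => (x i : ℝ)).comp
        (measurable_compositionVector hQ n)
    refine MemLp.of_bound hm.aestronglyMeasurable (total (initialTotal x₀) b n) ?_
    filter_upwards [ae_realComposition hurn hQ] with ω hω
    have := (hω n).1 i
    simp only [realComposition] at this
    rw [Real.norm_of_nonneg this.1]
    exact this.2
  simp only [covMatrix, covReal, Matrix.of_apply, Matrix.map_apply, Matrix.sub_apply,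
    vecMulVec_apply]
  rw [covariance_eq_sub (hLp i) (hLp j)]
  rfl

/-- The conditional covariance of the next sample, divided by `s²` and averaged. -/
noncomputable def sampleNoise (mode : Sampling) (s b : ℕ) (M : (Fin k → ℕ) → Fin k → ℤ)
    (x₀ : Fin k → ℕ) (μ : Measure Ω) (Q : ℕ → Ω → Fin k → ℕ) (n : ℕ) :
    Matrix (Fin k) (Fin k) ℝ :=
  (1 / (s : ℝ) ^ 2) • sampleMoment mode s b M x₀ μ Q n
    - (1 / total (initialTotal x₀) b n ^ 2) • secondMoment M x₀ μ Q n

/-- The covariance matrix evolves linearly, driven by the averaged conditional covariance of the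
increments. -/
lemma covReal_succ (hurn : IsUrn mode s b M x₀) (haff : IsAffine mode s M)
    (hQ : IsDrawSequence mode s M x₀ μ Q) (n : ℕ) :
    covReal M x₀ μ Q (n + 1)
      = (1 + (1 / total (initialTotal x₀) b n) • coreR (core s M))ᵀ * covReal M x₀ μ Q n
          * (1 + (1 / total (initialTotal x₀) b n) • coreR (core s M))
        + (coreR (core s M))ᵀ * sampleNoise mode s b M x₀ μ Q n * coreR (core s M) := by
  simp only [covReal, sampleNoise]
  rw [secondMoment_succ hurn haff hQ n, meanVec_succ hurn haff hQ n]
  set A := coreR (core s M)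
  set m := meanVec M x₀ μ Q n
  set c := 1 / total (initialTotal x₀) b n
  have hc : 1 / total (initialTotal x₀) b n ^ 2 = c * c := by
    simp only [c]; ring
  have hv : vecMulVec (m + c • (m ᵥ* A)) (m + c • (m ᵥ* A))
      = vecMulVec m m + c • (vecMulVec m m * A) + c • (Aᵀ * vecMulVec m m)
        + (c * c) • (Aᵀ * vecMulVec m m * A) := by
    rw [Matrix.mul_vecMulVec, Matrix.vecMulVec_mul, Matrix.vecMulVec_mul, Matrix.mulVec_transpose]
    simp only [vecMulVec_add, add_vecMulVec, vecMulVec_smul, smul_vecMulVec, smul_add, smul_smul]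
    abel
  rw [hv, hc]
  simp only [Matrix.transpose_add, Matrix.transpose_one, Matrix.transpose_smul, add_mul, mul_add,
    sub_mul, mul_sub, one_mul, mul_one, Matrix.smul_mul, Matrix.mul_smul, smul_smul, smul_add]
  abel

end UrnProcess

/-! ### Asymptotics of the recursion for the covariance matrices -/

section Asymptotics

variable {𝔸 : Type*} [NormedRing 𝔸] [NormedAlgebra ℂ 𝔸] [CompleteSpace 𝔸] [StarRing 𝔸]
  [NormedStarGroup 𝔸] [StarModule ℂ 𝔸] {a p d : 𝔸} {τ b : ℝ} {S F : ℕ → 𝔸}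

/-- The comparison solution is invariant under compression by `p`. -/
lemma star_mul_orbitIntegral_mul (h : Commute p a) (hp : p * p = p) (d : 𝔸) (b t : ℝ) :
    star p * orbitIntegral a (star p * d * p) b t * p = orbitIntegral a (star p * d * p) b t := by
  have horb : ∀ t, star p * orbit a (star p * d * p) b t * p = orbit a (star p * d * p) b t := by
    intro t
    have hs : star p * star p = star p := by rw [← star_mul, hp]
    rw [orbit_conj_eq h, mul_smul_comm, smul_mul_assoc, star_mul]
    congr 1
    have : flow a t * p * p = flow a t * p := by rw [mul_assoc, hp]
    calc star p * (star p * star (flow a t) * d * (flow a t * p)) * p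
        = (star p * star p) * star (flow a t) * d * (flow a t * p * p) := by simp only [mul_assoc]
      _ = _ := by rw [hs, this]
  have hi : IntervalIntegrable (orbit a (star p * d * p) b) volume 0 t :=
    (continuous_orbit _ _ _).intervalIntegrable _ _
  let Φ : 𝔸 →L[ℂ] 𝔸 :=
    ((ContinuousLinearMap.mul ℂ 𝔸).flip p).comp (ContinuousLinearMap.mul ℂ 𝔸 (star p))
  have hΦ : ∀ x, Φ x = star p * x * p := fun x => rfl
  have := Φ.intervalIntegral_comp_comm hi
  rw [orbitIntegral, mul_smul_comm, smul_mul_assoc, ← hΦ, ← this]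
  simp only [hΦ, horb]

/-- The distance of a solution of the recursion to the comparison solution, when the growth of the
flow on the range of `p` is at most `√g`. -/
lemma exists_norm_sub_ansatz_le (hτ : 1 ≤ τ) (hb : 0 < b) {K : ℝ} (hK : 0 ≤ K)
    (hcomm : Commute p a) (hp : p * p = p)
    (hψ : ∀ t, 0 ≤ t → ‖orbit a (star p * d * p) b t‖ ≤ K * Real.exp (b * t / 2))
    {g : ℝ → ℝ} (hg : ∀ t, 0 ≤ t → ‖flow a t * p‖ ^ 2 ≤ g t)
    (hS : ∀ n, S (n + 1) = star (step a τ b n) * S n * step a τ b n + F n)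
    (hpS : ∀ n, star p * S n * p = S n) (hF : Tendsto F atTop (𝓝 (star p * d * p))) :
    ∃ (C : ℝ) (δ : ℕ → ℝ), 0 ≤ C ∧ (∀ n, 0 ≤ δ n) ∧ Tendsto δ atTop (𝓝 0) ∧ ∀ n,
      ‖S n - ansatz a (star p * d * p) b (total τ b n)‖
        ≤ C * g (Real.log (total τ b n / total τ b 0) / b)
          + C * ∑ m ∈ Finset.range n,
            δ m * g (Real.log (total τ b n / total τ b (m + 1)) / b) := by
  set d' := star p * d * p with hd'
  obtain ⟨C, hC0, hC⟩ := exists_norm_star_mul_mul_le a p hτ hb hg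
  set U : ℕ → 𝔸 := fun n => ansatz a d' b (total τ b n)
  set G : ℕ → 𝔸 := fun n => U (n + 1) - star (step a τ b n) * U n * step a τ b n
  have hG : Tendsto G atTop (𝓝 d') := tendsto_ansatz_forcing hτ hb hK hψ
  have hδ : Tendsto (fun n => ‖F n - G n‖) atTop (𝓝 0) := by
    have := (hF.sub hG).norm
    rwa [sub_self, norm_zero] at this
  have hU : ∀ n, star p * U n * p = U n := by
    intro n
    simp only [U, ansatz]
    rw [mul_smul_comm, smul_mul_assoc, star_mul_orbitIntegral_mul hcomm hp]
  have hg0 : ∀ n m, m ≤ n → 0 ≤ g (Real.log (total τ b n / total τ b m) / b) := by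
    intro n m hmn
    refine (sq_nonneg _).trans (hg _ (div_nonneg (Real.log_nonneg ?_) hb.le))
    rw [one_le_div (total_pos hτ hb m)]
    exact total_mono hb hmn
  refine ⟨C * max 1 ‖S 0 - U 0‖, fun n => ‖F n - G n‖, by positivity,
    fun n => norm_nonneg _, hδ, fun n => ?_⟩
  have h := hC (fun n => S n - U n) (fun n => F n - G n) (fun n => ?_) n
  · have e : star p * (S n - U n) * p = S n - U n := by
      rw [mul_sub, sub_mul, hpS, hU]
    rw [e] at h
    refine h.trans ?_
    rw [mul_add]
    refine add_le_add ?_ ?_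
    · rw [mul_assoc]
      refine mul_le_mul_of_nonneg_left ?_ hC0
      exact mul_le_mul_of_nonneg_right (le_max_right _ _) (hg0 n 0 (Nat.zero_le _))
    · refine mul_le_mul_of_nonneg_right (le_mul_of_one_le_right hC0 (le_max_left _ _)) ?_
      exact Finset.sum_nonneg fun m hm => mul_nonneg (norm_nonneg _)
        (hg0 n (m + 1) (Finset.mem_range.1 hm))
  · simp only [hS, G, mul_sub, sub_mul]
    abel

/-- A solution of the recursion with bounded forcing is `o(T²)` when the flow grows no faster than
`e^{3bt/4}`. -/
lemma tendsto_norm_div_sq (hτ : 1 ≤ τ) (hb : 0 < b) {K : ℝ}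
    (hg : ∀ t, 0 ≤ t → ‖flow a t * p‖ ^ 2 ≤ K * Real.exp (3 / 2 * b * t))
    (hS : ∀ n, S (n + 1) = star (step a τ b n) * S n * step a τ b n + F n)
    (hpS : ∀ n, star p * S n * p = S n) {L : ℝ} (hF : ∀ n, ‖F n‖ ≤ L) :
    Tendsto (fun n => ‖S n‖ / total τ b n ^ 2) atTop (𝓝 0) := by
  obtain ⟨C, hC0, hC⟩ := exists_norm_star_mul_mul_le a p hτ hb hg
  have hpos := total_pos (b := b) hτ hb
  have hK0 : 0 ≤ K := by simpa using (sq_nonneg _).trans (hg 0 le_rfl)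
  have hexp : ∀ n m, Real.exp (3 / 2 * b * (Real.log (total τ b n / total τ b m) / b))
      = (total τ b n / total τ b m) ^ (3 / 2 : ℝ) := by
    intro n m
    rw [Real.rpow_def_of_pos (div_pos (hpos n) (hpos m))]
    congr 1
    field_simp
  have h0 : Tendsto (fun n => (total τ b n / total τ b 0) ^ (3 / 2 : ℝ) / total τ b n ^ 2) atTop
      (𝓝 0) := by
    have h := ((tendsto_rpow_neg_atTop (by norm_num : (0 : ℝ) < 1 / 2)).comp
      (tendsto_total (τ := τ) hb)).const_mul ((total τ b 0 ^ (3 / 2 : ℝ))⁻¹)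
    rw [mul_zero] at h
    refine h.congr fun n => ?_
    have hn := hpos n
    simp only [Function.comp_apply]
    rw [Real.div_rpow hn.le (hpos 0).le, ← Real.rpow_natCast (total τ b n) 2,
      show (-(1 / 2) : ℝ) = 3 / 2 - (2 : ℕ) by norm_num, Real.rpow_sub hn]
    field_simp
  have h := ((h0.const_mul (‖S 0‖ * K)).add
    ((tendsto_sum_forcing_apriori hτ hb).const_mul (L * K))).const_mul C
  simp only [mul_zero, add_zero] at h
  refine squeeze_zero (fun n => by positivity) (fun n => ?_) h
  have hn := hC S F hS n
  rw [hpS] at hn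
  rw [div_le_iff₀ (by have := hpos n; positivity)]
  refine hn.trans ((mul_le_mul_of_nonneg_left (add_le_add_right
    (Finset.sum_le_sum fun m hm => mul_le_mul_of_nonneg_right (hF m) ?_) _) hC0).trans_eq ?_)
  · positivity
  · have h2 : total τ b n ≠ 0 := (hpos n).ne'
    simp only [hexp, mul_left_comm _ K, ← Finset.mul_sum]
    field_simp

/-- Below the critical growth rate, `S n` is `T / b` times the orbit integral up to `o(T)`. -/
lemma tendsto_sub_ansatz_subcritical (hτ : 1 ≤ τ) (hb : 0 < b) {K K' : ℝ} (hK : 0 ≤ K)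
    (hcomm : Commute p a) (hp : p * p = p)
    (hψ : ∀ t, 0 ≤ t → ‖orbit a (star p * d * p) b t‖ ≤ K * Real.exp (b * t / 2))
    {σ : ℝ} (hσ0 : 0 ≤ σ) (hσ : σ < 1)
    (hg : ∀ t, 0 ≤ t → ‖flow a t * p‖ ^ 2 ≤ K' * Real.exp (σ * (b * t)))
    (hS : ∀ n, S (n + 1) = star (step a τ b n) * S n * step a τ b n + F n)
    (hpS : ∀ n, star p * S n * p = S n) (hF : Tendsto F atTop (𝓝 (star p * d * p))) :
    Tendsto (fun n => ‖S n - ansatz a (star p * d * p) b (total τ b n)‖ / total τ b n) atTop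
      (𝓝 0) := by
  obtain ⟨C, δ, hC0, -, hδ, hC⟩ := exists_norm_sub_ansatz_le hτ hb hK hcomm hp hψ hg hS hpS hF
  have hpos := total_pos (b := b) hτ hb
  have hexp : ∀ n m, Real.exp (σ * (b * (Real.log (total τ b n / total τ b m) / b)))
      = (total τ b n / total τ b m) ^ σ := by
    intro n m
    rw [Real.rpow_def_of_pos (div_pos (hpos n) (hpos m))]
    congr 1
    field_simp
  have h0 : Tendsto (fun n => (total τ b n / total τ b 0) ^ σ / total τ b n) atTop (𝓝 0) := by
    have h := ((tendsto_rpow_neg_atTop (sub_pos.2 hσ)).comp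
      (tendsto_total (τ := τ) hb)).const_mul ((total τ b 0 ^ σ)⁻¹)
    rw [mul_zero] at h
    refine h.congr fun n => ?_
    have hn := hpos n
    simp only [Function.comp_apply]
    rw [Real.div_rpow hn.le (hpos 0).le, neg_sub, Real.rpow_sub hn, Real.rpow_one]
    field_simp
  have h := (h0.const_mul (C * K')).add
    ((tendsto_sum_forcing_subcritical hτ hb hσ0 hσ hδ).const_mul (C * K'))
  simp only [mul_zero, add_zero] at h
  refine squeeze_zero (fun n => div_nonneg (norm_nonneg _) (hpos n).le) (fun n => ?_) h
  rw [div_le_iff₀ (hpos n)]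
  refine (hC n).trans_eq ?_
  have h2 : total τ b n ≠ 0 := (hpos n).ne'
  simp only [hexp, mul_left_comm _ K', ← Finset.mul_sum]
  field_simp

/-- At the critical growth rate, `S n` is `T / b` times the orbit integral up to
`o(T (log T)^{2ν + 1})`. -/
lemma tendsto_sub_ansatz_critical (hτ : 1 ≤ τ) (hb : 0 < b) {K K' : ℝ} (hK : 0 ≤ K)
    (hcomm : Commute p a) (hp : p * p = p)
    (hψ : ∀ t, 0 ≤ t → ‖orbit a (star p * d * p) b t‖ ≤ K * Real.exp (b * t / 2)) {ν : ℕ}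
    (hg : ∀ t, 0 ≤ t → ‖flow a t * p‖ ^ 2 ≤ K' * (Real.exp (b * t) * (1 + t) ^ (2 * ν)))
    (hS : ∀ n, S (n + 1) = star (step a τ b n) * S n * step a τ b n + F n)
    (hpS : ∀ n, star p * S n * p = S n) (hF : Tendsto F atTop (𝓝 (star p * d * p))) :
    Tendsto (fun n => ‖S n - ansatz a (star p * d * p) b (total τ b n)‖
      / (total τ b n * Real.log (total τ b n) ^ (2 * ν + 1))) atTop (𝓝 0) := by
  obtain ⟨C, δ, hC0, hδ0, hδ, hC⟩ := exists_norm_sub_ansatz_le hτ hb hK hcomm hp hψ hg hS hpS hF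
  have hpos := total_pos (b := b) hτ hb
  have hone := one_le_total (b := b) hτ hb
  have hK0 : 0 ≤ K' := by simpa using (sq_nonneg _).trans (hg 0 le_rfl)
  have hlog := Real.tendsto_log_atTop.comp (tendsto_total (τ := τ) hb)
  have hle : ∀ n m, m ≤ n → K' * (Real.exp (b * (Real.log (total τ b n / total τ b m) / b))
      * (1 + Real.log (total τ b n / total τ b m) / b) ^ (2 * ν))
      ≤ K' * (1 + Real.log (total τ b n) / b) ^ (2 * ν) * (total τ b n / total τ b m) := by
    intro n m hmn
    have hq : 1 ≤ total τ b n / total τ b m := by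
      rw [one_le_div (hpos m)]
      exact total_mono hb hmn
    rw [mul_div_cancel₀ _ hb.ne', Real.exp_log (by positivity), mul_assoc,
      mul_comm (total τ b n / total τ b m)]
    have h1 := Real.log_nonneg hq
    have h2 : Real.log (total τ b n / total τ b m) ≤ Real.log (total τ b n) :=
      Real.log_le_log (by positivity) (div_le_self (hpos n).le (hone m))
    gcongr
  have hr : Tendsto (fun n => ((1 + Real.log (total τ b n) / b) / Real.log (total τ b n))
      ^ (2 * ν)) atTop (𝓝 ((0 + b⁻¹) ^ (2 * ν))) := by
    refine Tendsto.pow ?_ _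
    refine (hlog.inv_tendsto_atTop.add_const b⁻¹).congr' ?_
    filter_upwards [hlog.eventually_gt_atTop 0] with n hn
    have : Real.log (total τ b n) ≠ 0 := ne_of_gt hn
    simp only [Pi.inv_apply, Function.comp_apply]
    field_simp
  have h := ((hr.mul ((hlog.inv_tendsto_atTop.const_mul ((total τ b 0)⁻¹)).add
    (tendsto_sum_forcing_critical hτ hb hδ))).const_mul (C * K'))
  simp only [mul_zero, add_zero] at h
  refine squeeze_zero' (Eventually.of_forall fun n => div_nonneg (norm_nonneg _)
    (mul_nonneg (hpos n).le (pow_nonneg (Real.log_nonneg (hone n)) _))) ?_ h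
  filter_upwards [hlog.eventually_gt_atTop 0] with n hn
  have hn' : 0 < Real.log (total τ b n) := hn
  rw [div_le_iff₀ (mul_pos (hpos n) (pow_pos hn' _))]
  refine (hC n).trans ((add_le_add (mul_le_mul_of_nonneg_left (hle n 0 (Nat.zero_le _)) hC0)
    (mul_le_mul_of_nonneg_left (Finset.sum_le_sum fun m hm => mul_le_mul_of_nonneg_left
      (hle n (m + 1) (Finset.mem_range.1 hm)) (hδ0 m)) hC0)).trans_eq ?_)
  have h2 : total τ b n ≠ 0 := (hpos n).ne'
  simp only [mul_left_comm _ (K' * (1 + Real.log (total τ b n) / b) ^ (2 * ν)), ← Finset.mul_sum,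
    Pi.inv_apply, Function.comp_apply, div_pow]
  field_simp
  ring

end Asymptotics

/-! ### Bounds and limits of the moments -/

section Moments

variable {k s b : ℕ} {mode : Sampling} {M : (Fin k → ℕ) → Fin k → ℤ} {x₀ : Fin k → ℕ}
  {Ω : Type*} [MeasurableSpace Ω] {μ : Measure Ω} [IsProbabilityMeasure μ]
  {Q : ℕ → Ω → Fin k → ℕ}

lemma sum_meanVec (hurn : IsUrn mode s b M x₀) (hQ : IsDrawSequence mode s M x₀ μ Q) (n : ℕ) :
    ∑ j, meanVec M x₀ μ Q n j = total (initialTotal x₀) b n := by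
  simp only [meanVec]
  have hi : ∀ j, Integrable (fun ω => realComposition M x₀ Q n ω j) μ := fun j =>
    integrable_comp hurn hQ n fun x _ => (x j : ℝ)
  rw [← integral_finsetSum _ fun j _ => hi j]
  have h : (fun ω => ∑ j, realComposition M x₀ Q n ω j) =ᵐ[μ]
      fun _ => total (initialTotal x₀) b n := by
    filter_upwards [ae_realComposition hurn hQ] with ω hω using (hω n).2
  rw [integral_congr_ae h]
  simp

lemma sum_secondMoment (hurn : IsUrn mode s b M x₀) (hQ : IsDrawSequence mode s M x₀ μ Q) (n : ℕ)
    (i : Fin k) :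
    ∑ j, secondMoment M x₀ μ Q n i j
      = meanVec M x₀ μ Q n i * total (initialTotal x₀) b n := by
  simp only [secondMoment, meanVec, Matrix.of_apply]
  have hi : ∀ j, Integrable (fun ω => realComposition M x₀ Q n ω i
      * realComposition M x₀ Q n ω j) μ := fun j =>
    integrable_comp hurn hQ n fun x _ => (x i * x j : ℝ)
  rw [← integral_finsetSum _ fun j _ => hi j, ← integral_mul_const]
  refine integral_congr_ae ?_
  filter_upwards [ae_realComposition hurn hQ] with ω hω
  rw [← Finset.mul_sum, (hω n).2]

lemma abs_meanVec_le (hurn : IsUrn mode s b M x₀) (hQ : IsDrawSequence mode s M x₀ μ Q) (n : ℕ)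
    (j : Fin k) : |meanVec M x₀ μ Q n j| ≤ total (initialTotal x₀) b n := by
  have h := norm_integral_le_of_norm_le_const (μ := μ) (C := total (initialTotal x₀) b n)
    (f := fun ω => realComposition M x₀ Q n ω j) (by
      filter_upwards [ae_realComposition hurn hQ] with ω hω
      rw [Real.norm_of_nonneg ((hω n).1 j).1]
      exact ((hω n).1 j).2)
  simpa [meanVec] using h

lemma abs_secondMoment_le (hurn : IsUrn mode s b M x₀) (hQ : IsDrawSequence mode s M x₀ μ Q)
    (n : ℕ) (i j : Fin k) :
    |secondMoment M x₀ μ Q n i j| ≤ total (initialTotal x₀) b n ^ 2 := by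
  have h := norm_integral_le_of_norm_le_const (μ := μ) (C := total (initialTotal x₀) b n ^ 2)
    (f := fun ω => realComposition M x₀ Q n ω i * realComposition M x₀ Q n ω j) (by
      filter_upwards [ae_realComposition hurn hQ] with ω hω
      obtain ⟨h1, h2⟩ := (hω n).1 i
      obtain ⟨h3, h4⟩ := (hω n).1 j
      rw [Real.norm_of_nonneg (mul_nonneg h1 h3), sq]
      exact mul_le_mul h2 h4 h3 (h1.trans h2))
  simpa [secondMoment] using h

lemma secondMoment_transpose (n : ℕ) :
    (secondMoment M x₀ μ Q n)ᵀ = secondMoment M x₀ μ Q n := by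
  ext i j
  simp only [secondMoment, Matrix.transpose_apply, Matrix.of_apply]
  congr 1; funext ω; ring

lemma covReal_transpose (n : ℕ) : (covReal M x₀ μ Q n)ᵀ = covReal M x₀ μ Q n := by
  rw [covReal, Matrix.transpose_sub, secondMoment_transpose, transpose_vecMulVec]

/-- The total number of balls is deterministic. -/
lemma covReal_mulVec_one (hurn : IsUrn mode s b M x₀) (hQ : IsDrawSequence mode s M x₀ μ Q)
    (n : ℕ) : covReal M x₀ μ Q n *ᵥ 1 = 0 := by
  funext i
  simp only [covReal, Matrix.mulVec, dotProduct, Matrix.sub_apply, Pi.one_apply, mul_one,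
    vecMulVec_apply, Pi.zero_apply]
  rw [Finset.sum_sub_distrib, sum_secondMoment hurn hQ, ← Finset.mul_sum, sum_meanVec hurn hQ,
    sub_self]

/-- The noise in terms of the moments of the proportions of the colors. -/
lemma sampleNoise_apply (hurn : IsUrn mode s b M x₀) (n : ℕ) (i j : Fin k) :
    sampleNoise mode s b M x₀ μ Q n i j
      = 1 / (s : ℝ) ^ 2 * ((s * (s - 1)) * (total (initialTotal x₀) b n
            / (total (initialTotal x₀) b n - depletion mode))
          * (secondMoment M x₀ μ Q n i j / total (initialTotal x₀) b n ^ 2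
            - depletion mode / total (initialTotal x₀) b n
              * diagonal (fun l => meanVec M x₀ μ Q n l / total (initialTotal x₀) b n) i j)
          + s * diagonal (fun l => meanVec M x₀ μ Q n l / total (initialTotal x₀) b n) i j)
        - secondMoment M x₀ μ Q n i j / total (initialTotal x₀) b n ^ 2 := by
  have hT : total (initialTotal x₀) (b : ℝ) n ≠ 0 :=
    (total_pos (one_le_initialTotal hurn) (by exact_mod_cast hurn.one_le_b) n).ne'
  have hd : diagonal (fun l => meanVec M x₀ μ Q n l / total (initialTotal x₀) b n) i j
      = diagonal (meanVec M x₀ μ Q n) i j / total (initialTotal x₀) b n := by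
    by_cases h : i = j <;> simp [h]
  rw [hd]
  simp only [sampleNoise, sampleMoment, Matrix.sub_apply, Matrix.smul_apply, Matrix.add_apply,
    smul_eq_mul]
  have e : ((s : ℝ) * (s - 1)) / (total (initialTotal x₀) b n
      * (total (initialTotal x₀) b n - depletion mode))
      = (s * (s - 1)) * (total (initialTotal x₀) b n
            / (total (initialTotal x₀) b n - depletion mode))
          / total (initialTotal x₀) b n ^ 2 := by
    field_simp
  rw [e]
  field_simp

lemma tendsto_total_div_sub (τ : ℝ) {b : ℝ} (hb : 0 < b) (c : ℝ) :
    Tendsto (fun n => total τ b n / (total τ b n - c)) atTop (𝓝 1) := by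
  have hT := tendsto_total (τ := τ) hb
  have h1 : Tendsto (fun n => 1 - c * (total τ b n)⁻¹) atTop (𝓝 1) := by
    simpa using (hT.inv_tendsto_atTop.const_mul c).const_sub 1
  have h2 := h1.inv₀ one_ne_zero
  rw [inv_one] at h2
  refine h2.congr' ?_
  filter_upwards [hT.eventually_gt_atTop 0] with n hn
  rw [show 1 - c * (total τ b n)⁻¹ = (total τ b n - c) / total τ b n by field_simp, inv_div]

lemma exists_abs_sampleNoise_le (hurn : IsUrn mode s b M x₀)
    (hQ : IsDrawSequence mode s M x₀ μ Q) :
    ∃ L, ∀ n i j, |sampleNoise mode s b M x₀ μ Q n i j| ≤ L := by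
  have hb : (0 : ℝ) < b := by exact_mod_cast hurn.one_le_b
  have hτ := one_le_initialTotal hurn
  obtain ⟨K, hK⟩ := (tendsto_total_div_sub (initialTotal x₀) hb (depletion mode)).bddAbove_range
  obtain ⟨K', hK'⟩ := (tendsto_total_div_sub (initialTotal x₀) hb (depletion mode)).bddBelow_range
  set R := max |K| |K'|
  have hR : ∀ n, |total (initialTotal x₀) b n
      / (total (initialTotal x₀) b n - depletion mode)| ≤ R := fun n =>
    abs_le_max_abs_abs (hK' ⟨n, rfl⟩) (hK ⟨n, rfl⟩) |>.trans (by rw [max_comm])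
  refine ⟨1 / (s : ℝ) ^ 2 * (|(s : ℝ) * (s - 1)| * R * (1 + 1) + s) + 1, fun n i j => ?_⟩
  have hT := one_le_total hτ hb n
  have hT0 : 0 < total (initialTotal x₀) b n := by linarith
  have h1 : |secondMoment M x₀ μ Q n i j / total (initialTotal x₀) b n ^ 2| ≤ 1 := by
    rw [abs_div, abs_of_pos (pow_pos hT0 2), div_le_one (pow_pos hT0 2)]
    exact abs_secondMoment_le hurn hQ n i j
  have h2 : |diagonal (fun l => meanVec M x₀ μ Q n l / total (initialTotal x₀) b n) i j| ≤ 1 := by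
    by_cases h : i = j
    · subst h
      rw [diagonal_apply_eq, abs_div, abs_of_pos hT0, div_le_one hT0]
      exact abs_meanVec_le hurn hQ n i
    · rw [diagonal_apply_ne _ h]; simp
  have h3 : |depletion mode / total (initialTotal x₀) b n| ≤ 1 := by
    rw [abs_div, abs_of_pos hT0, div_le_one hT0]
    refine le_trans ?_ hT
    cases mode <;> simp [depletion]
  rw [sampleNoise_apply hurn]
  refine (abs_sub _ _).trans (add_le_add ?_ h1)
  rw [abs_mul, abs_of_nonneg (by positivity : (0 : ℝ) ≤ 1 / (s : ℝ) ^ 2)]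
  refine mul_le_mul_of_nonneg_left ((abs_add_le _ _).trans (add_le_add ?_ ?_)) (by positivity)
  · rw [abs_mul, abs_mul]
    have := hR n
    gcongr
    refine (abs_sub _ _).trans (add_le_add h1 ?_)
    rw [abs_mul]
    exact mul_le_one₀ h3 (abs_nonneg _) h2
  · rw [abs_mul, Nat.abs_cast]
    exact mul_le_of_le_one_right (Nat.cast_nonneg _) h2

/-- Depletion by the drawn balls does not matter in the limit. -/
lemma tendsto_sampleNoise (hurn : IsUrn mode s b M x₀) {v : Fin k → ℝ}
    (hm : ∀ i, Tendsto (fun n => meanVec M x₀ μ Q n i / total (initialTotal x₀) b n) atTop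
      (𝓝 (v i)))
    (hS : ∀ i j, Tendsto (fun n => secondMoment M x₀ μ Q n i j
      / total (initialTotal x₀) b n ^ 2) atTop (𝓝 (v i * v j))) (i j : Fin k) :
    Tendsto (fun n => sampleNoise mode s b M x₀ μ Q n i j) atTop
      (𝓝 (1 / (s : ℝ) ^ 2 * (s * (s - 1) * (v i * v j) + s * diagonal v i j) - v i * v j)) := by
  have hb : (0 : ℝ) < b := by exact_mod_cast hurn.one_le_b
  have hd : Tendsto (fun n => diagonal
      (fun l => meanVec M x₀ μ Q n l / total (initialTotal x₀) b n) i j) atTop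
      (𝓝 (diagonal v i j)) := by
    by_cases h : i = j
    · subst h; simpa using hm i
    · simp [h]
  have hT := tendsto_total (τ := initialTotal x₀) hb
  have h0 : Tendsto (fun n => depletion mode / total (initialTotal x₀) b n) atTop (𝓝 0) :=
    hT.const_div_atTop _
  have h := (((((tendsto_total_div_sub (initialTotal x₀) hb (depletion mode)).const_mul
    ((s : ℝ) * (s - 1))).mul ((hS i j).sub (h0.mul hd))).add (hd.const_mul (s : ℝ))).const_mul
    (1 / (s : ℝ) ^ 2)).sub (hS i j)
  rw [zero_mul, sub_zero, mul_one] at h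
  exact h.congr fun n => (sampleNoise_apply hurn n i j).symm

/-- The mean composition centred at the multiple of `v` with the same number of balls. -/
noncomputable def meanDeviation (b : ℕ) (M : (Fin k → ℕ) → Fin k → ℤ) (x₀ : Fin k → ℕ)
    (μ : Measure Ω) (Q : ℕ → Ω → Fin k → ℕ) (v : Fin k → ℝ) (n : ℕ) : Fin k → ℝ :=
  meanVec M x₀ μ Q n - total (initialTotal x₀) b n • v

/-- The second moments of the composition about the multiple of `v` with the same number of
balls. -/
noncomputable def centredMoment (b : ℕ) (M : (Fin k → ℕ) → Fin k → ℤ) (x₀ : Fin k → ℕ)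
    (μ : Measure Ω) (Q : ℕ → Ω → Fin k → ℕ) (v : Fin k → ℝ) (n : ℕ) :
    Matrix (Fin k) (Fin k) ℝ :=
  covReal M x₀ μ Q n + vecMulVec (meanDeviation b M x₀ μ Q v n) (meanDeviation b M x₀ μ Q v n)

lemma centredMoment_transpose (v : Fin k → ℝ) (n : ℕ) :
    (centredMoment b M x₀ μ Q v n)ᵀ = centredMoment b M x₀ μ Q v n := by
  rw [centredMoment, Matrix.transpose_add, covReal_transpose, transpose_vecMulVec]

lemma centredMoment_mulVec_one (hurn : IsUrn mode s b M x₀)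
    (hQ : IsDrawSequence mode s M x₀ μ Q) {v : Fin k → ℝ} (hv : ∑ i, v i = 1) (n : ℕ) :
    centredMoment b M x₀ μ Q v n *ᵥ 1 = 0 := by
  have h : meanDeviation b M x₀ μ Q v n ⬝ᵥ 1 = 0 := by
    rw [dotProduct_one]
    simp only [meanDeviation, Pi.sub_apply, Pi.smul_apply, smul_eq_mul]
    rw [Finset.sum_sub_distrib, ← Finset.mul_sum, sum_meanVec hurn hQ, hv, mul_one, sub_self]
  rw [centredMoment, Matrix.add_mulVec, covReal_mulVec_one hurn hQ, zero_add,
    Matrix.vecMulVec_mulVec, h]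
  simp

/-- The centring vector `T_n v` is a solution of the recursion for the mean, so the centred moments
satisfy the recursion of the covariance matrices. -/
lemma centredMoment_succ (hurn : IsUrn mode s b M x₀) (haff : IsAffine mode s M)
    (hQ : IsDrawSequence mode s M x₀ μ Q) {v : Fin k → ℝ}
    (hv : v ᵥ* coreR (core s M) = (b : ℝ) • v) (n : ℕ) :
    centredMoment b M x₀ μ Q v (n + 1)
      = (1 + (1 / total (initialTotal x₀) b n) • coreR (core s M))ᵀ
          * centredMoment b M x₀ μ Q v n
          * (1 + (1 / total (initialTotal x₀) b n) • coreR (core s M))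
        + (coreR (core s M))ᵀ * sampleNoise mode s b M x₀ μ Q n * coreR (core s M) := by
  have hb : (0 : ℝ) < b := by exact_mod_cast hurn.one_le_b
  have hT := (total_pos (one_le_initialTotal hurn) hb n).ne'
  set G := 1 + (1 / total (initialTotal x₀) b n) • coreR (core s M) with hG
  have hy : meanDeviation b M x₀ μ Q v (n + 1) = meanDeviation b M x₀ μ Q v n ᵥ* G := by
    simp only [meanDeviation]
    rw [meanVec_succ hurn haff hQ n, total_succ, Matrix.sub_vecMul, hG, Matrix.vecMul_add,
      Matrix.vecMul_one, Matrix.vecMul_smul, Matrix.smul_vecMul, Matrix.vecMul_add,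
      Matrix.vecMul_one, Matrix.vecMul_smul, hv, smul_add, smul_smul, smul_smul, add_smul]
    congr 3
    field_simp
  have hcov := covReal_succ hurn haff hQ n
  rw [← hG] at hcov
  clear_value G
  rw [centredMoment, hcov, hy, centredMoment, mul_add, add_mul,
    Matrix.mul_vecMulVec, Matrix.vecMulVec_mul, Matrix.mulVec_transpose]
  abel

/-- If the second moments about the direction `v` are `o(T²)`, then composition and second moments
have the limits of a deterministic composition in the direction `v`. -/
lemma tendsto_moments_of_centredMoment (hurn : IsUrn mode s b M x₀)
    (hQ : IsDrawSequence mode s M x₀ μ Q) {v : Fin k → ℝ}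
    (h : ∀ i j, Tendsto (fun n => centredMoment b M x₀ μ Q v n i j
      / total (initialTotal x₀) b n ^ 2) atTop (𝓝 0)) :
    (∀ i, Tendsto (fun n => meanVec M x₀ μ Q n i / total (initialTotal x₀) b n) atTop
      (𝓝 (v i))) ∧
    ∀ i j, Tendsto (fun n => secondMoment M x₀ μ Q n i j
      / total (initialTotal x₀) b n ^ 2) atTop (𝓝 (v i * v j)) := by
  have hb : (0 : ℝ) < b := by exact_mod_cast hurn.one_le_b
  have hpos := total_pos (one_le_initialTotal hurn) hb
  have hvar : ∀ n i, 0 ≤ covReal M x₀ μ Q n i i := by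
    intro n i
    have h1 := congrFun (congrFun (covMatrix_eq hurn hQ n) i) i
    simp only [covMatrix, Matrix.of_apply, Matrix.map_apply] at h1
    have hm : Measurable fun ω => (compositionVector M x₀ Q n ω i : ℝ) :=
      (measurable_of_countable fun x : Fin k → ℤ => (x i : ℝ)).comp
        (measurable_compositionVector hQ n)
    rw [← Complex.ofReal_injective h1, covariance_self hm.aemeasurable]
    exact variance_nonneg _ _
  have hm : ∀ i, Tendsto (fun n => meanVec M x₀ μ Q n i / total (initialTotal x₀) b n) atTop
      (𝓝 (v i)) := by
    intro i
    have h1 : Tendsto (fun n => (meanDeviation b M x₀ μ Q v n i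
        / total (initialTotal x₀) b n) ^ 2) atTop (𝓝 0) := by
      refine squeeze_zero (fun n => sq_nonneg _) (fun n => ?_) (h i i)
      have := hvar n i
      rw [div_pow]
      refine div_le_div_of_nonneg_right ?_ (sq_nonneg _)
      simp only [centredMoment, Matrix.add_apply, vecMulVec_apply]
      nlinarith
    have h2 : Tendsto (fun n => meanDeviation b M x₀ μ Q v n i
        / total (initialTotal x₀) b n) atTop (𝓝 0) := by
      have := (Real.continuous_sqrt.tendsto 0).comp h1
      rw [Real.sqrt_zero] at this
      refine tendsto_zero_iff_abs_tendsto_zero _ |>.2 (this.congr fun n => ?_)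
      simp [Real.sqrt_sq_eq_abs]
    have h3 := h2.add_const (v i)
    rw [zero_add] at h3
    refine h3.congr fun n => ?_
    have := (hpos n).ne'
    simp only [meanDeviation, Pi.sub_apply, Pi.smul_apply, smul_eq_mul]
    field_simp
    ring
  refine ⟨hm, fun i j => ?_⟩
  have h4 := (((h i j).add ((hm j).const_mul (v i))).add ((hm i).mul_const (v j))).sub_const
    (v i * v j)
  rw [zero_add, add_sub_cancel_right] at h4
  refine h4.congr fun n => ?_
  have := (hpos n).ne'
  simp only [centredMoment, covReal, meanDeviation, Matrix.add_apply, Matrix.sub_apply,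
    vecMulVec_apply, Pi.sub_apply, Pi.smul_apply, smul_eq_mul]
  field_simp
  ring

end Moments

/-! ### The recursion over the complex numbers -/

section Complexification

open scoped Matrix.Norms.L2Operator

variable {k : ℕ} {A : Matrix (Fin k) (Fin k) ℤ} {τ b : ℝ}

lemma coreC_eq_map_coreR (A : Matrix (Fin k) (Fin k) ℤ) :
    coreC A = (coreR A).map Complex.ofRealHom := by
  ext i j; simp [coreC, coreR]

lemma star_map_ofReal (R : Matrix (Fin k) (Fin k) ℝ) :
    star (R.map Complex.ofRealHom) = Rᵀ.map Complex.ofRealHom := by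
  ext i j; simp [Matrix.star_apply]

/-- The recursion of real matrices over the complex numbers, in terms of the Euler factors of the
core. -/
lemma map_recursion {R N : ℕ → Matrix (Fin k) (Fin k) ℝ}
    (h : ∀ n, R (n + 1) = (1 + (1 / total τ b n) • coreR A)ᵀ * R n
      * (1 + (1 / total τ b n) • coreR A) + (coreR A)ᵀ * N n * coreR A) (n : ℕ) :
    (R (n + 1)).map Complex.ofRealHom
      = star (step (coreC A) τ b n) * (R n).map Complex.ofRealHom * step (coreC A) τ b n
        + star (coreC A) * (N n).map Complex.ofRealHom * coreC A := by
  have hs : step (coreC A) τ b n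
      = (1 + (1 / total τ b n) • coreR A).map Complex.ofRealHom := by
    ext i j
    by_cases hij : i = j <;> simp [step, coreC, coreR, hij]
  rw [hs, coreC_eq_map_coreR, star_map_ofReal, star_map_ofReal, ← Matrix.map_mul,
    ← Matrix.map_mul, ← Matrix.map_mul, ← Matrix.map_mul, h n]
  exact Matrix.map_add _ (map_add Complex.ofRealHom) _ _

/-- Entrywise bounds control the operator norm. -/
lemma norm_le_of_forall_norm_le (k : ℕ) :
    ∃ C : ℝ, 0 ≤ C ∧ ∀ (N : Matrix (Fin k) (Fin k) ℂ) (L : ℝ), (∀ i j, ‖N i j‖ ≤ L) →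
      ‖N‖ ≤ C * L := by
  refine ⟨∑ i : Fin k, ∑ j : Fin k, ‖(Matrix.single i j (1 : ℂ) : Matrix (Fin k) (Fin k) ℂ)‖,
    by positivity, fun N L hN => ?_⟩
  conv_lhs => rw [Matrix.matrix_eq_sum_single N]
  rw [Finset.sum_mul]
  refine (norm_sum_le _ _).trans (Finset.sum_le_sum fun i _ => ?_)
  rw [Finset.sum_mul]
  refine (norm_sum_le _ _).trans (Finset.sum_le_sum fun j _ => ?_)
  have e : (Matrix.single i j (N i j) : Matrix (Fin k) (Fin k) ℂ)
      = N i j • Matrix.single i j (1 : ℂ) := by simp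
  rw [e, norm_smul, mul_comm]
  exact mul_le_mul_of_nonneg_left (hN i j) (norm_nonneg _)

variable {b : ℕ}

/-- Symmetric matrices that kill the vector of ones live on the range of `P̂`. -/
lemma star_projHat_mul_mul (hb : 1 ≤ b) (hrow : ∀ i, ∑ j, A i j = b)
    (hΛ : coreIndex b A ≤ 1 / 2) (hk : 0 < k) {R : Matrix (Fin k) (Fin k) ℝ} (hR : Rᵀ = R)
    (hR1 : R *ᵥ 1 = 0) :
    star (projHat b A) * R.map Complex.ofRealHom * projHat b A = R.map Complex.ofRealHom := by
  have h1 : R.map Complex.ofRealHom * specProj (coreC A) (b : ℂ) = 0 := by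
    rw [specProj_principal hb hrow hΛ hk, Matrix.mul_vecMulVec]
    have : R.map Complex.ofRealHom *ᵥ (1 : Fin k → ℂ) = 0 := by
      funext i
      have := congrArg Complex.ofRealHom (congrFun hR1 i)
      simpa [Matrix.mulVec, dotProduct] using this
    rw [this]
    ext i j; simp [vecMulVec_apply]
  have h2 : star (specProj (coreC A) (b : ℂ)) * R.map Complex.ofRealHom = 0 := by
    have := congrArg star h1
    rwa [star_mul, star_map_ofReal, hR, star_zero] at this
  rw [projHat, star_sub, star_one, mul_sub, sub_mul, h2, sub_zero, one_mul, mul_one, h1, sub_zero]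

lemma projHat_mul_self (b : ℕ) (A : Matrix (Fin k) (Fin k) ℤ) :
    projHat b A * projHat b A = projHat b A := by
  rw [projHat, mul_sub, mul_one, sub_mul, one_mul, specProj_mul_self, sub_self, sub_zero]

/-- Off the principal eigenspace the flow grows no faster than any exponential of rate above `Re
λ₂`. -/
lemma exists_norm_flow_projHat_le (hrow : ∀ i, ∑ j, A i j = b) (hk : 0 < k) {κ : ℝ}
    (hκ : secondRe b A < κ) :
    ∃ C, 0 ≤ C ∧ ∀ t, 0 ≤ t → ‖flow (coreC A) t * projHat b A‖ ^ 2
      ≤ C * Real.exp (2 * κ * t) := by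
  have hlt : ∀ z ∈ minorEigenvalues b A, z.re < κ := fun z hz =>
    (re_le_secondRe (mem_otherEigenvalues_of_mem hz)).trans_lt hκ
  obtain ⟨C, hC0, hC⟩ := exists_norm_flow_mul_le (a := coreC A) (N := k) (ν := 0)
    (projHat_eq_sum hrow hk)
    (fun z _ j hj => by
      rw [← Nat.sub_add_cancel hj.le, pow_add, mul_assoc, sub_pow_finrank_mul_specProj, mul_zero])
    (fun z hz => (hlt z hz).le) (fun z hz h => absurd h (hlt z hz).ne)
  refine ⟨C ^ 2, sq_nonneg _, fun t ht => ?_⟩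
  refine (pow_le_pow_left₀ (norm_nonneg _) (hC t ht) 2).trans_eq ?_
  rw [pow_zero, mul_one, mul_pow, ← Real.exp_nat_mul]
  congr 2
  push_cast; ring

/-- At the critical index the growth rate is `b/2`, up to a polynomial factor of degree `ν₂`. -/
lemma exists_norm_flow_projHat_le_critical (hrow : ∀ i, ∑ j, A i j = b)
    (hk : 0 < k) (hκ : secondRe b A = b / 2) :
    ∃ C, 0 ≤ C ∧ ∀ t, 0 ≤ t → ‖flow (coreC A) t * projHat b A‖ ^ 2
      ≤ C * (Real.exp (b * t) * (1 + t) ^ (2 * nuTwo b A)) := by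
  obtain ⟨C, hC0, hC⟩ := exists_norm_flow_mul_le (a := coreC A) (N := k) (ν := nuTwo b A)
    (κ := b / 2) (projHat_eq_sum hrow hk)
    (fun z _ j hj => by
      rw [← Nat.sub_add_cancel hj.le, pow_add, mul_assoc, sub_pow_finrank_mul_specProj, mul_zero])
    (fun z hz => hκ ▸ re_le_secondRe (mem_otherEigenvalues_of_mem hz))
    (fun z hz h j hj => sub_pow_mul_specProj_eq_zero _
      ((nilIndex_le_nuTwo hz (h.trans hκ.symm)).trans_lt hj))
  refine ⟨C ^ 2, sq_nonneg _, fun t ht => ?_⟩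
  refine (pow_le_pow_left₀ (norm_nonneg _) (hC t ht) 2).trans_eq ?_
  rw [mul_pow, mul_pow, ← Real.exp_nat_mul, ← pow_mul, mul_comm (nuTwo b A) 2]
  congr 3
  push_cast; ring

/-- Any bound of the growth rate below `3b/4` keeps the rescaled orbit below `e^{bt/2}`. -/
lemma exists_norm_orbit_projHat_le (hb : 1 ≤ b) (hrow : ∀ i, ∑ j, A i j = b)
    (hΛ : coreIndex b A ≤ 1 / 2) (hk : 0 < k) (d : Matrix (Fin k) (Fin k) ℂ) :
    ∃ K, 0 ≤ K ∧ ∀ t, 0 ≤ t →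
      ‖orbit (coreC A) (star (projHat b A) * d * projHat b A) b t‖
        ≤ K * Real.exp (b * t / 2) := by
  have hb' : (0 : ℝ) < b := by exact_mod_cast hb
  have h := secondRe_le hb hΛ
  obtain ⟨C, hC0, hC⟩ := exists_norm_flow_projHat_le (κ := 3 / 4 * b) hrow hk (by linarith)
  refine ⟨‖d‖ * C, by positivity, fun t ht => ?_⟩
  refine (norm_orbit_conj_le commute_projHat d (hC t ht)).trans_eq ?_
  rw [show (b : ℝ) * t / 2 = -(b * t) + 2 * (3 / 4 * b) * t by ring, Real.exp_add]
  ring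

/-- The limit of the forcing term and `B` have the same compression by `P̂`, because they differ by
a multiple of `v₁ᵀ v₁`. -/
lemma star_mul_matB_mul {s : ℕ} (hb : 1 ≤ b) (hrow : ∀ i, ∑ j, A i j = b)
    (hΛ : coreIndex b A ≤ 1 / 2) (hk : 0 < k) :
    star (projHat b A) * (star (coreC A) * (((1 / (s : ℝ) ^ 2) • matQ s b A
      - vecMulVec (principalVec b A) (principalVec b A)).map Complex.ofRealHom) * coreC A)
        * projHat b A
      = star (projHat b A) * matB s b A * projHat b A := by
  obtain ⟨hv, hv1⟩ := principalVec_spec hb hrow hΛ hk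
  set v := principalVec b A
  set w : Fin k → ℂ := fun i => (v i : ℂ) with hw
  have hwA : w ᵥ* coreC A = (b : ℂ) • w := by
    have := ofReal_vecMul_coreC hv
    simpa using this
  -- `v₁ P̂ = 0`
  have hwp : w ᵥ* projHat b A = 0 := by
    have h1 : w ⬝ᵥ 1 = 1 := by
      rw [dotProduct_one, hw, ← Complex.ofReal_sum, hv1, Complex.ofReal_one]
    rw [projHat, Matrix.vecMul_sub, Matrix.vecMul_one, specProj_principal hb hrow hΛ hk,
      Matrix.vecMul_vecMulVec, h1]
    simp [w, v]
  have hmap : ((1 / (s : ℝ) ^ 2) • matQ s b A - vecMulVec v v).map Complex.ofRealHom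
      = (1 / (s : ℂ) ^ 2) • (matQ s b A).map (fun r => (r : ℂ)) - vecMulVec w w := by
    ext i j; simp [vecMulVec_apply, w]
  have hz : star (coreC A) * vecMulVec w w * coreC A * projHat b A = 0 := by
    rw [mul_assoc, mul_assoc, ← mul_assoc (vecMulVec w w), Matrix.vecMulVec_mul, hwA,
      Matrix.vecMulVec_mul, Matrix.smul_vecMul, hwp, smul_zero]
    simp
  have hst : star (coreC A) = (coreC A)ᵀ := conjTranspose_coreC
  rw [hmap, mul_sub, sub_mul, mul_sub, sub_mul, mul_assoc (star (projHat b A)) _ (projHat b A),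
    mul_assoc (star (projHat b A)) (star (coreC A) * vecMulVec w w * coreC A), hz, mul_zero,
    sub_zero, matB, hst]
  simp only [Matrix.mul_smul, Matrix.smul_mul, mul_assoc]

end Complexification

/-! ### The recursion for the covariance matrices -/

section Covariance

open scoped Matrix.Norms.L2Operator

variable {k s b : ℕ} {mode : Sampling} {M : (Fin k → ℕ) → Fin k → ℤ} {x₀ : Fin k → ℕ}
  {Ω : Type*} [MeasurableSpace Ω] {μ : Measure Ω} [IsProbabilityMeasure μ]
  {Q : ℕ → Ω → Fin k → ℕ}

lemma IsUrn.pos (hurn : IsUrn mode s b M x₀) : 0 < k := by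
  rcases Nat.eq_zero_or_pos k with rfl | h
  · have := one_le_initialTotal hurn
    simp [initialTotal] at this
    linarith
  · exact h

lemma IsUrn.sum_core (hurn : IsUrn mode s b M x₀) (i : Fin k) : ∑ j, core s M i j = b :=
  hurn.balanced _ (single_mem_samples i)

lemma IsUrn.principalVec_vecMul (hurn : IsUrn mode s b M x₀)
    (hΛ : coreIndex b (core s M) ≤ 1 / 2) :
    principalVec b (core s M) ᵥ* coreR (core s M) = (b : ℝ) • principalVec b (core s M) ∧
      ∑ i, principalVec b (core s M) i = 1 :=
  principalVec_spec hurn.one_le_b hurn.sum_core hΛ hurn.pos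

/-- The averaged covariance of the increments, as a complex matrix. -/
noncomputable def forcing (mode : Sampling) (s b : ℕ) (M : (Fin k → ℕ) → Fin k → ℤ)
    (x₀ : Fin k → ℕ) (μ : Measure Ω) (Q : ℕ → Ω → Fin k → ℕ) (n : ℕ) :
    Matrix (Fin k) (Fin k) ℂ :=
  star (coreC (core s M)) * (sampleNoise mode s b M x₀ μ Q n).map Complex.ofRealHom
    * coreC (core s M)

lemma exists_norm_forcing_le (hurn : IsUrn mode s b M x₀)
    (hQ : IsDrawSequence mode s M x₀ μ Q) :
    ∃ L, ∀ n, ‖forcing mode s b M x₀ μ Q n‖ ≤ L := by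
  obtain ⟨L, hL⟩ := exists_abs_sampleNoise_le hurn hQ
  obtain ⟨C, hC0, hC⟩ := norm_le_of_forall_norm_le k
  refine ⟨‖star (coreC (core s M))‖ * (C * L) * ‖coreC (core s M)‖, fun n => ?_⟩
  refine (norm_mul_le _ _).trans (mul_le_mul_of_nonneg_right ((norm_mul_le _ _).trans
    (mul_le_mul_of_nonneg_left (hC _ L fun i j => ?_) (norm_nonneg _))) (norm_nonneg _))
  rw [Matrix.map_apply, Complex.ofRealHom_eq_coe, Complex.norm_real]
  exact hL n i j

/-- The law of large numbers in mean square. -/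
lemma tendsto_moments (hurn : IsUrn mode s b M x₀) (haff : IsAffine mode s M)
    (hQ : IsDrawSequence mode s M x₀ μ Q) (hΛ : coreIndex b (core s M) ≤ 1 / 2) :
    (∀ i, Tendsto (fun n => meanVec M x₀ μ Q n i / total (initialTotal x₀) b n) atTop
      (𝓝 (principalVec b (core s M) i))) ∧
    ∀ i j, Tendsto (fun n => secondMoment M x₀ μ Q n i j / total (initialTotal x₀) b n ^ 2) atTop
      (𝓝 (principalVec b (core s M) i * principalVec b (core s M) j)) := by
  have hb : (0 : ℝ) < b := by exact_mod_cast hurn.one_le_b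
  have hτ := one_le_initialTotal hurn
  obtain ⟨hv, hv1⟩ := hurn.principalVec_vecMul hΛ
  set v := principalVec b (core s M)
  obtain ⟨C, -, hC⟩ := exists_norm_flow_projHat_le (κ := 3 / 4 * b) hurn.sum_core hurn.pos
    (by linarith [secondRe_le hurn.one_le_b hΛ])
  obtain ⟨L, hL⟩ := exists_norm_forcing_le hurn hQ
  refine tendsto_moments_of_centredMoment hurn hQ fun i j => ?_
  have h := tendsto_norm_div_sq (a := coreC (core s M)) (p := projHat b (core s M))
    (S := fun n => (centredMoment b M x₀ μ Q v n).map Complex.ofRealHom)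
    (F := forcing mode s b M x₀ μ Q) hτ hb
    (fun t ht => (hC t ht).trans_eq (by congr 2; ring))
    (fun n => map_recursion (centredMoment_succ hurn haff hQ hv) n)
    (fun n => star_projHat_mul_mul hurn.one_le_b hurn.sum_core hΛ hurn.pos
      (centredMoment_transpose v n) (centredMoment_mulVec_one hurn hQ hv1 n)) hL
  have h1 : Tendsto (fun n => ((total (initialTotal x₀) b n ^ 2 : ℝ) : ℂ)⁻¹ •
      (centredMoment b M x₀ μ Q v n).map Complex.ofRealHom) atTop (𝓝 0) := by
    refine tendsto_zero_iff_norm_tendsto_zero.2 (h.congr fun n => ?_)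
    rw [norm_smul, norm_inv, Complex.norm_real, Real.norm_of_nonneg (sq_nonneg _), div_eq_inv_mul]
  have h2 : Tendsto (fun n => (((total (initialTotal x₀) b n ^ 2 : ℝ) : ℂ)⁻¹ •
      (centredMoment b M x₀ μ Q v n).map Complex.ofRealHom) i j) atTop (𝓝 0) :=
    ((continuous_id.matrix_elem i j).tendsto (0 : Matrix (Fin k) (Fin k) ℂ)).comp h1
  have h3 := (Complex.continuous_re.tendsto 0).comp h2
  rw [Complex.zero_re] at h3
  refine h3.congr fun n => ?_
  simp only [Function.comp_apply, Matrix.smul_apply, Matrix.map_apply, Complex.ofRealHom_eq_coe,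
    smul_eq_mul, ← Complex.ofReal_inv, ← Complex.ofReal_mul, Complex.ofReal_re]
  rw [div_eq_inv_mul]

lemma tendsto_forcing (hurn : IsUrn mode s b M x₀) (haff : IsAffine mode s M)
    (hQ : IsDrawSequence mode s M x₀ μ Q) (hΛ : coreIndex b (core s M) ≤ 1 / 2) :
    Tendsto (forcing mode s b M x₀ μ Q) atTop
      (𝓝 (star (coreC (core s M)) * (((1 / (s : ℝ) ^ 2) • matQ s b (core s M)
      - vecMulVec (principalVec b (core s M)) (principalVec b (core s M))).map Complex.ofRealHom)
        * coreC (core s M))) := by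
  obtain ⟨hm, hS⟩ := tendsto_moments hurn haff hQ hΛ
  have hN : Tendsto (fun n => (sampleNoise mode s b M x₀ μ Q n).map Complex.ofRealHom) atTop
      (𝓝 (((1 / (s : ℝ) ^ 2) • matQ s b (core s M) - vecMulVec (principalVec b (core s M))
        (principalVec b (core s M))).map Complex.ofRealHom)) := by
    refine tendsto_pi_nhds.2 fun i => tendsto_pi_nhds.2 fun j => ?_
    exact (Complex.continuous_ofReal.tendsto _).comp (tendsto_sampleNoise hurn hm hS i j)
  exact (tendsto_const_nhds.mul hN).mul tendsto_const_nhds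

lemma star_mul_covMatrix_mul (hurn : IsUrn mode s b M x₀) (hQ : IsDrawSequence mode s M x₀ μ Q)
    (hΛ : coreIndex b (core s M) ≤ 1 / 2) (n : ℕ) :
    star (projHat b (core s M)) * covMatrix M x₀ μ Q n * projHat b (core s M)
      = covMatrix M x₀ μ Q n := by
  rw [covMatrix_eq hurn hQ]
  exact star_projHat_mul_mul hurn.one_le_b hurn.sum_core hΛ hurn.pos (covReal_transpose n)
    (covReal_mulVec_one hurn hQ n)

/-- The recursion for the covariance matrices, compressed by `P̂`; the limit of the forcing term is
the compression of `B`. -/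
lemma exists_recursion (hurn : IsUrn mode s b M x₀) (haff : IsAffine mode s M)
    (hQ : IsDrawSequence mode s M x₀ μ Q) (hΛ : coreIndex b (core s M) ≤ 1 / 2) :
    ∃ F : ℕ → Matrix (Fin k) (Fin k) ℂ,
      (∀ n, covMatrix M x₀ μ Q (n + 1)
        = star (step (coreC (core s M)) (initialTotal x₀) b n) * covMatrix M x₀ μ Q n
          * step (coreC (core s M)) (initialTotal x₀) b n + F n) ∧
      Tendsto F atTop (𝓝 (star (projHat b (core s M)) * matB s b (core s M)
        * projHat b (core s M))) := by
  have hrec : ∀ n, covMatrix M x₀ μ Q (n + 1)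
      = star (step (coreC (core s M)) (initialTotal x₀) b n) * covMatrix M x₀ μ Q n
        * step (coreC (core s M)) (initialTotal x₀) b n + forcing mode s b M x₀ μ Q n := by
    intro n
    rw [covMatrix_eq hurn hQ, covMatrix_eq hurn hQ]
    exact map_recursion (covReal_succ hurn haff hQ) n
  have hp := star_mul_covMatrix_mul hurn hQ hΛ
  set p := projHat b (core s M)
  refine ⟨fun n => star p * forcing mode s b M x₀ μ Q n * p, fun n => ?_, ?_⟩
  · set u := step (coreC (core s M)) (initialTotal x₀) b n with hu
    have hc : u * p = p * u := by
      rw [hu, step, add_mul, mul_add, one_mul, mul_one, smul_mul_assoc, mul_smul_comm,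
        (commute_projHat (b := b) (A := core s M)).eq]
    have hc' : star p * star u = star u * star p := by rw [← star_mul, hc, star_mul]
    rw [← hp (n + 1), hrec n, mul_add, add_mul]
    congr 1
    calc star p * (star u * covMatrix M x₀ μ Q n * u) * p
        = (star p * star u) * covMatrix M x₀ μ Q n * (u * p) := by simp only [mul_assoc]
      _ = star u * (star p * covMatrix M x₀ μ Q n * p) * u := by
        rw [hc, hc']; simp only [mul_assoc]
      _ = _ := by rw [hp n]
  · rw [← star_mul_matB_mul hurn.one_le_b hurn.sum_core hΛ hurn.pos]
    exact (tendsto_const_nhds.mul (tendsto_forcing hurn haff hQ hΛ)).mul tendsto_const_nhds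

end Covariance

/-! ### The limits -/

section Limits

open scoped Matrix.Norms.L2Operator

/-- Passing from the comparison solution to the solution, with a change of the normalization. -/
lemma tendsto_inv_smul_of_sub {E : Type*} [NormedAddCommGroup E] [NormedSpace ℂ E]
    {S U : ℕ → E} {r q : ℕ → ℝ} {c : ℝ} {l : E} (hr : ∀ᶠ n in atTop, 0 < r n)
    (h : Tendsto (fun n => ‖S n - U n‖ / r n) atTop (𝓝 0))
    (hU : Tendsto (fun n => ((r n : ℝ) : ℂ)⁻¹ • U n) atTop (𝓝 l))
    (hq : Tendsto (fun n => r n / q n) atTop (𝓝 c)) :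
    Tendsto (fun n => (1 / ((q n : ℝ) : ℂ)) • S n) atTop (𝓝 ((c : ℂ) • l)) := by
  have h1 : Tendsto (fun n => ((r n : ℝ) : ℂ)⁻¹ • (S n - U n)) atTop (𝓝 0) := by
    refine tendsto_zero_iff_norm_tendsto_zero.2 (h.congr' ?_)
    filter_upwards [hr] with n hn
    rw [norm_smul, norm_inv, Complex.norm_real, Real.norm_of_nonneg hn.le, div_eq_inv_mul]
  have h2 := ((Complex.continuous_ofReal.tendsto c).comp hq).smul (h1.add hU)
  rw [zero_add] at h2
  refine h2.congr' ?_
  filter_upwards [hr] with n hn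
  have : ((r n : ℝ) : ℂ) ≠ 0 := by exact_mod_cast hn.ne'
  rw [← smul_add, sub_add_cancel, smul_smul, Function.comp_apply, Complex.ofReal_div]
  congr 1
  field_simp

variable {k s b : ℕ} {A : Matrix (Fin k) (Fin k) ℤ}

/-- The integrand of the limit matrix is the rescaled orbit of the compression of `B`. -/
lemma sigmaIntegrand_eq_orbit (hb : 1 ≤ b) (hrow : ∀ i, ∑ j, A i j = b)
    (hΛ : coreIndex b A ≤ 1 / 2) (hk : 0 < k) (t : ℝ) :
    sigmaIntegrand s b A t
      = orbit (coreC A) (star (projHat b A) * matB s b A * projHat b A) b t := by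
  have h1 : star (projHat b A) = (projHat b A)ᵀ := conjTranspose_projHat hb hrow hΛ hk
  have h2 : star (coreC A) = (coreC A)ᵀ := conjTranspose_coreC
  have h3 : Complex.exp (-((b : ℂ) * (t : ℂ))) = ((Real.exp (-(b * t)) : ℝ) : ℂ) := by
    push_cast; rfl
  rw [sigmaIntegrand, orbit, star_flow, flow, flow, h1, h2, h3]
  congr 1
  simp only [mul_assoc]

/-- Below the critical index the flow on the range of `P̂` grows like `e^{σbt/2}` with `σ < 1`. -/
lemma exists_subcritical_rate (hb : 1 ≤ b) (hrow : ∀ i, ∑ j, A i j = b)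
    (hΛ : coreIndex b A < 1 / 2) (hk : 0 < k) :
    ∃ σ C : ℝ, 0 ≤ σ ∧ σ < 1 ∧ 0 ≤ C ∧ ∀ t, 0 ≤ t →
      ‖flow (coreC A) t * projHat b A‖ ^ 2 ≤ C * Real.exp (σ * (b * t)) := by
  have hb' : (0 : ℝ) < b := by exact_mod_cast hb
  have h : secondRe b A < b / 2 := by
    rw [coreIndex, div_lt_iff₀ hb'] at hΛ
    linarith
  obtain ⟨r, hr1, hr2⟩ := exists_between (max_lt h (half_pos hb'))
  obtain ⟨C, hC0, hC⟩ := exists_norm_flow_projHat_le hrow hk ((le_max_left _ _).trans_lt hr1)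
  have hr0 : 0 < r := (le_max_right _ _).trans_lt hr1
  refine ⟨2 * r / b, C, by positivity, ?_, hC0, fun t ht => (hC t ht).trans_eq ?_⟩
  · rw [div_lt_one hb']; linarith
  · congr 2
    field_simp

lemma integrableOn_orbit (hb : 1 ≤ b) (hrow : ∀ i, ∑ j, A i j = b)
    (hΛ : coreIndex b A < 1 / 2) (hk : 0 < k) (d : Matrix (Fin k) (Fin k) ℂ) :
    IntegrableOn (orbit (coreC A) (star (projHat b A) * d * projHat b A) b) (Set.Ioi 0)
      volume := by
  have hb' : (0 : ℝ) < b := by exact_mod_cast hb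
  obtain ⟨σ, C, -, hσ, hC0, hC⟩ := exists_subcritical_rate hb hrow hΛ hk
  have hi : IntegrableOn (fun t : ℝ => ‖d‖ * C * Real.exp (-((1 - σ) * b) * t)) (Set.Ioi 0) :=
    (exp_neg_integrableOn_Ioi 0 (mul_pos (sub_pos.2 hσ) hb')).const_mul _
  refine Integrable.mono' hi (continuous_orbit _ _ _).aestronglyMeasurable ?_
  filter_upwards [ae_restrict_mem measurableSet_Ioi] with t ht
  refine (norm_orbit_conj_le commute_projHat d (hC t (le_of_lt ht))).trans_eq ?_
  rw [show -((1 - σ) * b) * t = -(b * t) + σ * (b * t) by ring, Real.exp_add]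
  ring

lemma integrableOn_sigmaIntegrand (hb : 1 ≤ b) (hrow : ∀ i, ∑ j, A i j = b)
    (hΛ : coreIndex b A < 1 / 2) (hk : 0 < k) (i j : Fin k) :
    IntegrableOn (fun t : ℝ => sigmaIntegrand s b A t i j) (Set.Ioi 0) volume := by
  simp only [sigmaIntegrand_eq_orbit hb hrow hΛ.le hk]
  exact (LinearMap.toContinuousLinearMap (Matrix.entryLinearMap ℂ ℂ i j)).integrable_comp
    (integrableOn_orbit hb hrow hΛ hk (matB s b A))

lemma tendsto_orbitIntegral_sigmaSmall (hb : 1 ≤ b) (hrow : ∀ i, ∑ j, A i j = b)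
    (hΛ : coreIndex b A < 1 / 2) (hk : 0 < k) :
    Tendsto (orbitIntegral (coreC A) (star (projHat b A) * matB s b A * projHat b A) b) atTop
      (𝓝 (sigmaSmall s b A)) := by
  refine tendsto_pi_nhds.2 fun i => tendsto_pi_nhds.2 fun j => ?_
  have h := (intervalIntegral_tendsto_integral_Ioi (0 : ℝ)
    (integrableOn_sigmaIntegrand (s := s) hb hrow hΛ hk i j) tendsto_id).const_mul (b : ℂ)
  refine h.congr fun t => ?_
  have hc := (LinearMap.toContinuousLinearMap
    (Matrix.entryLinearMap ℂ ℂ i j : Matrix (Fin k) (Fin k) ℂ →ₗ[ℂ] ℂ)).intervalIntegral_comp_comm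
    ((continuous_orbit (coreC A) (star (projHat b A) * matB s b A * projHat b A)
      b).intervalIntegrable
      (μ := volume) 0 t)
  simp only [sigmaIntegrand_eq_orbit hb hrow hΛ.le hk]
  rw [orbitIntegral, Matrix.smul_apply, Complex.ofReal_natCast, smul_eq_mul]
  congr 1

/-- The limit of the rescaled orbit integral is the limit matrix of the critical case. -/
lemma tendsto_orbitIntegral_sigmaCritical (hb : 1 ≤ b) (hrow : ∀ i, ∑ j, A i j = b)
    (hΛ : coreIndex b A = 1 / 2) (hk : 0 < k) :
    Tendsto (fun t : ℝ => ((t : ℂ) ^ (2 * nuTwo b A + 1))⁻¹ •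
      orbitIntegral (coreC A) (star (projHat b A) * matB s b A * projHat b A) b t) atTop
      (𝓝 ((b : ℂ) ^ (2 * nuTwo b A + 1) • sigmaCritical s b A)) := by
  have hb' : (0 : ℝ) < b := by exact_mod_cast hb
  have hκ : secondRe b A = b / 2 := by
    rw [coreIndex, div_eq_iff hb'.ne'] at hΛ
    linarith
  have h := tendsto_orbitIntegral_critical (a := coreC A) (b := b) (N := k) (ν := nuTwo b A)
    (matB s b A) commute_projHat (projHat_eq_sum hrow hk)
    (fun z _ j hj => by
      rw [← Nat.sub_add_cancel hj.le, pow_add, mul_assoc, sub_pow_finrank_mul_specProj, mul_zero])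
    (fun z hz => hκ ▸ re_le_secondRe (mem_otherEigenvalues_of_mem hz))
    (fun z hz h j hj => sub_pow_mul_specProj_eq_zero _
      ((nilIndex_le_nuTwo hz (h.trans hκ.symm)).trans_lt hj)) nuTwo_le
  have hf : (coreC A).charpoly.roots.toFinset.filter (fun z => z.re = (b : ℝ) / 2)
      = (minorEigenvalues b A).filter (fun z => z.re = (b : ℝ) / 2) := by
    ext z
    simp only [Finset.mem_filter, mem_minorEigenvalues, Multiset.mem_toFinset]
    refine ⟨fun ⟨h1, h2⟩ => ⟨⟨?_, h1⟩, h2⟩, fun ⟨⟨_, h1⟩, h2⟩ => ⟨h1, h2⟩⟩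
    rintro rfl
    rw [Complex.natCast_re] at h2
    linarith
  have e : (b : ℂ) ^ (2 * nuTwo b A + 1) • sigmaCritical s b A
      = (((b : ℝ) : ℂ) / ((2 * (nuTwo b A : ℂ) + 1) * ((nuTwo b A).factorial : ℂ) ^ 2)) •
        ∑ z ∈ (minorEigenvalues b A).filter (fun z => z.re = (b : ℝ) / 2),
          star ((coreC A - z • 1) ^ nuTwo b A * specProj (coreC A) z) * matB s b A
            * ((coreC A - z • 1) ^ nuTwo b A * specProj (coreC A) z) := by
    rw [sigmaCritical, hf, smul_smul]
    congr 1
    · have : (b : ℂ) ≠ 0 := by exact_mod_cast hb'.ne'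
      have h2 : (2 * (nuTwo b A : ℂ) + 1) ≠ 0 := by
        exact_mod_cast (by omega : 2 * nuTwo b A + 1 ≠ 0)
      rw [pow_succ, Complex.ofReal_natCast]
      field_simp
    · refine Finset.sum_congr rfl fun z _ => ?_
      rw [← specProj_mul_specNil_pow, star_mul, star_pow]
      simp only [mul_assoc, Matrix.star_eq_conjTranspose]
  rw [e]
  exact h

end Limits

section Theorem

open scoped Matrix.Norms.L2Operator

variable {k s b : ℕ} {mode : Sampling} {M : (Fin k → ℕ) → Fin k → ℤ} {x₀ : Fin k → ℕ}
  {Ω : Type*} [MeasurableSpace Ω] {μ : Measure Ω} [IsProbabilityMeasure μ]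
  {Q : ℕ → Ω → Fin k → ℕ}

lemma tendsto_covMatrix_subcritical (hurn : IsUrn mode s b M x₀) (haff : IsAffine mode s M)
    (hQ : IsDrawSequence mode s M x₀ μ Q) (hΛ : coreIndex b (core s M) < 1 / 2) :
    Tendsto (fun n : ℕ => (1 / (n : ℂ)) • covMatrix M x₀ μ Q n) atTop
      (𝓝 (sigmaSmall s b (core s M))) := by
  have hb1 := hurn.one_le_b
  have hb : (0 : ℝ) < b := by exact_mod_cast hb1
  have hτ := one_le_initialTotal hurn
  have hT := tendsto_total (τ := initialTotal x₀) hb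
  obtain ⟨F, hF, hFlim⟩ := exists_recursion hurn haff hQ hΛ.le
  obtain ⟨K, hK0, hK⟩ := exists_norm_orbit_projHat_le hb1 hurn.sum_core hΛ.le hurn.pos
    (matB s b (core s M))
  obtain ⟨σ, C, hσ0, hσ, -, hC⟩ := exists_subcritical_rate hb1 hurn.sum_core hΛ hurn.pos
  have h := tendsto_sub_ansatz_subcritical hτ hb hK0 commute_projHat (projHat_mul_self _ _) hK
    hσ0 hσ hC hF (star_mul_covMatrix_mul hurn hQ hΛ.le) hFlim
  have hb0 : ((b : ℝ) : ℂ) ≠ 0 := by exact_mod_cast hb.ne'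
  have hU : Tendsto (fun n => ((total (initialTotal x₀) b n : ℝ) : ℂ)⁻¹ •
      ansatz (coreC (core s M)) (star (projHat b (core s M)) * matB s b (core s M)
        * projHat b (core s M)) b (total (initialTotal x₀) b n)) atTop
      (𝓝 (((b : ℝ) : ℂ)⁻¹ • sigmaSmall s b (core s M))) := by
    have h1 := ((tendsto_orbitIntegral_sigmaSmall (s := s) hb1 hurn.sum_core hΛ hurn.pos).comp
      ((Real.tendsto_log_atTop.comp hT).atTop_div_const hb)).const_smul (((b : ℝ) : ℂ)⁻¹)
    refine h1.congr fun n => ?_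
    have : ((total (initialTotal x₀) b n : ℝ) : ℂ) ≠ 0 := by
      exact_mod_cast (total_pos hτ hb n).ne'
    rw [ansatz, smul_smul, Complex.ofReal_div]
    simp only [Function.comp_apply]
    congr 1
    field_simp
  have hlim := tendsto_inv_smul_of_sub (hT.eventually_gt_atTop 0) h hU
    (tendsto_total_div (initialTotal x₀) b)
  rw [smul_smul, mul_inv_cancel₀ hb0, one_smul] at hlim
  simpa only [Complex.ofReal_natCast] using hlim

lemma tendsto_log_total_div_log (τ : ℝ) {b : ℝ} (hb : 0 < b) :
    Tendsto (fun n : ℕ => Real.log (total τ b n) / Real.log n) atTop (𝓝 1) := by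
  have hn : Tendsto (fun n : ℕ => Real.log n) atTop atTop :=
    Real.tendsto_log_atTop.comp tendsto_natCast_atTop_atTop
  have h := ((((Real.continuousAt_log hb.ne').tendsto.comp (tendsto_total_div τ b)).mul
    hn.inv_tendsto_atTop).add_const 1)
  rw [mul_zero, zero_add] at h
  refine h.congr' ?_
  filter_upwards [hn.eventually_gt_atTop 0, eventually_gt_atTop 0,
    (tendsto_total (τ := τ) hb).eventually_gt_atTop 0] with n h1 h2 h3
  simp only [Function.comp_apply, Pi.inv_apply]
  rw [Real.log_div h3.ne' (by positivity)]
  field_simp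
  ring

lemma tendsto_covMatrix_critical (hurn : IsUrn mode s b M x₀) (haff : IsAffine mode s M)
    (hQ : IsDrawSequence mode s M x₀ μ Q) (hΛ : coreIndex b (core s M) = 1 / 2) :
    Tendsto (fun n : ℕ => (1 / ((n : ℂ) *
        ((Real.log n ^ (2 * nuTwo b (core s M) + 1) : ℝ) : ℂ))) • covMatrix M x₀ μ Q n) atTop
      (𝓝 (sigmaCritical s b (core s M))) := by
  have hb1 := hurn.one_le_b
  have hb : (0 : ℝ) < b := by exact_mod_cast hb1
  have hτ := one_le_initialTotal hurn
  have hT := tendsto_total (τ := initialTotal x₀) hb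
  have hlog := Real.tendsto_log_atTop.comp hT
  obtain ⟨F, hF, hFlim⟩ := exists_recursion hurn haff hQ hΛ.le
  obtain ⟨K, hK0, hK⟩ := exists_norm_orbit_projHat_le hb1 hurn.sum_core hΛ.le hurn.pos
    (matB s b (core s M))
  obtain ⟨C, -, hC⟩ := exists_norm_flow_projHat_le_critical (b := b) hurn.sum_core hurn.pos (by
    rw [coreIndex, div_eq_iff hb.ne'] at hΛ
    linarith)
  have h := tendsto_sub_ansatz_critical hτ hb hK0 commute_projHat (projHat_mul_self _ _) hK
    hC hF (star_mul_covMatrix_mul hurn hQ hΛ.le) hFlim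
  set ν := nuTwo b (core s M)
  have hb0 : ((b : ℝ) : ℂ) ≠ 0 := by exact_mod_cast hb.ne'
  have hpos : ∀ᶠ n in atTop, 0 < total (initialTotal x₀) b n
      * Real.log (total (initialTotal x₀) b n) ^ (2 * ν + 1) := by
    filter_upwards [hT.eventually_gt_atTop 0, hlog.eventually_gt_atTop 0] with n h1 h2
    exact mul_pos h1 (pow_pos h2 _)
  have hU : Tendsto (fun n => ((total (initialTotal x₀) b n
      * Real.log (total (initialTotal x₀) b n) ^ (2 * ν + 1) : ℝ) : ℂ)⁻¹ •
      ansatz (coreC (core s M)) (star (projHat b (core s M)) * matB s b (core s M)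
        * projHat b (core s M)) b (total (initialTotal x₀) b n)) atTop
      (𝓝 ((((b : ℝ) : ℂ) ^ (2 * ν + 2))⁻¹ •
        ((b : ℂ) ^ (2 * ν + 1) • sigmaCritical s b (core s M)))) := by
    have h1 := ((tendsto_orbitIntegral_sigmaCritical (s := s) hb1 hurn.sum_core hΛ hurn.pos).comp
      (hlog.atTop_div_const hb)).const_smul (((b : ℝ) : ℂ) ^ (2 * ν + 2))⁻¹
    refine h1.congr' ?_
    filter_upwards [hT.eventually_gt_atTop 0, hlog.eventually_gt_atTop 0] with n h2 h3
    have h2' : ((total (initialTotal x₀) b n : ℝ) : ℂ) ≠ 0 := by exact_mod_cast h2.ne'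
    have h3' : ((Real.log (total (initialTotal x₀) b n) : ℝ) : ℂ) ≠ 0 := by
      exact_mod_cast (ne_of_gt h3)
    rw [ansatz, smul_smul]
    simp only [Function.comp_apply, smul_smul]
    congr 1
    have hb0' : (b : ℂ) ≠ 0 := by exact_mod_cast hb.ne'
    push_cast
    rw [div_pow, show 2 * ν + 2 = 2 * ν + 1 + 1 from rfl, pow_succ (b : ℂ) (2 * ν + 1)]
    field_simp
    simp only [ν]
  have hq : Tendsto (fun n : ℕ => total (initialTotal x₀) b n
      * Real.log (total (initialTotal x₀) b n) ^ (2 * ν + 1)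
      / (n * Real.log n ^ (2 * ν + 1))) atTop (𝓝 (b * 1 ^ (2 * ν + 1))) := by
    refine ((tendsto_total_div (initialTotal x₀) b).mul
      ((tendsto_log_total_div_log (initialTotal x₀) hb).pow (2 * ν + 1))).congr fun n => ?_
    rw [div_pow, div_mul_div_comm]
  have hlim := tendsto_inv_smul_of_sub hpos h hU hq
  have e : ((b * 1 ^ (2 * ν + 1) : ℝ) : ℂ) • (((b : ℝ) : ℂ) ^ (2 * ν + 2))⁻¹ •
        ((b : ℂ) ^ (2 * ν + 1) • sigmaCritical s b (core s M))
      = sigmaCritical s b (core s M) := by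
    rw [one_pow, mul_one, smul_smul, smul_smul, ← Complex.ofReal_natCast b]
    have : ((b : ℝ) : ℂ) * (((b : ℝ) : ℂ) ^ (2 * ν + 2))⁻¹ * ((b : ℝ) : ℂ) ^ (2 * ν + 1) = 1 := by
      field_simp
      ring
    rw [this, one_smul]
  rw [e] at hlim
  refine hlim.congr fun n => ?_
  rw [Complex.ofReal_mul, Complex.ofReal_natCast]

end Theorem

end MultiDrawUrn

theorem mainTheorem2 {k s b : ℕ} (mode : MultiDrawUrn.Sampling)
    (M : (Fin k → ℕ) → Fin k → ℤ) (x₀ : Fin k → ℕ)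
    (hurn : MultiDrawUrn.IsUrn mode s b M x₀)
    (haff : MultiDrawUrn.IsAffine mode s M)
    (hirr : MultiDrawUrn.IsIrreducibleCore s (MultiDrawUrn.core s M))
    {Ω : Type*} [MeasurableSpace Ω] (μ : Measure Ω) [IsProbabilityMeasure μ]
    (Q : ℕ → Ω → Fin k → ℕ) (hQ : MultiDrawUrn.IsDrawSequence mode s M x₀ μ Q) :
    (MultiDrawUrn.coreIndex b (MultiDrawUrn.core s M) < 1 / 2 →
      (∀ i j, IntegrableOn
        (fun t : ℝ => MultiDrawUrn.sigmaIntegrand s b (MultiDrawUrn.core s M) t i j)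
        (Set.Ioi 0) volume) ∧
      Tendsto (fun n : ℕ => (1 / (n : ℂ)) • MultiDrawUrn.covMatrix M x₀ μ Q n) atTop
        (𝓝 (MultiDrawUrn.sigmaSmall s b (MultiDrawUrn.core s M)))) ∧
    (MultiDrawUrn.coreIndex b (MultiDrawUrn.core s M) = 1 / 2 →
      Tendsto
        (fun n : ℕ =>
          (1 / ((n : ℂ) *
            ((Real.log n ^ (2 * MultiDrawUrn.nuTwo b (MultiDrawUrn.core s M) + 1) : ℝ) : ℂ))) •
              MultiDrawUrn.covMatrix M x₀ μ Q n) atTop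
        (𝓝 (MultiDrawUrn.sigmaCritical s b (MultiDrawUrn.core s M)))) := by
  exact ⟨fun hΛ =>
      ⟨MultiDrawUrn.integrableOn_sigmaIntegrand hurn.one_le_b hurn.sum_core hΛ hurn.pos,
        MultiDrawUrn.tendsto_covMatrix_subcritical hurn haff hQ hΛ⟩,
    MultiDrawUrn.tendsto_covMatrix_critical hurn haff hQ⟩
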